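/- Let $X\subseteq\mathbb A^1_{\mathbb C}$ be an open affine subset with coordinate $x$. For a finite set $I$ with an equivalence relation let $U(I)\subseteq X^I$ be the open set of points with $x_i\neq x_j$ whenever $i\not\sim j$, and put $S_X(I)=\Gamma(U(I),\mathcal O)$. If all elements of $I$ are equivalent, then $U(I)=X^I$. Write $I_1:I_2$ for $I_1\sqcup I_2$ with the disjoint union of the two equivalence relations, and $I_1,I_2$ for $I_1\sqcup I_2$ with all elements equivalent. A (unital) $(A,H,S_X)$-vertex algebra $\mathbb V$ is a singular commutative ring in functors from finite sets to complex vector spaces with compatible actions of $T(I)=\mathbb C[\partial_i]_{i\in I}$ and $S_X$. That is, it consists of the following data. * Left $\mathcal D$-modules $\mathcal V(I)$ on $X^I$, with global sections $V(I)$. * Functorial maps $\alpha_*:V(I)\to V(J)$ for all maps $\alpha:I\to J$ of finite sets, with $\alpha_*(sv)=\alpha_*(s)\,\alpha_*(v)$ and $\partial_j\alpha_*(v)=\alpha_*\big(\sum_{\alpha(i)=j}\partial_i v\big)$. * Extending $V$ to finite sets with an equivalence relation by $V(I)=V(\bar I)\otimes_{S_X(\bar I)}S_X(I)$, where $\bar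 I$ is the underlying set: multiplications $\mu_{I_1,I_2}:V(I_1)\otimes V(I_2)\to V(I_1:I_2)$ that commute with the actions of $T$ and $S_X$, are functorial for maps preserving inequivalence, and are associative and commutative. * A unit $S_X\to V$, compatible with $\alpha_*$, $T$ and $S_X$, such that for all finite sets $I,J$ and all $a\in S_X(I)$, $v\in V(J)$ the product of $a$ and $v$ is the image in $V(I:J)$ of $a\cdot v\in V(I,J)$. A vertex algebra over $X$ is a vertex algebra $(V,|0\rangle,T,Y)$ (with $[T,Y(v,z)]=Y(Tv,z)=\frac{d}{dz}Y(v,z)$) and a $\Gamma(X,\mathcal O_X)$-module structure on $V$ such that $T(gv)=g'v+gTv$ and $Y(gv,z)(hu)=g(x+z)h(x)Y(v,z)u$. Then $V$ is a left $\mathcal D$-module on $X$ through $\partial_x=T$. Let $\Delta:X\to X^2$ be the diagonal and $j:U\to X^2$ the inclusion of its complement. For a left $\mathcal D$-module $\mathcal N$ on $X$ we have $\Delta_*\mathcal N=j_*j^*(\mathcal O_X\boxtimes\mathcal N)/(\mathcal O_X\boxtimes\mathcal N)$, and for a right one $\Delta_!\mathcal N=j_*j^*(\omega_X\boxtimes\mathcal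 N)/(\omega_X\boxtimes\mathcal N)$. Let $\Psi_X$ send a vertex algebra $V$ over $X$ to the right $\mathcal D$-module $\mathcal V\otimes\omega_X$ with the chiral bracket that corresponds, after tensoring with $\omega$, to the map of left $\mathcal D$-modules $$\lambda^{ch}:j_*j^*(\mathcal V\boxtimes\mathcal V)\to\Delta_*\mathcal V,\qquad h\,(v\boxtimes u)\mapsto h\,Y(v,x_1-x_2)u \bmod \mathcal O_X\boxtimes\mathcal V ,\quad h\in S_X(1:2).$$ **Theorem.** Let $\mathbb V$ be an $(A,H,S_X)$-vertex algebra, let $\mathcal V=\mathcal V(1)$, $V=V(1)$, $\mathcal A=\mathcal V\otimes\omega_X$, and let $\alpha:\{1,2\}\to\{1\}$. There is a unique vertex algebra $\Phi_X(\mathbb V)$ over $X$ on the left $\mathcal D$-module $\mathcal V$ (so $T=\partial$) whose vacuum is the image of $1\in S_X(1)$ and whose vertex operators satisfy $$Y(v,z)u=\sum_{i\ge0}\tfrac1{i!}\,\alpha_*(\partial_1^{\,i}a)\,z^{i-N}\quad\text{whenever } N\ge 0,\ a\in V(1,2),\ \mu_{12}(v\otimes u)=(x_1-x_2)^{-N}a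 .$$ The chiral bracket $\mu^{ch}:j_*j^*(\mathcal A\boxtimes\mathcal A)\to\Delta_!\mathcal A$ of $\Psi_X(\Phi_X(\mathbb V))$ is equal to the map $\mu^{ch}_0$ that corresponds, after tensoring with $\omega$, to the composite $$\lambda_0^{ch}:\ j_*j^*(\mathcal V\boxtimes\mathcal V)\longrightarrow j_*j^*\mathcal V(1,2)\overset{\gamma}{\longrightarrow}\Delta_*\Delta^*\mathcal V(1,2)\longrightarrow\Delta_*\mathcal V$$ of maps of left $\mathcal D$-modules on $X^2$, where 1. the first map is the $S_X(1:2)$-linear extension of $\mu_{12}:V(1)\otimes V(2)\to V(1:2)=V(1,2)\otimes_{S_X(1,2)}S_X(1:2)$; 2. $\gamma$ is the canonical map, the last map of $0\to\Delta_*\Delta^!\mathcal V(1,2)\to\mathcal V(1,2)\to j_*j^*\mathcal V(1,2)\to\Delta_*\Delta^*\mathcal V(1,2)\to0$; explicitly $h\,m\mapsto\sum_{i\ge0}\frac1{i!}\big[h\,(x_1-x_2)^i\,(1\boxtimes\overline{\partial_1^{\,i}m})\big]$ for $h\in S_X(1:2)$, $m\in V(1,2)$, where $\overline{m}$ is the class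 of $m$ in $\Delta^*\mathcal V(1,2)$; 3. the last map is $\Delta_*(\widetilde\alpha)$, for the map $\widetilde\alpha:\Delta^*\mathcal V(1,2)\to\mathcal V$ induced by $\alpha_*:V(1,2)\to V(1)$. -/

import Mathlib

open scoped TensorProduct

set_option linter.unusedSectionVars false

noncomputable section

universe u v w

namespace AHS

/-! ### Derivations of localizations -/

section Derivations

variable {R : Type} [CommRing R] [Algebra ℂ R]

/-- The ring homomorphism `r ↦ r + d(r) ε` to the dual numbers of the localization. -/
def dualHom (M : Submonoid R) (d : Derivation ℂ R R) :
    R →+* TrivSqZeroExt (Localization M) (Localization M) where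
  toFun r := TrivSqZeroExt.inl (algebraMap R _ r) + TrivSqZeroExt.inr (algebraMap R _ (d r))
  map_one' := by ext <;> simp
  map_mul' a b := by
    ext
    · simp
    · simp only [Derivation.leibniz, TrivSqZeroExt.snd_add, TrivSqZeroExt.snd_inl,
        TrivSqZeroExt.snd_inr, TrivSqZeroExt.snd_mul, TrivSqZeroExt.fst_add,
        TrivSqZeroExt.fst_inl, TrivSqZeroExt.fst_inr, smul_eq_mul, map_mul, map_add,
        MulOpposite.smul_eq_mul_unop, MulOpposite.unop_op, zero_add, add_zero]
      ring
  map_zero' := by ext <;> simp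
  map_add' a b := by
    ext
    · simp
    · simp only [TrivSqZeroExt.snd_add, TrivSqZeroExt.snd_inl, TrivSqZeroExt.snd_inr, map_add,
        zero_add]

theorem dualHom_isUnit (M : Submonoid R) (d : Derivation ℂ R R) (m : M) :
    IsUnit (dualHom M d m) := by
  rw [TrivSqZeroExt.isUnit_iff_isUnit_fst]
  simpa [dualHom] using IsLocalization.map_units (Localization M) m

/-- The lift of `dualHom` to the localization. -/
def dualLift (M : Submonoid R) (d : Derivation ℂ R R) :
    Localization M →+* TrivSqZeroExt (Localization M) (Localization M) :=
  IsLocalization.lift (M := M) (dualHom_isUnit M d)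

theorem dualLift_algebraMap (M : Submonoid R) (d : Derivation ℂ R R) (r : R) :
    dualLift M d (algebraMap R _ r) = dualHom M d r :=
  IsLocalization.lift_eq _ r

theorem dualLift_fst (M : Submonoid R) (d : Derivation ℂ R R) (z : Localization M) :
    (dualLift M d z).fst = z := by
  have : (TrivSqZeroExt.fstHom (Localization M) (Localization M) (Localization M)).toRingHom.comp
      (dualLift M d) = RingHom.id _ := by
    refine IsLocalization.ringHom_ext M ?_
    ext r
    simp [dualLift_algebraMap, dualHom]
  exact RingHom.congr_fun this z

/-- The unique extension of a derivation of `R` to a localization of `R`. -/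
def locDer (M : Submonoid R) (d : Derivation ℂ R R) :
    Derivation ℂ (Localization M) (Localization M) :=
  Derivation.mk'
    { toFun := fun z => (dualLift M d z).snd
      map_add' := fun a b => by simp
      map_smul' := fun c a => by
        have h : (algebraMap ℂ (Localization M) c) = algebraMap R _ (algebraMap ℂ R c) :=
          IsScalarTower.algebraMap_apply ℂ R _ c
        simp only [Algebra.smul_def, map_mul, TrivSqZeroExt.snd_mul, dualLift_fst, h,
          dualLift_algebraMap, RingHom.id_apply]
        simp [dualHom] }
    (fun a b => by simp [dualLift_fst, mul_comm])

theorem locDer_algebraMap (M : Submonoid R) (d : Derivation ℂ R R) (r : R) :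
    locDer M d (algebraMap R _ r) = algebraMap R _ (d r) := by
  change (dualLift M d (algebraMap R _ r)).snd = _
  rw [dualLift_algebraMap]
  change TrivSqZeroExt.snd (TrivSqZeroExt.inl (algebraMap R (Localization M) r) +
    TrivSqZeroExt.inr (algebraMap R (Localization M) (d r))) = _
  rw [TrivSqZeroExt.snd_add, TrivSqZeroExt.snd_inl, TrivSqZeroExt.snd_inr, zero_add]

theorem locDer_comm (M : Submonoid R) (d e : Derivation ℂ R R)
    (h : ∀ r, d (e r) = e (d r)) (z : Localization M) :
    locDer M d (locDer M e z) = locDer M e (locDer M d z) := by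
  have hb : ∀ r : R, locDer M d (locDer M e (algebraMap R (Localization M) r)) =
      locDer M e (locDer M d (algebraMap R (Localization M) r)) := by
    intro r
    simp [locDer_algebraMap, h]
  obtain ⟨⟨p, m⟩, hz⟩ := IsLocalization.surj M z
  have hu : IsUnit (algebraMap R (Localization M) m) := IsLocalization.map_units _ m
  have h1 := hb p
  simp only at hz
  rw [← hz] at h1
  have h2 := hb m
  simp only [Derivation.leibniz, map_add, smul_eq_mul] at h1
  rw [h2] at h1
  refine hu.mul_left_cancel ?_
  linear_combination h1

end Derivations

/-! ### The coordinate rings of `X^I` and of its open subsets `U(I)` -/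

/-- The functions `f(x_i)`, `i ∈ I`, generate a multiplicative set; inverting it cuts out `X^I`
inside the affine space of dimension `I`, where `X ⊆ 𝔸¹` is the open affine set `f ≠ 0`. -/
def polyUnits (f : Polynomial ℂ) (I : Type) : Submonoid (MvPolynomial I ℂ) :=
  Submonoid.closure (Set.range fun i => Polynomial.aeval (MvPolynomial.X i) f)

/-- `S f I = Γ(X^I, 𝒪)`, where `X ⊆ 𝔸¹` is the open affine set `f ≠ 0`. -/
def S (f : Polynomial ℂ) (I : Type) : Type := Localization (polyUnits f I)

instance (f : Polynomial ℂ) (I : Type) : CommRing (S f I) :=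
  inferInstanceAs (CommRing (Localization _))

instance (f : Polynomial ℂ) (I : Type) : Algebra ℂ (S f I) :=
  inferInstanceAs (Algebra ℂ (Localization (polyUnits f I)))

instance (f : Polynomial ℂ) (I : Type) : Algebra (MvPolynomial I ℂ) (S f I) :=
  inferInstanceAs (Algebra _ (Localization (polyUnits f I)))

instance (f : Polynomial ℂ) (I : Type) : IsScalarTower ℂ (MvPolynomial I ℂ) (S f I) :=
  inferInstanceAs (IsScalarTower ℂ _ (Localization (polyUnits f I)))

instance (f : Polynomial ℂ) (I : Type) : IsLocalization (polyUnits f I) (S f I) :=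
  inferInstanceAs (IsLocalization _ (Localization (polyUnits f I)))

variable {f : Polynomial ℂ} {I J K : Type}

/-- The coordinate function `x_i` on `X^I`. -/
def S.x (i : I) : S f I := algebraMap (MvPolynomial I ℂ) _ (MvPolynomial.X i)

/-- The vector field `∂/∂x_i` on `X^I`. -/
def S.d (i : I) : Derivation ℂ (S f I) (S f I) :=
  locDer (polyUnits f I) (MvPolynomial.pderiv i)

theorem S.isUnit_aeval (i : I) : IsUnit (Polynomial.aeval (S.x i : S f I) f) := by
  have := IsLocalization.map_units (S f I)
    (⟨_, Submonoid.subset_closure ⟨i, rfl⟩⟩ : polyUnits f I)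
  have h2 : Polynomial.aeval (S.x i : S f I) f =
      algebraMap (MvPolynomial I ℂ) (S f I) (Polynomial.aeval (MvPolynomial.X i) f) := by
    rw [S.x, Polynomial.aeval_algebraMap_apply]
  rw [h2]
  exact this

theorem S.map_isUnit (α : I → J) (m : polyUnits f I) :
    IsUnit ((algebraMap (MvPolynomial J ℂ) (S f J)).comp
      (MvPolynomial.rename α).toRingHom m) := by
  obtain ⟨m, hm⟩ := m
  induction hm using Submonoid.closure_induction with
  | mem y hy =>
    obtain ⟨i, rfl⟩ := hy
    have := S.isUnit_aeval (f := f) (α i)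
    convert this
    simp [S.x, Polynomial.aeval_algebraMap_apply, ← Polynomial.aeval_algHom_apply]
  | one => simp
  | mul a b _ _ ha hb => simpa using ha.mul hb

/-- The map on global sections induced by `φ(α) : X^J → X^I`, i.e. `x_i ↦ x_{α i}`. -/
def S.map (α : I → J) : S f I →+* S f J :=
  IsLocalization.lift (M := polyUnits f I) (S.map_isUnit α)

theorem S.map_algebraMap (α : I → J) (p : MvPolynomial I ℂ) :
    S.map α (algebraMap _ (S f I) p) = algebraMap _ (S f J) (MvPolynomial.rename α p) :=
  IsLocalization.lift_eq _ _

@[simp] theorem S.map_x (α : I → J) (i : I) : S.map α (S.x i : S f I) = S.x (α i) := by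
  simp [S.x, S.map_algebraMap]

@[simp] theorem S.map_C (α : I → J) (c : ℂ) :
    S.map α (algebraMap ℂ (S f I) c) = algebraMap ℂ (S f J) c := by
  rw [IsScalarTower.algebraMap_apply ℂ (MvPolynomial I ℂ), S.map_algebraMap,
    IsScalarTower.algebraMap_apply ℂ (MvPolynomial J ℂ) (S f J)]
  simp [MvPolynomial.algebraMap_eq]

/-- Induction principle: a property of functions on `X^I` that holds for constants and
coordinates and passes to sums, products and inverses holds always. -/
theorem S.induction {p : S f I → Prop} (hC : ∀ c : ℂ, p (algebraMap ℂ _ c))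
    (hx : ∀ i, p (S.x i)) (hadd : ∀ a b, p a → p b → p (a + b))
    (hmul : ∀ a b, p a → p b → p (a * b))
    (hinv : ∀ a b, a * b = 1 → p a → p b) (s : S f I) : p s := by
  have hpoly : ∀ q : MvPolynomial I ℂ, p (algebraMap _ _ q) := by
    intro q
    induction q using MvPolynomial.induction_on with
    | C c =>
      have := hC c
      rwa [IsScalarTower.algebraMap_apply ℂ (MvPolynomial I ℂ)] at this
    | add a b ha hb => rw [map_add]; exact hadd _ _ ha hb
    | mul_X a i ha => rw [map_mul]; exact hmul _ _ ha (hx i)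
  obtain ⟨⟨q, m⟩, hz⟩ := IsLocalization.surj (polyUnits f I) s
  obtain ⟨t, ht⟩ := (IsLocalization.map_units (S f I) m).exists_right_inv
  have h1 : s = algebraMap _ _ q * t := by
    rw [← hz, mul_assoc]
    simp only at ht ⊢
    rw [ht, mul_one]
  rw [h1]
  exact hmul _ _ (hpoly q) (hinv _ _ ht (hpoly _))

@[simp] theorem S.d_C (i : I) (c : ℂ) : S.d i (algebraMap ℂ (S f I) c) = 0 :=
  Derivation.map_algebraMap _ _

@[simp] theorem S.d_one (i : I) : S.d i (1 : S f I) = 0 := Derivation.map_one_eq_zero _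

theorem S.d_x [DecidableEq I] (i j : I) :
    S.d i (S.x j : S f I) = if i = j then 1 else 0 := by
  have := locDer_algebraMap (polyUnits f I) (MvPolynomial.pderiv i) (MvPolynomial.X j)
  change S.d i (S.x j) = _ at this
  rw [this, MvPolynomial.pderiv_X]
  by_cases h : i = j
  · subst h
    rw [if_pos rfl, Pi.single_eq_same]
    exact map_one (algebraMap (MvPolynomial I ℂ) (S f I))
  · rw [if_neg h, Pi.single_eq_of_ne (Ne.symm h)]
    exact map_zero (algebraMap (MvPolynomial I ℂ) (S f I))

theorem pderiv_comm (i j : I) (p : MvPolynomial I ℂ) :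
    MvPolynomial.pderiv i (MvPolynomial.pderiv j p) =
      MvPolynomial.pderiv j (MvPolynomial.pderiv i p) := by
  classical
  induction p using MvPolynomial.induction_on with
  | C c => simp
  | add a b ha hb => simp [ha, hb]
  | mul_X a k ha =>
    have hX : ∀ l m : I, MvPolynomial.pderiv l
        (MvPolynomial.pderiv m (MvPolynomial.X k : MvPolynomial I ℂ)) = 0 := by
      intro l m
      rw [MvPolynomial.pderiv_X]
      by_cases h : k = m
      · subst h; simp
      · rw [Pi.single_eq_of_ne h, map_zero]
    simp only [Derivation.leibniz, map_add, smul_eq_mul, ha, hX]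
    ring

theorem S.d_comm (i j : I) (s : S f I) : S.d i (S.d j s) = S.d j (S.d i s) :=
  locDer_comm _ _ _ (fun r => pderiv_comm i j r) s

theorem S.map_id (s : S f I) : S.map id s = s := by
  induction s using S.induction with
  | hC c => simp
  | hx i => simp
  | hadd a b ha hb => simp [ha, hb]
  | hmul a b ha hb => simp [ha, hb]
  | hinv a b h ha =>
    have h2 := congrArg (S.map id) h
    rw [map_mul, map_one, ha] at h2
    exact (IsUnit.of_mul_eq_one _ h).mul_left_cancel (h2.trans h.symm)

theorem S.map_map (α : I → J) (β : J → K) (s : S f I) :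
    S.map β (S.map α s) = S.map (β ∘ α) s := by
  induction s using S.induction with
  | hC c => simp
  | hx i => simp
  | hadd a b ha hb => simp [ha, hb]
  | hmul a b ha hb => simp [ha, hb]
  | hinv a b h ha =>
    have h2 := congrArg (fun s => S.map β (S.map α s)) h
    have h3 := congrArg (S.map (β ∘ α)) h
    simp only [map_mul, map_one] at h2 h3
    rw [ha] at h2
    exact (IsUnit.of_mul_eq_one _ h3).mul_left_cancel (h2.trans h3.symm)

/-- The fibre `α⁻¹(j)` as a finite set. -/
def fiber [Finite I] (α : I → J) (j : J) : Finset I := (Set.toFinite (α ⁻¹' {j})).toFinset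

@[simp] theorem mem_fiber [Finite I] (α : I → J) (j : J) (i : I) :
    i ∈ fiber α j ↔ α i = j := by
  simp [fiber]

/-- The chain rule: `∂_j (α_* s) = α_* (∑_{i ∈ α⁻¹(j)} ∂_i s)`. -/
theorem S.d_map [Finite I] (α : I → J) (j : J) (s : S f I) :
    S.d j (S.map α s) = S.map α (∑ i ∈ fiber α j, S.d i s) := by
  classical
  induction s using S.induction with
  | hC c => simp
  | hx i =>
    simp only [S.map_x, S.d_x, Finset.sum_ite_eq', mem_fiber]
    by_cases h : j = α i
    · simp [h]
    · simp [h, Ne.symm h]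
  | hadd a b ha hb => simp [ha, hb, Finset.sum_add_distrib]
  | hmul a b ha hb =>
    simp only [map_mul, Derivation.leibniz, smul_eq_mul, ha, hb, Finset.sum_add_distrib,
      ← Finset.mul_sum, map_add]
  | hinv a b h ha =>
    have h1 : S.map α a * S.map α b = 1 := by rw [← map_mul, h, map_one]
    have h2 := congrArg (S.d j) h1
    rw [Derivation.leibniz, ha, Derivation.map_one_eq_zero] at h2
    have h3 : ∑ i ∈ fiber α j, S.d i (a * b) = 0 := by
      simp [h]
    simp only [Derivation.leibniz, smul_eq_mul, Finset.sum_add_distrib, ← Finset.mul_sum] at h3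
    have h4 := congrArg (S.map α) h3
    rw [map_add, map_mul, map_mul, map_zero] at h4
    simp only [smul_eq_mul] at h2
    refine (IsUnit.of_mul_eq_one _ h1).mul_left_cancel ?_
    exact add_right_cancel (h2.trans h4.symm)

/-- Inverting these functions on `X^I` cuts out the open subset `U(I) ⊆ X^I` of points with
`x_i ≠ x_j` whenever `i` and `j` are inequivalent. -/
def diffs (f : Polynomial ℂ) {I : Type} (r : Setoid I) : Submonoid (S f I) :=
  Submonoid.closure {s | ∃ i j, ¬ r i j ∧ s = S.x i - S.x j}

/-- `U f r = Γ(U(I), 𝒪)` for the finite set `I` with the equivalence relation `r`. -/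
def U (f : Polynomial ℂ) {I : Type} (r : Setoid I) : Type := Localization (diffs f r)

instance (r : Setoid I) : CommRing (U f r) := inferInstanceAs (CommRing (Localization _))

instance (r : Setoid I) : Algebra (S f I) (U f r) :=
  inferInstanceAs (Algebra _ (Localization (diffs f r)))

instance (r : Setoid I) : Algebra ℂ (U f r) :=
  inferInstanceAs (Algebra _ (Localization (diffs f r)))

instance (r : Setoid I) : IsLocalization (diffs f r) (U f r) :=
  inferInstanceAs (IsLocalization _ (Localization (diffs f r)))

/-- The vector field `∂/∂x_i` acting on functions on `U(I)`. -/
def U.d {r : Setoid I} (i : I) : Derivation ℂ (U f r) (U f r) :=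
  locDer (diffs f r) (S.d i)

theorem U.d_algebraMap {r : Setoid I} (i : I) (s : S f I) :
    U.d i (algebraMap _ (U f r) s) = algebraMap _ (U f r) (S.d i s) :=
  locDer_algebraMap _ _ _

theorem U.d_comm {r : Setoid I} (i j : I) (s : U f r) : U.d i (U.d j s) = U.d j (U.d i s) :=
  locDer_comm _ _ _ (fun t => S.d_comm i j t) s

theorem U.isUnit_sub {r : Setoid I} {i j : I} (h : ¬ r i j) :
    IsUnit (algebraMap (S f I) (U f r) (S.x i - S.x j)) :=
  IsLocalization.map_units (U f r)
    (⟨_, Submonoid.subset_closure ⟨i, j, h, rfl⟩⟩ : diffs f r)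

/-- Morphisms of finite sets with equivalence relations: maps preserving inequivalence. -/
def PresNEq (r : Setoid I) (s : Setoid J) (α : I → J) : Prop :=
  ∀ i i', s (α i) (α i') → r i i'

theorem U.map_le {r : Setoid I} {s : Setoid J} {α : I → J} (h : PresNEq r s α) :
    diffs f r ≤ (diffs f s).comap (S.map α) := by
  refine Submonoid.closure_le.2 ?_
  rintro _ ⟨i, j, hij, rfl⟩
  simp only [Submonoid.coe_comap, Set.mem_preimage, map_sub, S.map_x, SetLike.mem_coe]
  exact Submonoid.subset_closure ⟨α i, α j, fun h' => hij (h _ _ h'), rfl⟩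

/-- The map on sections induced by `φ_U(α) : U(J) → U(I)`. -/
def U.map {r : Setoid I} {s : Setoid J} (α : I → J) (h : PresNEq r s α) : U f r →+* U f s :=
  IsLocalization.map (M := diffs f r) (T := diffs f s) (U f s) (S.map α) (U.map_le h)

theorem U.map_algebraMap {r : Setoid I} {s : Setoid J} (α : I → J) (h : PresNEq r s α)
    (a : S f I) :
    U.map α h (algebraMap _ (U f r) a) = algebraMap _ (U f s) (S.map α a) :=
  IsLocalization.map_eq (M := diffs f r) (T := diffs f s) (U.map_le h) a

/-- The disjoint union of two equivalence relations. -/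
def sumSetoid (r : Setoid I) (s : Setoid J) : Setoid (I ⊕ J) where
  r := Sum.LiftRel r s
  iseqv :=
    { refl := by rintro (i | j); exacts [.inl (r.refl' i), .inr (s.refl' j)]
      symm := by rintro _ _ (h | h); exacts [.inl (r.symm' h), .inr (s.symm' h)]
      trans := by
        rintro _ _ _ (h | h) (h' | h')
        exacts [.inl (r.trans' h h'), .inr (s.trans' h h')] }

theorem presNEq_inl (r : Setoid I) (s : Setoid J) : PresNEq r (sumSetoid r s) Sum.inl := by
  rintro i i' (h | h); exact h

theorem presNEq_inr (r : Setoid I) (s : Setoid J) : PresNEq s (sumSetoid r s) Sum.inr := by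
  rintro i i' (h | h); exact h

theorem presNEq_map {I' J' : Type} {r : Setoid I} {s : Setoid J} {r' : Setoid I'}
    {s' : Setoid J'} {α : I → I'} {β : J → J'} (hα : PresNEq r r' α) (hβ : PresNEq s s' β) :
    PresNEq (sumSetoid r s) (sumSetoid r' s') (Sum.map α β) := by
  rintro (i | i) (j | j) h <;> cases h
  · exact .inl (hα _ _ ‹_›)
  · exact .inr (hβ _ _ ‹_›)

theorem presNEq_swap (r : Setoid I) (s : Setoid J) :
    PresNEq (sumSetoid r s) (sumSetoid s r) Sum.swap := by
  rintro (i | i) (j | j) h <;> cases h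
  · exact .inl ‹_›
  · exact .inr ‹_›

theorem presNEq_assoc (r : Setoid I) (s : Setoid J) (t : Setoid K) :
    PresNEq (sumSetoid (sumSetoid r s) t) (sumSetoid r (sumSetoid s t))
      (Equiv.sumAssoc I J K) := by
  rintro ((i | i) | i) ((j | j) | j) h
  · cases h; exact .inl (.inl ‹_›)
  · cases h
  · cases h
  · cases h
  · cases h; rename_i h; cases h; exact .inl (.inr ‹_›)
  · cases h; rename_i h; cases h
  · cases h
  · cases h; rename_i h; cases h
  · cases h; rename_i h; cases h; exact .inr ‹_›

/-- Every map is a morphism when all elements of the source are equivalent. -/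
theorem presNEq_top (s : Setoid J) (α : I → J) : PresNEq (⊤ : Setoid I) s α :=
  fun _ _ _ => trivial

/-! ### Operators on a base change -/

section OpBase

variable {R R' M : Type*} [CommRing R] [CommRing R'] [Algebra R R'] [AddCommGroup M] [Module R M]

/-- The operator `s ⊗ m ↦ ε d'(s) ⊗ m + s ⊗ D m` on `R' ⊗ M`. -/
def opBase (ε : ℤˣ) (d : R → R) (d' : R' →+ R') (D : M →+ M)
    (hd : ∀ a, d' (algebraMap R R' a) = algebraMap R R' (d a))
    (hL : ∀ a b, d' (a * b) = a * d' b + b * d' a)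
    (hD : ∀ a m, D (a • m) = (ε : ℤ) • (d a • m) + a • D m) : R' ⊗[R] M →+ R' ⊗[R] M :=
  TensorProduct.liftAddHom
    (AddMonoidHom.mk' (fun s => AddMonoidHom.mk'
      (fun m => (ε : ℤ) • (d' s ⊗ₜ[R] m) + s ⊗ₜ[R] D m)
      (fun a b => by simp only [map_add, TensorProduct.tmul_add, smul_add]; abel))
      (fun a b => by
        ext m
        simp only [map_add, TensorProduct.add_tmul, smul_add, AddMonoidHom.mk'_apply,
          AddMonoidHom.add_apply]
        abel))
    (fun a s m => by
      simp only [AddMonoidHom.mk'_apply, Algebra.smul_def, hL, hd, hD, TensorProduct.tmul_add,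
        TensorProduct.add_tmul, smul_add, TensorProduct.tmul_smul]
      rw [TensorProduct.smul_tmul' a (d' s) m, TensorProduct.smul_tmul' a s (D m),
        TensorProduct.smul_tmul' (d a) s m]
      simp only [Algebra.smul_def, mul_comm]
      abel)

variable (ε : ℤˣ) (d : R → R) (d' : R' →+ R') (D : M →+ M)
    (hd : ∀ a, d' (algebraMap R R' a) = algebraMap R R' (d a))
    (hL : ∀ a b, d' (a * b) = a * d' b + b * d' a)
    (hD : ∀ a m, D (a • m) = (ε : ℤ) • (d a • m) + a • D m)

theorem opBase_tmul (s : R') (m : M) : opBase ε d d' D hd hL hD (s ⊗ₜ m) =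
    (ε : ℤ) • (d' s ⊗ₜ[R] m) + s ⊗ₜ[R] D m := rfl

theorem opBase_smul (t : R') (z : R' ⊗[R] M) : opBase ε d d' D hd hL hD (t • z) =
    (ε : ℤ) • (d' t • z) + t • opBase ε d d' D hd hL hD z := by
  induction z using TensorProduct.induction_on with
  | zero => simp
  | add a b ha hb => simp only [smul_add, map_add, ha, hb]; abel
  | tmul s m =>
    simp only [TensorProduct.smul_tmul', opBase_tmul, smul_eq_mul, hL, TensorProduct.add_tmul,
      smul_add, mul_comm s,
      TensorProduct.smul_tmul']
    rw [mul_smul_comm]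
    abel

theorem opBase_comm (d₂ : R → R) (d₂' : R' →+ R') (D₂ : M →+ M)
    (hd₂ : ∀ a, d₂' (algebraMap R R' a) = algebraMap R R' (d₂ a))
    (hL₂ : ∀ a b, d₂' (a * b) = a * d₂' b + b * d₂' a)
    (hD₂ : ∀ a m, D₂ (a • m) = (ε : ℤ) • (d₂ a • m) + a • D₂ m)
    (h : ∀ s, d' (d₂' s) = d₂' (d' s)) (h' : ∀ m, D (D₂ m) = D₂ (D m)) (z : R' ⊗[R] M) :
    opBase ε d d' D hd hL hD (opBase ε d₂ d₂' D₂ hd₂ hL₂ hD₂ z) =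
      opBase ε d₂ d₂' D₂ hd₂ hL₂ hD₂ (opBase ε d d' D hd hL hD z) := by
  induction z using TensorProduct.induction_on with
  | zero => simp
  | add a b ha hb => simp only [map_add, ha, hb]
  | tmul s m =>
    simp only [opBase_tmul, map_add, map_zsmul, h, h', smul_add]
    abel

end OpBase

/-! ### D-modules on `X^I`, given by their global sections -/

/-- For `ε = 1`, a left `𝒟`-module on `X^I`: a module over `Γ(X^I, 𝒪)` with commuting operators
`∂_i` satisfying the Leibniz rule `∂_i (s m) = ∂_i(s) m + s ∂_i m`.

For `ε = -1`, a right `𝒟`-module on `X^I`: here `D i m` is `m ⬝ ∂_i`, and the relation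
`∂_i s = s ∂_i + ∂_i(s)` reads `(s m) ⬝ ∂_i = s (m ⬝ ∂_i) - ∂_i(s) m`. -/
structure DMod (f : Polynomial ℂ) (I : Type) (ε : ℤˣ) where
  carrier : Type u
  [addCommGroup : AddCommGroup carrier]
  [module : Module (S f I) carrier]
  D : I → carrier →+ carrier
  D_comm : ∀ i j m, D i (D j m) = D j (D i m)
  D_smul : ∀ i (s : S f I) m, D i (s • m) = (ε : ℤ) • (S.d i s • m) + s • D i m

attribute [instance] DMod.addCommGroup DMod.module

instance {ε : ℤˣ} : CoeSort (DMod.{u} f I ε) (Type u) := ⟨DMod.carrier⟩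

/-- Left `𝒟`-modules on `X^I`. -/
abbrev LeftDMod (f : Polynomial ℂ) (I : Type) := DMod.{u} f I 1

/-- Right `𝒟`-modules on `X^I`. -/
abbrev RightDMod (f : Polynomial ℂ) (I : Type) := DMod.{u} f I (-1)

namespace DMod

/-- Morphisms of `𝒟`-modules. -/
@[ext] structure Hom {ε : ℤˣ} (M : DMod.{u} f I ε) (N : DMod.{v} f I ε) extends M →ₗ[S f I] N where
  map_D : ∀ i m, toFun (M.D i m) = N.D i (toFun m)

instance {ε : ℤˣ} (M : DMod.{u} f I ε) (N : DMod.{v} f I ε) : CoeFun (Hom M N) (fun _ => M → N) :=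
  ⟨fun φ => φ.toLinearMap⟩

/-- Composition of morphisms of `𝒟`-modules. -/
def Hom.comp {ε : ℤˣ} {M : DMod.{u} f I ε} {N : DMod.{v} f I ε} {P : DMod.{w} f I ε} (ψ : Hom N P) (φ : Hom M N) : Hom M P where
  toLinearMap := ψ.toLinearMap ∘ₗ φ.toLinearMap
  map_D i m := by
    have h1 := φ.map_D i m
    have h2 := ψ.map_D i (φ.toLinearMap m)
    simp only [AddHom.toFun_eq_coe, LinearMap.coe_toAddHom, LinearMap.comp_apply] at h1 h2 ⊢
    rw [h1, h2]

theorem Hom.apply_D {ε : ℤˣ} {M : DMod.{u} f I ε} {N : DMod.{v} f I ε} (φ : Hom M N) (i : I) (m : M) :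
    φ (M.D i m) = N.D i (φ m) := φ.map_D i m

/-- The left `𝒟`-module `𝒪` for `ε = 1`; the right `𝒟`-module `ω = 𝒪 dx` for `ε = -1`, with
`(s dx) ⬝ ∂_i = - ∂_i(s) dx`. -/
def one (f : Polynomial ℂ) (I : Type) (ε : ℤˣ) : DMod.{0} f I ε where
  carrier := S f I
  D i := (ε : ℤ) • (S.d i : Derivation ℂ (S f I) (S f I)).toLinearMap.toAddMonoidHom
  D_comm i j m := by
    simp [S.d_comm i j]
  D_smul i s m := by
    simp [Derivation.leibniz, smul_add]
    ring

/-- The right `𝒟`-module `M ⊗ ω` of a left `𝒟`-module `M`. An element `m` of the carrier stands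
for `m dx_1 ∧ ⋯ ∧ dx_n`, and `(m dx) ⬝ ∂_i = - (∂_i m) dx`. -/
def toRight (M : LeftDMod.{u} f I) : RightDMod.{u} f I where
  carrier := M
  D i := - M.D i
  D_comm i j m := by simp [M.D_comm i j]
  D_smul i s m := by simp [M.D_smul]; abel

/-! #### Inverse images -/

/-- The ring `Γ(X^J, 𝒪)` as an algebra over `Γ(X^I, 𝒪)` via `φ(α) : X^J → X^I`. -/
def SAlong (f : Polynomial ℂ) {I J : Type} (_α : I → J) : Type := S f J

instance (α : I → J) : CommRing (SAlong f α) := inferInstanceAs (CommRing (S f J))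

instance (α : I → J) : Algebra (S f I) (SAlong f α) := (S.map (f := f) α).toAlgebra

/-- Underlying module of the inverse image along `φ(α)`. -/
def PullC {ε : ℤˣ} (α : I → J) (M : DMod.{u} f I ε) : Type u := SAlong f α ⊗[S f I] M

instance {ε : ℤˣ} (α : I → J) (M : DMod.{u} f I ε) : AddCommGroup (PullC α M) :=
  inferInstanceAs (AddCommGroup (SAlong f α ⊗[S f I] M))

instance {ε : ℤˣ} (α : I → J) (M : DMod.{u} f I ε) : Module (S f J) (PullC α M) :=
  inferInstanceAs (Module (SAlong f α) (SAlong f α ⊗[S f I] M))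

/-- The inverse image `φ(α)^* M = Γ(X^J, 𝒪) ⊗ M` along `φ(α) : X^J → X^I`; the vector field
`∂_j` acts by `∂_j ⊗ id + id ⊗ ∑_{i ∈ α⁻¹(j)} ∂_i`. -/
def pull {ε : ℤˣ} [Finite I] (α : I → J) (M : DMod.{u} f I ε) : DMod.{u} f J ε where
  carrier := PullC α M
  D j := opBase (R := S f I) (R' := SAlong f α) ε (fun s => ∑ i ∈ fiber α j, S.d i s)
    (S.d j : Derivation ℂ (S f J) (S f J)).toLinearMap.toAddMonoidHom (∑ i ∈ fiber α j, M.D i)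
    (fun a => S.d_map α j a) (fun a b => Derivation.leibniz (S.d j : Derivation ℂ (S f J) (S f J)) a b)
    (fun a m => by
      simp only [AddMonoidHom.finsetSum_apply, M.D_smul, Finset.sum_add_distrib,
        ← Finset.smul_sum, Finset.sum_smul])
  D_comm i j z := by
    refine opBase_comm _ _ _ _ _ _ _ _ _ _ _ _ _ ?_ ?_ z
    · intro s
      exact S.d_comm (f := f) i j s
    · intro m
      simp only [AddMonoidHom.finsetSum_apply, map_sum]
      rw [Finset.sum_comm]
      simp only [M.D_comm]
  D_smul j s z := opBase_smul (R' := SAlong f α) _ _ _ _ _ _ _ s z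

/-- The element `s ⊗ m` of an inverse image. -/
def pullMk {ε : ℤˣ} [Finite I] (α : I → J) {M : DMod.{u} f I ε} (s : S f J) (m : M) : pull α M :=
  TensorProduct.tmul (S f I) (M := SAlong f α) (N := M) s m

section pull

variable {ε : ℤˣ} [Finite I] (α : I → J) {M : DMod.{u} f I ε}

theorem pull_induction {p : pull α M → Prop} (h0 : p 0) (hm : ∀ s m, p (pullMk α s m))
    (ha : ∀ a b, p a → p b → p (a + b)) (z : pull α M) : p z :=
  TensorProduct.induction_on (R := S f I) (M := SAlong f α) (N := M) (motive := p) z h0 hm ha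

theorem smul_pullMk (t s : S f J) (m : M) : t • pullMk α s m = pullMk α (t * s) m := rfl

theorem pullMk_add (s : S f J) (m n : M) :
    pullMk α s (m + n) = pullMk α s m + pullMk α s n :=
  TensorProduct.tmul_add (R := S f I) (M := SAlong f α) s m n

theorem pullMk_smul (s : S f J) (a : S f I) (m : M) :
    pullMk α s (a • m) = pullMk α (s * S.map α a) m := by
  have := TensorProduct.smul_tmul (R := S f I) (M := SAlong f α) (N := M) a s m
  rw [mul_comm]
  exact this.symm

theorem pullMk_zero (s : S f J) : pullMk α s (0 : M) = 0 :=
  TensorProduct.tmul_zero (R := S f I) (M := SAlong f α) (N := M) s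

theorem pullMk_zero_left (m : M) : pullMk α (0 : S f J) m = 0 :=
  TensorProduct.zero_tmul (R := S f I) (M := SAlong f α) (N := M) m

theorem D_pullMk (j : J) (s : S f J) (m : M) : (pull α M).D j (pullMk α s m) =
    (ε : ℤ) • pullMk α (S.d j s) m + pullMk α s (∑ i ∈ fiber α j, M.D i m) := by
  have := opBase_tmul (R := S f I) (R' := SAlong f α) ε (fun s => ∑ i ∈ fiber α j, S.d i s)
    (S.d j : Derivation ℂ (S f J) (S f J)).toLinearMap.toAddMonoidHom (∑ i ∈ fiber α j, M.D i)
    (fun a => S.d_map α j a) (fun a b => Derivation.leibniz (S.d j : Derivation ℂ (S f J) (S f J)) a b)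
    (fun a m => by
      simp only [AddMonoidHom.finsetSum_apply, M.D_smul, Finset.sum_add_distrib,
        ← Finset.smul_sum, Finset.sum_smul]) s m
  rw [AddMonoidHom.finsetSum_apply] at this
  exact this

theorem D_pullMk_one (j : J) (m : M) : (pull α M).D j (pullMk α 1 m) =
    pullMk α 1 (∑ i ∈ fiber α j, M.D i m) := by
  rw [D_pullMk, S.d_one, pullMk_zero_left, smul_zero, zero_add]

/-- The additive map underlying `pullLift`. -/
def pullLiftAdd {T : Type*} [AddCommGroup T] [Module (S f J) T] (φ : M →+ T)
    (hφ : ∀ (a : S f I) m, φ (a • m) = S.map α a • φ m) : pull α M →+ T :=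
  TensorProduct.liftAddHom (R := S f I) (M := SAlong f α) (N := M)
    (AddMonoidHom.mk' (fun s : S f J => (DistribSMul.toAddMonoidHom T s).comp φ)
      (fun a b => by ext m; exact add_smul (R := S f J) (M := T) a b (φ m)))
    (fun a s m => by
      let s' : S f J := s
      change (S.map α a * s') • φ m = s' • φ (a • m)
      rw [hφ, smul_smul, mul_comm])

/-- The universal property of the inverse image as a module. -/
def pullLift {T : Type*} [AddCommGroup T] [Module (S f J) T] (φ : M →+ T)
    (hφ : ∀ (a : S f I) m, φ (a • m) = S.map α a • φ m) : pull α M →ₗ[S f J] T where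
  toFun := pullLiftAdd α φ hφ
  map_add' a b := map_add _ _ _
  map_smul' t z := by
    induction z using pull_induction with
    | h0 => rw [smul_zero, map_zero, smul_zero]
    | ha a b h1 h2 => rw [smul_add, map_add, h1, h2, map_add, smul_add]
    | hm s m => exact mul_smul t s (φ m)

theorem pull_ext {T : Type*} [AddCommGroup T] [Module (S f J) T] {φ ψ : pull α M →ₗ[S f J] T}
    (h : ∀ s m, φ (pullMk α s m) = ψ (pullMk α s m)) : φ = ψ := by
  ext z
  induction z using pull_induction with
  | h0 => simp only [map_zero]
  | ha a b h1 h2 => rw [map_add, map_add, h1, h2]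
  | hm s m => exact h s m

theorem pullLift_mk {T : Type*} [AddCommGroup T] [Module (S f J) T] (φ : M →+ T)
    (hφ : ∀ (a : S f I) m, φ (a • m) = S.map α a • φ m) (s : S f J) (m : M) :
    pullLift α φ hφ (pullMk α s m) = s • φ m := rfl

end pull

/-! #### External tensor products -/

/-- Underlying module of the external tensor product. -/
def BoxC {ε : ℤˣ} [Finite I] [Finite J] (M : DMod.{u} f I ε) (N : DMod.{v} f J ε) :
    Type (max u v) :=
  pull (J := I ⊕ J) Sum.inl M ⊗[S f (I ⊕ J)] pull (J := I ⊕ J) Sum.inr N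

instance {ε : ℤˣ} [Finite I] [Finite J] (M : DMod.{u} f I ε) (N : DMod.{v} f J ε) :
    AddCommGroup (BoxC M N) := inferInstanceAs (AddCommGroup (_ ⊗[S f (I ⊕ J)] _))

instance {ε : ℤˣ} [Finite I] [Finite J] (M : DMod.{u} f I ε) (N : DMod.{v} f J ε) :
    Module (S f (I ⊕ J)) (BoxC M N) :=
  inferInstanceAs (Module (S f (I ⊕ J)) (_ ⊗[S f (I ⊕ J)] _))

/-- The operator `∂ ⊗ id + id ⊗ ∂` on the tensor product of two modules. -/
def tensD {ε : ℤˣ} (P : DMod.{u} f I ε) (Q : DMod.{v} f I ε) (i : I) :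
    P ⊗[S f I] Q →+ P ⊗[S f I] Q :=
  TensorProduct.liftAddHom
    (AddMonoidHom.mk' (fun p => AddMonoidHom.mk'
      (fun q => P.D i p ⊗ₜ[S f I] q + p ⊗ₜ[S f I] Q.D i q)
      (fun a b => by simp only [map_add, TensorProduct.tmul_add]; abel))
      (fun a b => by
        ext m
        simp only [map_add, TensorProduct.add_tmul, AddMonoidHom.mk'_apply,
          AddMonoidHom.add_apply]
        abel))
    (fun a p q => by
      simp only [AddMonoidHom.mk'_apply, P.D_smul, Q.D_smul, TensorProduct.add_tmul,
        TensorProduct.tmul_add, TensorProduct.smul_tmul', TensorProduct.tmul_smul]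
      rw [add_assoc, add_comm, add_assoc]
      abel)

theorem tensD_tmul {ε : ℤˣ} (P : DMod.{u} f I ε) (Q : DMod.{v} f I ε) (i : I) (p : P) (q : Q) :
    tensD P Q i (p ⊗ₜ q) = P.D i p ⊗ₜ[S f I] q + p ⊗ₜ[S f I] Q.D i q := rfl

/-- The external tensor product `M ⊠ N = pr_1^* M ⊗ pr_2^* N` on `X^I × X^J = X^{I ⊔ J}`. The
vector fields in the `I`-directions act through `M`, those in the `J`-directions through `N`. -/
def box {ε : ℤˣ} [Finite I] [Finite J] (M : DMod.{u} f I ε) (N : DMod.{v} f J ε) :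
    DMod.{max u v} f (I ⊕ J) ε where
  carrier := BoxC M N
  D i := tensD (pull Sum.inl M) (pull Sum.inr N) i
  D_comm i j z := by
    refine TensorProduct.induction_on (R := S f (I ⊕ J)) (motive := fun z =>
      tensD (pull Sum.inl M) (pull Sum.inr N) i (tensD (pull Sum.inl M) (pull Sum.inr N) j z) =
      tensD (pull Sum.inl M) (pull Sum.inr N) j (tensD (pull Sum.inl M) (pull Sum.inr N) i z))
      z ?_ ?_ ?_
    · simp only [map_zero]
    · intro p q
      simp only [tensD_tmul, map_add, (pull Sum.inl M).D_comm i j, (pull Sum.inr N).D_comm i j]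
      abel
    · intro a b ha hb
      simp only [map_add, ha, hb]
  D_smul i s z := by
    refine TensorProduct.induction_on (R := S f (I ⊕ J)) (motive := fun z =>
      tensD (pull Sum.inl M) (pull Sum.inr N) i (s • z) = (ε : ℤ) • (S.d i s • z) +
        s • tensD (pull Sum.inl M) (pull Sum.inr N) i z) z ?_ ?_ ?_
    · simp only [smul_zero, map_zero, add_zero]
    · intro p q
      rw [TensorProduct.smul_tmul', tensD_tmul, tensD_tmul, (pull Sum.inl M).D_smul,
        TensorProduct.add_tmul, smul_add]
      simp only [TensorProduct.smul_tmul']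
      abel
    · intro a b ha hb
      simp only [smul_add, map_add, ha, hb]
      abel

section box

variable {ε : ℤˣ} [Finite I] [Finite J] {M : DMod.{u} f I ε} {N : DMod.{v} f J ε}

/-- The element `m ⊠ n`. -/
def boxMk (m : M) (n : N) : box M N :=
  TensorProduct.tmul (S f (I ⊕ J)) (M := pull Sum.inl M) (N := pull Sum.inr N)
    (pullMk Sum.inl 1 m) (pullMk Sum.inr 1 n)

theorem fiber_inl_inl (i : I) : fiber (Sum.inl : I → I ⊕ J) (Sum.inl i) = {i} := by
  ext; simp

theorem fiber_inl_inr (j : J) : fiber (Sum.inl : I → I ⊕ J) (Sum.inr j) = ∅ := by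
  ext; simp

theorem fiber_inr_inr (j : J) : fiber (Sum.inr : J → I ⊕ J) (Sum.inr j) = {j} := by
  ext; simp

theorem fiber_inr_inl (i : I) : fiber (Sum.inr : J → I ⊕ J) (Sum.inl i) = ∅ := by
  ext; simp

theorem D_inl_boxMk (i : I) (m : M) (n : N) :
    (box M N).D (Sum.inl i) (boxMk m n) = boxMk (M.D i m) n := by
  refine (tensD_tmul (pull Sum.inl M) (pull Sum.inr N) (Sum.inl i) _ _).trans ?_
  rw [D_pullMk_one, D_pullMk_one, fiber_inl_inl, fiber_inr_inl, Finset.sum_singleton,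
    Finset.sum_empty, pullMk_zero, TensorProduct.tmul_zero, add_zero]
  rfl

theorem D_inr_boxMk (j : J) (m : M) (n : N) :
    (box M N).D (Sum.inr j) (boxMk m n) = boxMk m (N.D j n) := by
  refine (tensD_tmul (pull Sum.inl M) (pull Sum.inr N) (Sum.inr j) _ _).trans ?_
  rw [D_pullMk_one, D_pullMk_one, fiber_inl_inr, fiber_inr_inr, Finset.sum_singleton,
    Finset.sum_empty, pullMk_zero, TensorProduct.zero_tmul, zero_add]
  rfl

theorem boxMk_add_left (m m' : M) (n : N) : boxMk (m + m') n = boxMk m n + boxMk m' n := by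
  simp only [boxMk, pullMk_add]
  exact TensorProduct.add_tmul _ _ _

theorem boxMk_add_right (m : M) (n n' : N) : boxMk m (n + n') = boxMk m n + boxMk m n' := by
  simp only [boxMk, pullMk_add]
  exact TensorProduct.tmul_add _ _ _

theorem boxMk_smul_left (a : S f I) (m : M) (n : N) :
    boxMk (a • m) n = S.map (Sum.inl : I → I ⊕ J) a • boxMk m n := by
  simp only [boxMk, pullMk_smul]
  rw [one_mul, ← mul_one (S.map Sum.inl a), ← smul_pullMk, mul_one]
  exact (TensorProduct.smul_tmul' _ _ _).symm

theorem boxMk_smul_right (a : S f J) (m : M) (n : N) :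
    boxMk m (a • n) = S.map (Sum.inr : J → I ⊕ J) a • boxMk m n := by
  simp only [boxMk, pullMk_smul]
  rw [one_mul, ← mul_one (S.map Sum.inr a), ← smul_pullMk, mul_one]
  exact TensorProduct.tmul_smul _ _ _

theorem box_induction {p : box M N → Prop} (h0 : p 0)
    (hm : ∀ (s : S f (I ⊕ J)) m n, p (s • boxMk m n))
    (ha : ∀ a b, p a → p b → p (a + b)) (z : box M N) : p z := by
  refine TensorProduct.induction_on (R := S f (I ⊕ J)) (M := pull Sum.inl M)
    (N := pull Sum.inr N) (motive := p) z h0 ?_ ha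
  intro a b
  induction a using pull_induction with
  | h0 => rw [TensorProduct.zero_tmul]; exact h0
  | ha a a' h1 h2 => rw [TensorProduct.add_tmul]; exact ha _ _ h1 h2
  | hm s m =>
    induction b using pull_induction with
    | h0 => rw [TensorProduct.tmul_zero]; exact h0
    | ha a a' h1 h2 => rw [TensorProduct.tmul_add]; exact ha _ _ h1 h2
    | hm t n =>
      have := hm (s * t) m n
      convert this using 1
      rw [mul_smul]
      unfold boxMk
      rw [← mul_one s, ← mul_one t, ← smul_pullMk, ← smul_pullMk, mul_one, mul_one]
      rw [← TensorProduct.smul_tmul', TensorProduct.tmul_smul]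
      rfl

/-- The universal property of the external tensor product as a module. -/
def boxLift {T : Type*} [AddCommGroup T] [Module (S f (I ⊕ J)) T] (B : M →+ N →+ T)
    (h1 : ∀ (a : S f I) m n, B (a • m) n = S.map (Sum.inl : I → I ⊕ J) a • B m n)
    (h2 : ∀ (a : S f J) m n, B m (a • n) = S.map (Sum.inr : J → I ⊕ J) a • B m n) :
    box M N →ₗ[S f (I ⊕ J)] T :=
  TensorProduct.lift (R := S f (I ⊕ J)) (M := pull Sum.inl M) (N := pull Sum.inr N)
    (pullLift (T := pull Sum.inr N →ₗ[S f (I ⊕ J)] T) Sum.inl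
      (AddMonoidHom.mk' (fun m => pullLift Sum.inr (B m) (fun a n => h2 a m n))
        (fun m m' => by
          refine pull_ext _ fun s n => ?_
          simp only [LinearMap.add_apply, pullLift_mk, map_add, AddMonoidHom.add_apply,
            smul_add]))
      (fun a m => by
          refine pull_ext _ fun s n => ?_
          simp only [AddMonoidHom.mk'_apply, LinearMap.smul_apply, pullLift_mk, h1]
          rw [smul_comm]))

theorem boxLift_mk {T : Type*} [AddCommGroup T] [Module (S f (I ⊕ J)) T] (B : M →+ N →+ T)
    (h1 : ∀ (a : S f I) m n, B (a • m) n = S.map (Sum.inl : I → I ⊕ J) a • B m n)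
    (h2 : ∀ (a : S f J) m n, B m (a • n) = S.map (Sum.inr : J → I ⊕ J) a • B m n)
    (m : M) (n : N) : boxLift B h1 h2 (boxMk m n) = B m n := by
  change (1 : S f (I ⊕ J)) • (1 : S f (I ⊕ J)) • B m n = _
  rw [one_smul, one_smul]

end box

/-! #### Restriction to the open subset `U(I) ⊆ X^I` and direct image back to `X^I` -/

/-- Underlying module of `j_* j^* M`, for `j : U(I) → X^I`. -/
def LocC {ε : ℤˣ} (M : DMod.{u} f I ε) (r : Setoid I) : Type u := U f r ⊗[S f I] M

section loc

variable {ε : ℤˣ} (M : DMod.{u} f I ε) (r : Setoid I)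

instance : AddCommGroup (LocC M r) := inferInstanceAs (AddCommGroup (U f r ⊗[S f I] M))

instance : Module (U f r) (LocC M r) := inferInstanceAs (Module (U f r) (U f r ⊗[S f I] M))

instance : Module (S f I) (LocC M r) := inferInstanceAs (Module (S f I) (U f r ⊗[S f I] M))

instance : IsScalarTower (S f I) (U f r) (LocC M r) :=
  inferInstanceAs (IsScalarTower (S f I) (U f r) (U f r ⊗[S f I] M))

/-- The action of `∂_i` on `j_* j^* M = Γ(U(I), 𝒪) ⊗ M` by `∂_i ⊗ id + id ⊗ ∂_i`. -/
def locD (i : I) : LocC M r →+ LocC M r :=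
  opBase (R := S f I) (R' := U f r) (M := M) ε (S.d i)
    (U.d i : Derivation ℂ (U f r) (U f r)).toLinearMap.toAddMonoidHom (M.D i)
    (fun a => U.d_algebraMap i a) (fun a b => Derivation.leibniz (U.d i) a b) (M.D_smul i)

theorem locD_smul (i : I) (t : U f r) (z : LocC M r) :
    locD M r i (t • z) = (ε : ℤ) • (U.d i t • z) + t • locD M r i z :=
  opBase_smul (R' := U f r) (M := M) _ _ _ _ _ _ _ t z

/-- The `𝒟`-module `j_* j^* M` on `X^I`, for `j : U(I) → X^I` the open embedding. -/
def loc : DMod.{u} f I ε where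
  carrier := LocC M r
  D i := locD M r i
  D_comm i j z := by
    refine opBase_comm (M := M) _ _ _ _ _ _ _ _ _ _ _ _ _ ?_ ?_ z
    · intro s
      exact U.d_comm i j s
    · exact M.D_comm i j
  D_smul i s z := by
    rw [← algebraMap_smul (U f r) s z, locD_smul, U.d_algebraMap, algebraMap_smul,
      algebraMap_smul]

instance : Module (U f r) (loc M r) := inferInstanceAs (Module (U f r) (LocC M r))

instance : IsScalarTower (S f I) (U f r) (loc M r) :=
  inferInstanceAs (IsScalarTower (S f I) (U f r) (LocC M r))

variable {M r}

theorem loc_D_smul (i : I) (t : U f r) (z : loc M r) :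
    (loc M r).D i (t • z) = (ε : ℤ) • (U.d i t • z) + t • (loc M r).D i z :=
  locD_smul M r i t z

/-- The element `t ⊗ m` of `j_* j^* M`. -/
def locMk (t : U f r) (m : M) : loc M r := TensorProduct.tmul (S f I) (M := U f r) (N := M) t m

theorem loc_induction {p : loc M r → Prop} (h0 : p 0) (hm : ∀ t m, p (locMk t m))
    (ha : ∀ a b, p a → p b → p (a + b)) (z : loc M r) : p z :=
  TensorProduct.induction_on (R := S f I) (M := U f r) (N := M) (motive := p) z h0 hm ha

theorem smul_locMk (t s : U f r) (m : M) : t • locMk s m = locMk (t * s) m := rfl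

theorem locMk_add (t : U f r) (m n : M) : locMk t (m + n) = locMk t m + locMk t n :=
  TensorProduct.tmul_add (R := S f I) (M := U f r) (N := M) t m n

theorem locMk_add_left (t t' : U f r) (m : M) : locMk (t + t') m = locMk t m + locMk t' m :=
  TensorProduct.add_tmul (R := S f I) (M := U f r) (N := M) t t' m

theorem locMk_smul (t : U f r) (a : S f I) (m : M) :
    locMk t (a • m) = a • locMk t m :=
  TensorProduct.tmul_smul (R := S f I) (M := U f r) (N := M) a t m

theorem smul_locMk' (t : U f r) (a : S f I) (m : M) :
    a • locMk t m = locMk (algebraMap _ (U f r) a * t) m := by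
  rw [← algebraMap_smul (U f r) a (locMk t m), smul_locMk]

theorem D_locMk (i : I) (t : U f r) (m : M) :
    (loc M r).D i (locMk t m) = (ε : ℤ) • locMk (U.d i t) m + locMk t (M.D i m) := rfl

variable (M r)

/-- The canonical map `M → j_* j^* M`. -/
def toLoc : Hom M (loc M r) where
  toFun m := locMk 1 m
  map_add' m n := locMk_add 1 m n
  map_smul' a m := locMk_smul 1 a m
  map_D i m := by
    rw [D_locMk, Derivation.map_one_eq_zero]
    have : locMk (0 : U f r) m = 0 := TensorProduct.zero_tmul (R := S f I) (M := U f r) (N := M) m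
    rw [this, smul_zero, zero_add]

variable {M r}



/-- A linear map from `M` to a module over `Γ(U(I), 𝒪)` extends to `j_* j^* M`. -/
def locLift {T : Type*} [AddCommGroup T] [Module (S f I) T] [Module (U f r) T]
    [IsScalarTower (S f I) (U f r) T] (φ : M →ₗ[S f I] T) : loc M r →ₗ[U f r] T :=
  LinearMap.liftBaseChange (R := S f I) (M := M) (U f r) φ

theorem locLift_mk {T : Type*} [AddCommGroup T] [Module (S f I) T] [Module (U f r) T]
    [IsScalarTower (S f I) (U f r) T] (φ : M →ₗ[S f I] T) (t : U f r) (m : M) :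
    locLift φ (locMk t m) = t • φ m :=
  LinearMap.liftBaseChange_tmul (R := S f I) (M := M) (U f r) φ t m

/-- The functor `j_* j^*` on morphisms. -/
def locHom {N : DMod.{v} f I ε} (φ : Hom M N) : Hom (loc M r) (loc N r) where
  toLinearMap := (locLift ((toLoc N r).toLinearMap ∘ₗ φ.toLinearMap)).restrictScalars (S f I)
  map_D i z := by
    change locLift _ ((loc M r).D i z) = (loc N r).D i (locLift _ z)
    induction z using loc_induction with
    | h0 => simp only [map_zero]
    | ha a b h1 h2 => simp only [map_add, h1, h2]
    | hm t m =>
      rw [D_locMk, map_add, map_zsmul, locLift_mk, locLift_mk, locLift_mk, loc_D_smul]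
      simp only [LinearMap.comp_apply]
      rw [φ.apply_D, (toLoc N r).apply_D]

theorem locHom_mk {N : DMod.{v} f I ε} (φ : Hom M N) (t : U f r) (m : M) :
    locHom φ (locMk t m) = locMk t (φ m) := by
  refine (locLift_mk _ t m).trans ?_
  change t • locMk 1 (φ m) = _
  rw [smul_locMk, mul_one]

variable (M r)

/-- The image of `M` in `j_* j^* M`. -/
def regular : Submodule (S f I) (loc M r) := LinearMap.range (toLoc M r).toLinearMap

/-- The operator on `j_* j^* M / M` induced by `∂_i`. -/
def cokerD (i : I) : (loc M r ⧸ regular M r) →+ (loc M r ⧸ regular M r) :=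
  QuotientAddGroup.lift (regular M r).toAddSubgroup
    ((regular M r).mkQ.toAddMonoidHom.comp ((loc M r).D i)) (by
      rintro _ ⟨m, rfl⟩
      exact (Submodule.Quotient.mk_eq_zero _).2 ⟨M.D i m, (toLoc M r).apply_D i m⟩)

theorem cokerD_mk (i : I) (z : loc M r) :
    cokerD M r i ((regular M r).mkQ z) = (regular M r).mkQ ((loc M r).D i z) := rfl

/-- The `𝒟`-module `j_* j^* M / M`. -/
def coker : DMod.{u} f I ε where
  carrier := loc M r ⧸ regular M r
  D i := cokerD M r i
  D_comm i j z := by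
    obtain ⟨z, rfl⟩ := (regular M r).mkQ_surjective z
    rw [cokerD_mk, cokerD_mk, cokerD_mk, cokerD_mk, (loc M r).D_comm]
  D_smul i s z := by
    obtain ⟨z, rfl⟩ := (regular M r).mkQ_surjective z
    rw [← map_smul, cokerD_mk, cokerD_mk, (loc M r).D_smul, map_add, map_zsmul, map_smul, map_smul]

/-- The projection `j_* j^* M → j_* j^* M / M`. -/
def toCoker : Hom (loc M r) (coker M r) where
  toLinearMap := (regular M r).mkQ
  map_D _ _ := rfl

theorem toCoker_toLoc (m : M) : toCoker M r (toLoc M r m) = 0 :=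
  (Submodule.Quotient.mk_eq_zero _).2 ⟨m, rfl⟩

variable {M r}

/-- The functor `M ↦ j_* j^* M / M` on morphisms. -/
def cokerHom {N : DMod.{v} f I ε} (φ : Hom M N) : Hom (coker M r) (coker N r) where
  toLinearMap := Submodule.mapQ _ _ (locHom φ).toLinearMap (by
    rintro _ ⟨m, rfl⟩
    exact ⟨φ m, (locHom_mk φ 1 m).symm⟩)
  map_D i z := by
    obtain ⟨z, rfl⟩ := (regular M r).mkQ_surjective z
    exact congrArg (regular N r).mkQ ((locHom φ).map_D i z)

end loc

section boxHom

variable {ε : ℤˣ} [Finite I] [Finite J] {L : DMod.{w} f I ε} {M : DMod.{u} f J ε}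
    {N : DMod.{v} f J ε} (φ : Hom M N)

/-- The map `m ↦ (l ↦ l ⊠ φ m)`. -/
def boxHomAux : L →+ M →+ box L N :=
  AddMonoidHom.mk' (fun l => AddMonoidHom.mk' (fun m => boxMk l (φ m))
    (fun a b => by rw [map_add, boxMk_add_right]))
    (fun a b => by
      ext m
      simp only [AddMonoidHom.mk'_apply, AddMonoidHom.add_apply, boxMk_add_left])

theorem boxHomAux_apply (l : L) (m : M) : boxHomAux φ l m = boxMk l (φ m) := rfl

/-- The linear map underlying `boxHom`. -/
def boxHomLin : box L M →ₗ[S f (I ⊕ J)] box L N :=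
  boxLift (boxHomAux φ) (fun a l m => by simp only [boxHomAux_apply, boxMk_smul_left])
    (fun a l m => by simp only [boxHomAux_apply, map_smul, boxMk_smul_right])

theorem boxHomLin_mk (l : L) (m : M) : boxHomLin φ (boxMk l m) = boxMk l (φ m) :=
  boxLift_mk _ _ _ l m

/-- The functor `L ⊠ -` on morphisms. -/
def boxHom : Hom (box L M) (box L N) where
  toLinearMap := boxHomLin φ
  map_D i z := by
    change boxHomLin φ ((box L M).D i z) = (box L N).D i (boxHomLin φ z)
    induction z using box_induction with
    | h0 => simp only [map_zero]
    | ha a b h1 h2 => simp only [map_add, h1, h2]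
    | hm s l m =>
      rw [(box L M).D_smul, map_add, map_zsmul, map_smul, map_smul, map_smul, (box L N).D_smul,
        boxHomLin_mk]
      rcases i with i | i
      · rw [D_inl_boxMk, D_inl_boxMk, boxHomLin_mk]
      · rw [D_inr_boxMk, D_inr_boxMk, boxHomLin_mk, φ.apply_D]

theorem boxHom_mk (l : L) (m : M) : boxHom φ (boxMk l m) = boxMk l (φ m) := boxHomLin_mk φ l m

end boxHom

end DMod

/-! ### The square `X²`, the complement of the diagonal, and the diagonal -/

/-- The index set of the two factors of `X²`. -/
abbrev Two : Type := Unit ⊕ Unit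

/-- The index `1`. -/
abbrev p1 : Two := Sum.inl ()

/-- The index `2`. -/
abbrev p2 : Two := Sum.inr ()

/-- The set `{1 : 2}`, i.e. two inequivalent points; `U(1 : 2) ⊆ X²` is the complement of the
diagonal. -/
def r12 : Setoid Two := sumSetoid ⊤ ⊤

/-- The map `{1, 2} → {1}`; the map `φ(diag) : X → X²` is the diagonal embedding. -/
def diag : Two → Unit := fun _ => ()

theorem not_r12 : ¬ r12 p1 p2 := by
  intro h; cases h

variable (f) in
/-- The invertible function `x_1 - x_2` on the complement of the diagonal. -/
def t12 : (U f r12)ˣ := (U.isUnit_sub (f := f) not_r12).unit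

variable (f) in
/-- The function `(x_1 - x_2)^n`, for an integer `n`. -/
def z12 (n : ℤ) : U f r12 := ((t12 f ^ n : (U f r12)ˣ) : U f r12)

theorem z12_zero : z12 f 0 = 1 := by simp [z12]

theorem z12_add (m n : ℤ) : z12 f (m + n) = z12 f m * z12 f n := by simp [z12, zpow_add]

theorem z12_one : z12 f 1 = algebraMap (S f Two) _ (S.x p1 - S.x p2) := by
  simp [z12, t12]

theorem z12_natCast (n : ℕ) :
    z12 f n = algebraMap (S f Two) _ ((S.x p1 - S.x p2) ^ n) := by
  rw [map_pow, ← z12_one]; simp [z12]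

theorem d1_z12_one : U.d p1 (z12 f 1) = 1 := by
  rw [z12_one, U.d_algebraMap]; simp [S.d_x]

theorem d2_z12_one : U.d p2 (z12 f 1) = -1 := by
  rw [z12_one, U.d_algebraMap]; simp [S.d_x]

theorem d_z12 (i : Two) (c : ℤ) (hc : U.d i (z12 f 1) = (c : U f r12)) (n : ℤ) :
    U.d i (z12 f n) = (c * n : ℤ) • z12 f (n - 1) := by
  have step : ∀ m : ℤ, U.d i (z12 f (m + 1)) = z12 f 1 * U.d i (z12 f m) + c • z12 f m := by
    intro m
    rw [z12_add, Derivation.leibniz, hc]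
    simp [mul_comm]
    ring
  have e : ∀ m : ℤ, z12 f 1 * z12 f (m - 1) = z12 f m := by
    intro m
    rw [← z12_add]; congr 1; ring
  induction n using Int.induction_on with
  | zero => simp [z12_zero]
  | succ k ih =>
    rw [step, ih, mul_smul_comm, e, ← add_smul, add_sub_cancel_right]
    congr 1; ring
  | pred k ih =>
    have h := step (-k - 1)
    rw [sub_add_cancel, ih] at h
    have hu : IsUnit (z12 f 1) := (t12 f ^ (1 : ℤ)).isUnit
    refine hu.mul_left_cancel ?_
    rw [mul_smul_comm, e]
    have h2 := eq_sub_of_add_eq h.symm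
    rw [h2, ← sub_smul]
    congr 1; ring

theorem d1_z12 (n : ℤ) : U.d p1 (z12 f n) = n • z12 f (n - 1) := by
  have := d_z12 (f := f) p1 1 (by rw [d1_z12_one]; simp) n
  rwa [one_mul] at this

theorem d2_z12 (n : ℤ) : U.d p2 (z12 f n) = (-n) • z12 f (n - 1) := by
  have := d_z12 (f := f) p2 (-1) (by rw [d2_z12_one]; simp) n
  rwa [neg_one_mul] at this

theorem diffs_r12 {m : S f Two} (hm : m ∈ diffs f r12) :
    ∃ (e : ℤˣ) (k : ℕ), algebraMap _ (U f r12) m = (e : ℤ) • z12 f k := by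
  induction hm using Submonoid.closure_induction with
  | mem y hy =>
    obtain ⟨i, j, hij, rfl⟩ := hy
    rcases i with ⟨⟩ | ⟨⟩ <;> rcases j with ⟨⟩ | ⟨⟩
    · exact absurd (.inl trivial) hij
    · exact ⟨1, 1, by simp [z12_one]⟩
    · exact ⟨-1, 1, by simp [z12_one]⟩
    · exact absurd (.inr trivial) hij
  | one => exact ⟨1, 0, by simp [z12_zero]⟩
  | mul a b _ _ ha hb =>
    obtain ⟨e, k, h⟩ := ha
    obtain ⟨e', k', h'⟩ := hb
    refine ⟨e * e', k + k', ?_⟩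
    rw [map_mul, h, h']
    push_cast
    rw [z12_add, smul_mul_smul_comm]

/-- A function on the complement of the diagonal has a pole of finite order. -/
theorem exists_regular (h : U f r12) :
    ∃ N : ℤ, ∀ n, N ≤ n → ∃ s : S f Two, h * z12 f n = algebraMap _ _ s := by
  obtain ⟨⟨p, m⟩, hz⟩ := IsLocalization.surj (diffs f r12) h
  obtain ⟨e, k, hk⟩ := diffs_r12 m.2
  refine ⟨k, fun n hn => ?_⟩
  obtain ⟨l, rfl⟩ : ∃ l : ℕ, n = k + l := ⟨(n - k).toNat, by omega⟩
  refine ⟨(e : ℤ) • p * (S.x p1 - S.x p2) ^ l, ?_⟩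
  simp only at hz
  rw [map_mul, map_zsmul, ← hz, z12_add, z12_natCast l, ← mul_assoc, hk, mul_smul_comm, smul_smul]
  congr 1
  rcases Int.units_eq_one_or e with rfl | rfl <;> simp

namespace DMod

variable {ε : ℤˣ}

/-- The direct image `Δ_* N = j_* j^* (𝒪 ⊠ N) / (𝒪 ⊠ N)` of a left `𝒟`-module `N` on `X`
(`ε = 1`) along the diagonal `Δ : X → X²`; for a right `𝒟`-module (`ε = -1`), this is
`Δ_! N = j_* j^* (ω ⊠ N) / (ω ⊠ N)`. -/
def push (N : DMod.{u} f Unit ε) : DMod.{u} f Two ε := coker (box (one f Unit ε) N) r12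

/-- The function `1` in `𝒪` (`ε = 1`), or the form `dx` in `ω` (`ε = -1`). -/
def oneElt (f : Polynomial ℂ) (ε : ℤˣ) : one f Unit ε := (1 : S f Unit)

theorem D_oneElt : (one f Unit ε).D () (oneElt f ε) = 0 := by
  have : (one f Unit ε).D () (oneElt f ε) = (ε : ℤ) • S.d () (1 : S f Unit) := rfl
  rw [this, S.d_one]
  exact (smul_zero _ : (ε : ℤ) • (0 : S f Unit) = 0)

/-- The class of `h (1 ⊠ n)` in the direct image along the diagonal. -/
def pole {N : DMod.{u} f Unit ε} (h : U f r12) (n : N) : push N :=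
  toCoker _ r12 (locMk h (boxMk (oneElt f ε) n))

/-- The direct image along the diagonal, on morphisms. -/
def pushHom {N : DMod.{u} f Unit ε} {N' : DMod.{v} f Unit ε} (φ : Hom N N') :
    Hom (push N) (push N') := cokerHom (boxHom φ)

section pole

variable {N : DMod.{u} f Unit ε}

theorem pole_add_left (h h' : U f r12) (n : N) : pole (h + h') n = pole h n + pole h' n := by
  simp only [pole, locMk_add_left]; exact map_add _ _ _

theorem pole_add_right (h : U f r12) (n n' : N) : pole h (n + n') = pole h n + pole h n' := by
  simp only [pole, boxMk_add_right, locMk_add]; exact map_add _ _ _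

theorem pole_zero_right (h : U f r12) : pole h (0 : N) = 0 := by
  have := pole_add_right h (0 : N) 0
  rw [add_zero] at this
  exact left_eq_add.1 this

theorem pole_zsmul_left (c : ℤ) (h : U f r12) (n : N) : pole (c • h) n = c • pole h n :=
  map_zsmul (AddMonoidHom.mk' (fun h => pole h n) (fun a b => pole_add_left a b n)) c h

theorem pole_zsmul_right (c : ℤ) (h : U f r12) (n : N) : pole h (c • n) = c • pole h n :=
  map_zsmul (AddMonoidHom.mk' (fun n => pole h n) (fun a b => pole_add_right h a b)) c n

theorem smul_pole (s : S f Two) (h : U f r12) (n : N) :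
    s • pole h n = pole (algebraMap _ _ s * h) n := by
  simp only [pole, ← smul_locMk']; exact (map_smul (toCoker _ r12).toLinearMap s _).symm

theorem pole_regular (s : S f Two) (n : N) : pole (algebraMap _ _ s) n = 0 := by
  have h := smul_pole s 1 n
  rw [mul_one] at h
  rw [← h]
  have h0 : pole (1 : U f r12) n = 0 := toCoker_toLoc _ _ _
  rw [h0, smul_zero]

theorem pole_smul (a : S f Unit) (h : U f r12) (n : N) :
    pole h (a • n) = pole (algebraMap _ _ (S.map (Sum.inr : Unit → Two) a) * h) n := by
  rw [← smul_pole]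
  simp only [pole, boxMk_smul_right, locMk_smul]
  exact map_smul (toCoker _ r12).toLinearMap _ _

theorem D1_pole (h : U f r12) (n : N) :
    (push N).D p1 (pole h n) = (ε : ℤ) • pole (U.d p1 h) n := by
  unfold pole push
  rw [← Hom.apply_D, D_locMk, map_add, map_zsmul, D_inl_boxMk, D_oneElt]
  have h0 : boxMk (M := one f Unit ε) 0 n = 0 := by
    have := boxMk_add_left (M := one f Unit ε) 0 0 n
    rw [add_zero] at this
    exact left_eq_add.1 this
  have h1 : locMk (r := r12) h (0 : box (one f Unit ε) N) = 0 := by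
    have := locMk_add h (0 : box (one f Unit ε) N) 0
    rw [add_zero] at this
    exact left_eq_add.1 this
  rw [h0, h1, map_zero, add_zero]

theorem D2_pole (h : U f r12) (n : N) :
    (push N).D p2 (pole h n) = (ε : ℤ) • pole (U.d p2 h) n + pole h (N.D () n) := by
  unfold pole push
  rw [← Hom.apply_D, D_locMk, map_add, map_zsmul, D_inr_boxMk]

theorem pushHom_pole {N' : DMod.{v} f Unit ε} (φ : Hom N N') (h : U f r12) (n : N) :
    pushHom φ (pole h n) = pole h (φ n) := by
  change (regular _ r12).mkQ (locHom (boxHom φ) (locMk h _)) = _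
  rw [locHom_mk, boxHom_mk]
  rfl

end pole

end DMod

/-! ### The canonical map `j_* j^* M → Δ_* Δ^* M` -/

variable (f) in
/-- The constant `1 / i!`. -/
def invFact (I : Type) (i : ℕ) : S f I := algebraMap ℂ _ ((i.factorial : ℂ)⁻¹)

theorem succ_invFact (i : ℕ) : ((i + 1 : ℕ) : ℤ) • invFact f I (i + 1) = invFact f I i := by
  have : ((i + 1 : ℕ) : ℂ) ≠ 0 := Nat.cast_ne_zero.2 (Nat.succ_ne_zero i)
  rw [invFact, invFact, ← map_zsmul, Nat.factorial_succ, zsmul_eq_mul]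
  congr 1
  push_cast at this ⊢
  field_simp

namespace DMod

/-- The inverse image `Δ^* M` along the diagonal `Δ : X → X²`. -/
abbrev diagPull (M : LeftDMod.{u} f Two) : LeftDMod.{u} f Unit := pull diag M

/-- The class `m̄` of `m` in `Δ^* M`. -/
abbrev bar {M : LeftDMod.{u} f Two} (m : M) : diagPull M := pullMk diag 1 m

section gamma

variable {M : LeftDMod.{u} f Two}

theorem bar_smul (s : S f Two) (m : M) : bar (s • m) = S.map diag s • bar m := by
  rw [bar, pullMk_smul, smul_pullMk, one_mul, mul_one]

theorem bar_add (m n : M) : bar (m + n) = bar m + bar n := pullMk_add diag 1 m n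

theorem D_bar (m : M) : (diagPull M).D () (bar m) = bar (M.D p1 m) + bar (M.D p2 m) := by
  rw [bar, D_pullMk_one]
  have : fiber diag () = Finset.univ := by ext; simp [diag]
  rw [this, Fintype.sum_sum_type, pullMk_add]
  simp

/-- The term `(1 / i!) [h (x_1 - x_2)^i (1 ⊠ \overline{∂_1^i m})]`. -/
def gammaTerm (h : U f r12) (m : M) (i : ℕ) : push (diagPull M) :=
  pole (h * z12 f i) (invFact f Unit i • bar ((M.D p1)^[i] m))

/-- The sum `∑_i (1 / i!) [h (x_1 - x_2)^i (1 ⊠ \overline{∂_1^i m})]`. Only finitely many terms are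
nonzero, since `h (x_1 - x_2)^i` is regular along the diagonal for large `i`. -/
def gammaFun (h : U f r12) (m : M) : push (diagPull M) := ∑ᶠ i : ℕ, gammaTerm h m i

theorem gammaFun_eq_sum (h : U f r12) : ∃ N : ℕ, ∀ n, N ≤ n → ∀ m : M,
    gammaFun h m = ∑ i ∈ Finset.range n, gammaTerm h m i := by
  obtain ⟨N, hN⟩ := exists_regular h
  refine ⟨N.toNat, fun n hn m => finsum_eq_sum_of_support_subset _ ?_⟩
  intro i hi
  by_contra hlt
  have hlt : n ≤ i := by simpa using hlt
  obtain ⟨s, hs⟩ := hN i (by omega)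
  exact hi (by rw [gammaTerm, hs, pole_regular])

theorem iterate_add (m m' : M) (i : ℕ) :
    (M.D p1)^[i] (m + m') = (M.D p1)^[i] m + (M.D p1)^[i] m' :=
  iterate_map_add (M.D p1) i m m'

theorem gammaFun_add_right (h : U f r12) (m m' : M) :
    gammaFun h (m + m') = gammaFun h m + gammaFun h m' := by
  obtain ⟨N, hN⟩ := gammaFun_eq_sum (M := M) h
  rw [hN N le_rfl, hN N le_rfl, hN N le_rfl, ← Finset.sum_add_distrib]
  refine Finset.sum_congr rfl fun i _ => ?_
  rw [gammaTerm, iterate_add, bar_add, smul_add, pole_add_right]; rfl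

theorem gammaFun_add_left (h h' : U f r12) (m : M) :
    gammaFun (h + h') m = gammaFun h m + gammaFun h' m := by
  obtain ⟨N, hN⟩ := gammaFun_eq_sum (M := M) h
  obtain ⟨N', hN'⟩ := gammaFun_eq_sum (M := M) h'
  obtain ⟨N'', hN''⟩ := gammaFun_eq_sum (M := M) (h + h')
  rw [hN (max N (max N' N'')) (by simp), hN' (max N (max N' N'')) (by simp),
    hN'' (max N (max N' N'')) (by simp), ← Finset.sum_add_distrib]
  refine Finset.sum_congr rfl fun i _ => ?_
  rw [gammaTerm, add_mul, pole_add_left]; rfl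

theorem gammaFun_smul_left (s : S f Two) (h : U f r12) (m : M) :
    gammaFun (algebraMap _ _ s * h) m = s • gammaFun h m := by
  obtain ⟨N, hN⟩ := gammaFun_eq_sum (M := M) h
  obtain ⟨N', hN'⟩ := gammaFun_eq_sum (M := M) (algebraMap _ _ s * h)
  rw [hN (max N N') (by simp), hN' (max N N') (by simp), Finset.smul_sum]
  refine Finset.sum_congr rfl fun i _ => ?_
  rw [gammaTerm, gammaTerm, smul_pole, mul_assoc]

theorem iterate_smul_const (s : S f Two) (hs : S.d p1 s = 0) (m : M) (i : ℕ) :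
    (M.D p1)^[i] (s • m) = s • (M.D p1)^[i] m := by
  induction i with
  | zero => rfl
  | succ i ih => rw [Function.iterate_succ_apply', ih, M.D_smul, hs, zero_smul, smul_zero,
      zero_add, Function.iterate_succ_apply']

theorem gammaFun_const (s : S f Two) (hs : S.d p1 s = 0)
    (hs' : S.map (Sum.inr : Unit → Two) (S.map diag s) = s) (h : U f r12) (m : M) :
    gammaFun h (s • m) = gammaFun (algebraMap _ _ s * h) m := by
  rw [gammaFun, gammaFun]
  refine finsum_congr fun i => ?_
  rw [gammaTerm, gammaTerm, iterate_smul_const s hs, bar_smul, smul_comm, pole_smul, hs',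
    mul_assoc]

theorem iterate_smul_x12 (m : M) (i : ℕ) : (M.D p1)^[i + 1] ((S.x p1 - S.x p2 : S f Two) • m) =
    (S.x p1 - S.x p2 : S f Two) • (M.D p1)^[i + 1] m +
      ((i + 1 : ℕ) : ℤ) • (M.D p1)^[i] m := by
  have hd : S.d p1 (S.x p1 - S.x p2 : S f Two) = 1 := by simp [S.d_x]
  induction i with
  | zero =>
    simp only [Function.iterate_succ_apply', Function.iterate_zero, id_eq, M.D_smul, hd, one_smul]
    simp [add_comm]
  | succ i ih =>
    rw [Function.iterate_succ_apply', ih, map_add, M.D_smul, hd, map_zsmul,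
      ← Function.iterate_succ_apply' (M.D p1) i m,
      ← Function.iterate_succ_apply' (M.D p1) (i + 1) m, one_smul, add_comm (_ • _ : M), add_assoc,
      ← add_smul]
    congr 2
    push_cast
    ring

theorem gammaFun_x12 (h : U f r12) (m : M) :
    gammaFun h ((S.x p1 - S.x p2 : S f Two) • m) =
      gammaFun (algebraMap _ _ (S.x p1 - S.x p2 : S f Two) * h) m := by
  obtain ⟨N, hN⟩ := gammaFun_eq_sum (M := M) h
  obtain ⟨N', hN'⟩ := gammaFun_eq_sum (M := M) (algebraMap _ _ (S.x p1 - S.x p2 : S f Two) * h)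
  have hb : ∀ m : M, bar ((S.x p1 - S.x p2 : S f Two) • m) = 0 := by
    intro m
    rw [bar_smul]
    simp [diag]
  rw [hN (max N N' + 1) (by omega), hN' (max N N') (by simp), Finset.sum_range_succ']
  have h0 : gammaTerm h ((S.x p1 - S.x p2 : S f Two) • m) 0 = 0 := by
    rw [gammaTerm]
    simp only [Function.iterate_zero, id_eq]
    rw [hb, smul_zero, pole_zero_right]
  rw [h0, add_zero]
  refine Finset.sum_congr rfl fun i _ => ?_
  rw [gammaTerm, gammaTerm, iterate_smul_x12, bar, pullMk_add]
  have hz : pullMk diag 1 (((i + 1 : ℕ) : ℤ) • (M.D p1)^[i] m) =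
      ((i + 1 : ℕ) : ℤ) • pullMk diag 1 ((M.D p1)^[i] m) :=
    map_zsmul (AddMonoidHom.mk' (fun m : M => pullMk diag (1 : S f Unit) m)
      (fun a b => pullMk_add diag 1 a b)) _ _
  have := hb ((M.D p1)^[i + 1] m)
  rw [bar] at this
  rw [this, zero_add, hz, smul_comm, ← smul_assoc, succ_invFact, ← z12_one]
  congr 1
  push_cast
  rw [z12_add]
  ring

theorem gammaFun_smul (s : S f Two) : ∀ (h : U f r12) (m : M),
    gammaFun h (s • m) = gammaFun (algebraMap _ _ s * h) m := by
  have hx2 : ∀ (h : U f r12) (m : M),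
      gammaFun h ((S.x p2 : S f Two) • m) = gammaFun (algebraMap _ _ (S.x p2 : S f Two) * h) m :=
    gammaFun_const _ (by simp [S.d_x]) (by simp [diag])
  induction s using S.induction with
  | hC c => exact gammaFun_const _ (by simp) (by simp)
  | hx i =>
    rcases i with ⟨⟩ | ⟨⟩
    · intro h m
      have : (S.x (Sum.inl ()) : S f Two) = (S.x p1 - S.x p2) + S.x p2 := by ring
      rw [this, add_smul, gammaFun_add_right, gammaFun_x12, hx2, map_add, add_mul,
        gammaFun_add_left]
    · exact hx2
  | hadd a b ha hb =>
    intro h m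
    rw [add_smul, gammaFun_add_right, ha, hb, map_add, add_mul, gammaFun_add_left]
  | hmul a b ha hb =>
    intro h m
    rw [mul_smul, ha, hb, map_mul, ← mul_assoc, mul_comm (algebraMap _ _ b)]
  | hinv a b hab ha =>
    intro h m
    have h1 := ha (algebraMap _ _ b * h) (b • m)
    rw [smul_smul, hab, one_smul, ← mul_assoc, ← map_mul, hab, map_one, one_mul] at h1
    exact h1.symm

variable (M) in
/-- The linear map underlying `gamma`. -/
def gammaLin : loc M r12 →ₗ[S f Two] push (diagPull M) where
  toFun := TensorProduct.liftAddHom (R := S f Two) (M := U f r12) (N := M)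
    (AddMonoidHom.mk' (fun h => AddMonoidHom.mk' (fun m => gammaFun h m) (gammaFun_add_right h))
      (fun a b => by ext m; exact gammaFun_add_left a b m))
    (fun s h m => by
      simp only [AddMonoidHom.mk'_apply, gammaFun_smul, Algebra.smul_def])
  map_add' a b := map_add _ _ _
  map_smul' s z := by
    induction z using loc_induction with
    | h0 => rw [smul_zero]; exact (map_zero _).trans (smul_zero _).symm
    | ha a b h1 h2 =>
      rw [smul_add]
      refine (map_add _ _ _).trans ?_
      rw [h1, h2, ← smul_add]
      exact congrArg _ (map_add _ _ _).symm
    | hm h m =>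
      rw [smul_locMk']
      exact gammaFun_smul_left s h m

theorem gammaLin_mk (h : U f r12) (m : M) : gammaLin M (locMk h m) = gammaFun h m := rfl

theorem gammaFun_d1 (h : U f r12) (m : M) :
    (push (diagPull M)).D p1 (gammaFun h m) = gammaFun (U.d p1 h) m + gammaFun h (M.D p1 m) := by
  obtain ⟨N₁, h₁⟩ := gammaFun_eq_sum (M := M) h
  obtain ⟨N₂, h₂⟩ := gammaFun_eq_sum (M := M) (U.d p1 h)
  set n := max N₁ N₂
  rw [h₁ (n + 1) (by omega), h₂ (n + 1) (by omega), h₁ n (by omega), map_sum,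
    Finset.sum_range_succ' (fun i => gammaTerm (U.d p1 h) m i), Finset.sum_range_succ',
    add_right_comm, ← Finset.sum_add_distrib]
  congr 1
  · refine Finset.sum_congr rfl fun i _ => ?_
    rw [gammaTerm, gammaTerm, gammaTerm, D1_pole, Derivation.leibniz, d1_z12, pole_add_left,
      ← Function.iterate_succ_apply, add_comm]
    simp only [Units.val_one, one_smul, smul_eq_mul]
    rw [mul_comm (z12 f _)]
    congr 1
    rw [mul_smul_comm, pole_zsmul_left, ← pole_zsmul_right, ← smul_assoc, succ_invFact]
    congr 3
    push_cast
    ring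
  · rw [gammaTerm, gammaTerm, D1_pole]
    simp [z12_zero]

theorem gammaFun_d2 (h : U f r12) (m : M) :
    (push (diagPull M)).D p2 (gammaFun h m) = gammaFun (U.d p2 h) m + gammaFun h (M.D p2 m) := by
  obtain ⟨N₁, h₁⟩ := gammaFun_eq_sum (M := M) h
  obtain ⟨N₂, h₂⟩ := gammaFun_eq_sum (M := M) (U.d p2 h)
  set n := max N₁ N₂
  have hc : ∀ i, (M.D p1)^[i] (M.D p2 m) = M.D p2 ((M.D p1)^[i] m) := by
    intro i
    induction i with
    | zero => rfl
    | succ i ih => rw [Function.iterate_succ_apply', ih, M.D_comm, Function.iterate_succ_apply']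
  have hd : ∀ i (y : diagPull M), (diagPull M).D () (invFact f Unit i • y) =
      invFact f Unit i • (diagPull M).D () y := by
    intro i y
    rw [(diagPull M).D_smul, invFact, S.d_C]
    simp
  -- The two extra sums cancel.
  have key : ∀ i, (push (diagPull M)).D p2 (gammaTerm h m i) =
      gammaTerm (U.d p2 h) m i + gammaTerm h (M.D p2 m) i +
        (pole (h * z12 f i) (invFact f Unit i • bar ((M.D p1)^[i + 1] m)) -
          pole (h * z12 f (i - 1)) (((i : ℤ) • invFact f Unit i) • bar ((M.D p1)^[i] m))) := by
    intro i
    rw [gammaTerm, D2_pole, hd, D_bar, smul_add, pole_add_right, Derivation.leibniz, d2_z12,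
      pole_add_left, gammaTerm, gammaTerm, hc, ← Function.iterate_succ_apply' (M.D p1) i m]
    simp only [Units.val_one, one_smul, smul_eq_mul]
    rw [mul_comm (z12 f _), mul_smul_comm, pole_zsmul_left, smul_assoc (i : ℤ), pole_zsmul_right,
      neg_smul]
    abel
  have tel : ∀ k : ℕ, ∑ i ∈ Finset.range k,
      (pole (h * z12 f i) (invFact f Unit i • bar ((M.D p1)^[i + 1] m)) -
          pole (h * z12 f (i - 1)) (((i : ℤ) • invFact f Unit i) • bar ((M.D p1)^[i] m))) =
      pole (h * z12 f (k - 1)) (((k : ℤ) • invFact f Unit k) • bar ((M.D p1)^[k] m)) := by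
    intro k
    induction k with
    | zero => simp [pole_zero_right]
    | succ k ih =>
      rw [Finset.sum_range_succ, ih, succ_invFact]
      push_cast
      rw [add_sub_cancel_right]
      abel
  obtain ⟨N₃, h₃⟩ := exists_regular h
  set n' := max n (N₃.toNat + 1)
  have hreg : pole (h * z12 f (n' - 1)) (((n' : ℤ) • invFact f Unit n') •
      bar ((M.D p1)^[n'] m)) = 0 := by
    obtain ⟨s, hs⟩ := h₃ (n' - 1) (by omega)
    rw [hs, pole_regular]
  rw [h₁ n' (by omega), h₂ n' (by omega), h₁ n' (by omega), map_sum]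
  simp only [key]
  rw [Finset.sum_add_distrib, tel, hreg, add_zero, Finset.sum_add_distrib]

variable (M) in
/-- The canonical map `j_* j^* M → Δ_* Δ^* M`, the last map of the exact sequence
`0 → Δ_* Δ^! M → M → j_* j^* M → Δ_* Δ^* M → 0`. -/
def gamma : Hom (loc M r12) (push (diagPull M)) where
  toLinearMap := gammaLin M
  map_D i z := by
    change gammaLin M ((loc M r12).D i z) = (push (diagPull M)).D i (gammaLin M z)
    induction z using loc_induction with
    | h0 => simp only [map_zero]
    | ha a b h1 h2 => simp only [map_add, h1, h2]
    | hm h m =>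
      rw [D_locMk, Units.val_one, one_smul, map_add, gammaLin_mk, gammaLin_mk, gammaLin_mk]
      rcases i with ⟨⟩ | ⟨⟩
      · exact (gammaFun_d1 h m).symm
      · exact (gammaFun_d2 h m).symm

end gamma

end DMod

/-! ### Vertex algebras over `X` -/

/-- The structure of a vertex algebra over `X` on `V`. The translation operator `T` is `V.D ()`: it
and the `Γ(X, 𝒪)`-module structure of `V` are related by `T (a v) = (da/dx) v + a T v`, that is, they
make `V` a left `𝒟`-module on `X`. The vertex operators are `Y(v, z) u = ∑_n (mode n v u) z^{-n-1}`.
(They are `ℂ`-bilinear by the axiom `mode_smul_smul`, applied to constant functions.) -/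
structure VertexAlgebraOver (V : LeftDMod.{u} f Unit) where
  /-- the vacuum vector -/
  vac : V
  /-- `mode n v u = v_n u` -/
  mode : ℤ → V →+ V →+ V
  /-- lower truncation -/
  truncation : ∀ v u, ∃ N : ℤ, ∀ n, N ≤ n → mode n v u = 0
  /-- vacuum condition: `Y(vac, z) = id` -/
  mode_vac : ∀ n u, mode n vac u = if n = -1 then u else 0
  /-- creation property: `Y(v, z) vac = v + O(z)` -/
  creation : ∀ v, mode (-1) v vac = v
  creation_nonneg : ∀ v n, 0 ≤ n → mode n v vac = 0
  /-- derivative property: `Y(T v, z) = d/dz Y(v, z)` -/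
  mode_T : ∀ n v u, mode n (V.D () v) u = (-n) • mode (n - 1) v u
  /-- translation covariance: `[T, Y(v, z)] = d/dz Y(v, z)` -/
  T_mode : ∀ n v u, V.D () (mode n v u) = (-n) • mode (n - 1) v u + mode n v (V.D () u)
  /-- locality: the coefficient of `z^{-m-1} w^{-n-1}` in
  `(z - w)^N Y(v, z) Y(u, w) a = (z - w)^N Y(u, w) Y(v, z) a` -/
  locality : ∀ v u a, ∃ N : ℕ, ∀ m n : ℤ,
    ∑ j ∈ Finset.range (N + 1), ((-1) ^ j * (N.choose j : ℤ)) •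
        mode (m + N - j) v (mode (n + j) u a) =
      ∑ j ∈ Finset.range (N + 1), ((-1) ^ j * (N.choose j : ℤ)) •
        mode (n + j) u (mode (m + N - j) v a)
  /-- `Y(g v, z) (h u) = g(x + z) h(x) Y(v, z) u`, where `g(x + z) = ∑_k (1 / k!) (d^k g / dx^k) z^k` -/
  mode_smul_smul : ∀ (g h : S f Unit) n v u, mode n (g • v) (h • u) =
    h • ∑ᶠ k : ℕ, (invFact f Unit k * (S.d ())^[k] g) • mode (n + k) v u

namespace VertexAlgebraOver

open DMod

section bracket

variable {V : LeftDMod.{u} f Unit} (W : VertexAlgebraOver V)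

theorem mode_smul_right (h : S f Unit) (n : ℤ) (v u : V) :
    W.mode n v (h • u) = h • W.mode n v u := by
  have h1 := W.mode_smul_smul 1 h n v u
  rw [one_smul] at h1
  rw [h1, finsum_eq_single _ 0]
  · simp [invFact]
  · intro k hk
    obtain ⟨k, rfl⟩ := Nat.exists_eq_succ_of_ne_zero hk
    have : (S.d ())^[k + 1] (1 : S f Unit) = 0 := by
      rw [Function.iterate_succ_apply, S.d_one, iterate_map_zero]
    rw [this, mul_zero, zero_smul]

theorem mode_C_smul (c : ℂ) (n : ℤ) (v u : V) :
    W.mode n ((algebraMap ℂ (S f Unit) c) • v) u = algebraMap ℂ (S f Unit) c • W.mode n v u := by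
  have h1 := W.mode_smul_smul (algebraMap ℂ _ c) 1 n v u
  rw [one_smul, one_smul] at h1
  rw [h1, finsum_eq_single _ 0]
  · simp [invFact]
  · intro k hk
    obtain ⟨k, rfl⟩ := Nat.exists_eq_succ_of_ne_zero hk
    rw [Function.iterate_succ_apply, S.d_C, iterate_map_zero, mul_zero, zero_smul]

theorem mode_x_smul (n : ℤ) (v u : V) :
    W.mode n ((S.x () : S f Unit) • v) u = (S.x () : S f Unit) • W.mode n v u +
      W.mode (n + 1) v u := by
  have h1 := W.mode_smul_smul (S.x ()) 1 n v u
  rw [one_smul, one_smul] at h1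
  have hd : S.d () (S.x () : S f Unit) = 1 := by simp [S.d_x]
  rw [h1, finsum_eq_sum_of_support_subset (s := Finset.range 2), Finset.sum_range_succ,
    Finset.sum_range_one]
  · simp [invFact, hd]
  · intro k hk
    by_contra hlt
    have hlt : 2 ≤ k := by simp at hlt; omega
    obtain ⟨k, rfl⟩ : ∃ l, k = l + 2 := ⟨k - 2, by omega⟩
    apply hk
    have : (S.d ())^[k + 2] (S.x () : S f Unit) = 0 := by
      rw [Function.iterate_succ_apply, hd, Function.iterate_succ_apply, S.d_one, iterate_map_zero]
    simp only
    rw [this, mul_zero, zero_smul]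

/-- The class of `h Y(v, x_1 - x_2) u = ∑_n h (x_1 - x_2)^{-n-1} (1 ⊠ v_n u)` in `Δ_* V`. Only
finitely many terms are nonzero. -/
def lamFun (h : U f r12) (v u : V) : push V :=
  ∑ᶠ n : ℤ, pole (h * z12 f (-n - 1)) (W.mode n v u)

theorem lam_finite (h : U f r12) (v u : V) :
    (Function.support fun n : ℤ => pole (N := V) (h * z12 f (-n - 1)) (W.mode n v u)).Finite := by
  obtain ⟨N, hN⟩ := W.truncation v u
  obtain ⟨M, hM⟩ := exists_regular h
  refine (Set.finite_Icc (-M) N).subset fun n hn => ?_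
  by_contra hlt
  apply hn
  simp only [Set.mem_Icc, not_and_or, not_le] at hlt
  rcases hlt with hlt | hlt
  · obtain ⟨s, hs⟩ := hM (-n - 1) (by omega)
    simp only [hs, pole_regular]
  · simp only [hN n (by omega), pole_zero_right]

theorem lamFun_add_left (h h' : U f r12) (v u : V) :
    W.lamFun (h + h') v u = W.lamFun h v u + W.lamFun h' v u := by
  rw [lamFun, lamFun, lamFun, ← finsum_add_distrib (W.lam_finite h v u) (W.lam_finite h' v u)]
  exact finsum_congr fun n => by rw [add_mul, pole_add_left]

theorem lamFun_add_mid (h : U f r12) (v v' u : V) :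
    W.lamFun h (v + v') u = W.lamFun h v u + W.lamFun h v' u := by
  rw [lamFun, lamFun, lamFun, ← finsum_add_distrib (W.lam_finite h v u) (W.lam_finite h v' u)]
  exact finsum_congr fun n => by rw [map_add, AddMonoidHom.add_apply, pole_add_right]

theorem lamFun_add_right (h : U f r12) (v u u' : V) :
    W.lamFun h v (u + u') = W.lamFun h v u + W.lamFun h v u' := by
  rw [lamFun, lamFun, lamFun, ← finsum_add_distrib (W.lam_finite h v u) (W.lam_finite h v u')]
  exact finsum_congr fun n => by rw [map_add, pole_add_right]

theorem lamFun_smul_left (s : S f Two) (h : U f r12) (v u : V) :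
    W.lamFun (algebraMap _ _ s * h) v u = s • W.lamFun h v u := by
  rw [lamFun, lamFun]
  refine Eq.trans ?_ ((DistribSMul.toAddMonoidHom (push V) s).map_finsum
    (W.lam_finite h v u)).symm
  exact finsum_congr fun n => by
    rw [DistribSMul.toAddMonoidHom_apply, smul_pole, mul_assoc]

theorem lamFun_smul_right (a : S f Unit) (h : U f r12) (v u : V) :
    W.lamFun h v (a • u) = S.map (Sum.inr : Unit → Two) a • W.lamFun h v u := by
  rw [← lamFun_smul_left, lamFun, lamFun]
  exact finsum_congr fun n => by rw [mode_smul_right, pole_smul, mul_assoc]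

theorem lamFun_smul_mid (a : S f Unit) : ∀ (h : U f r12) (v u : V),
    W.lamFun h (a • v) u = W.lamFun (algebraMap _ _ (S.map (Sum.inl : Unit → Two) a) * h) v u := by
  induction a using S.induction with
  | hC c =>
    intro h v u
    rw [lamFun, lamFun]
    exact finsum_congr fun n => by rw [mode_C_smul, pole_smul, S.map_C, S.map_C, mul_assoc]
  | hx i =>
    intro h v u
    have e : algebraMap (S f Two) (U f r12) (S.map (Sum.inl : Unit → Two) (S.x i)) =
        algebraMap (S f Two) _ (S.map (Sum.inr : Unit → Two) (S.x i)) + z12 f 1 := by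
      rw [z12_one, ← map_add]; congr 1; simp
    rw [e, add_mul, lamFun_add_left, lamFun_smul_left, ← lamFun_smul_right]
    have e2 : W.lamFun (z12 f 1 * h) v u =
        ∑ᶠ n : ℤ, pole (h * z12 f (-n - 1)) (W.mode (n + 1) v u) := by
      rw [lamFun, ← finsum_comp_equiv (Equiv.addRight (1 : ℤ))]
      refine finsum_congr fun n => ?_
      rw [Equiv.coe_addRight, mul_comm (z12 f 1), mul_assoc, ← z12_add]
      congr 3
      ring
    have hfin : (Function.support fun n : ℤ =>
        pole (N := V) (h * z12 f (-n - 1)) (W.mode (n + 1) v u)).Finite := by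
      have := (W.lam_finite (z12 f 1 * h) v u).preimage
        ((Equiv.addRight (1 : ℤ)).injective.injOn)
      refine this.subset fun n hn => ?_
      simp only [Set.mem_preimage, Function.mem_support, Equiv.coe_addRight] at hn ⊢
      have e3 : z12 f 1 * h * z12 f (-(n + 1) - 1) = h * z12 f (-n - 1) := by
        rw [mul_comm (z12 f 1), mul_assoc, ← z12_add]
        congr 2
        ring
      rwa [e3]
    rw [e2, lamFun, lamFun, ← finsum_add_distrib (W.lam_finite h v _) hfin]
    exact finsum_congr fun n => by rw [mode_x_smul, mode_smul_right, pole_add_right]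
  | hadd a b ha hb =>
    intro h v u
    rw [add_smul, lamFun_add_mid, ha, hb, map_add, map_add, add_mul, lamFun_add_left]
  | hmul a b ha hb =>
    intro h v u
    rw [mul_smul, ha, hb, map_mul, map_mul, ← mul_assoc,
      mul_comm (algebraMap _ _ (S.map _ b))]
  | hinv a b hab ha =>
    intro h v u
    have h1 := ha (algebraMap _ _ (S.map (Sum.inl : Unit → Two) b) * h) (b • v) u
    rw [smul_smul, hab, one_smul, ← mul_assoc, ← map_mul, ← map_mul, hab, map_one, map_one,
      one_mul] at h1
    exact h1.symm

theorem lamFun_d1 (h : U f r12) (v u : V) : (push V).D p1 (W.lamFun h v u) =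
    W.lamFun (U.d p1 h) v u + W.lamFun h (V.D () v) u := by
  have e2 : W.lamFun h (V.D () v) u =
      ∑ᶠ n : ℤ, (-n - 1) • pole (h * z12 f (-n - 1 - 1)) (W.mode n v u) := by
    rw [lamFun, ← finsum_comp_equiv (Equiv.addRight (1 : ℤ))]
    refine finsum_congr fun n => ?_
    rw [Equiv.coe_addRight, mode_T, pole_zsmul_right, add_sub_cancel_right, neg_add',
      sub_sub (-n) 1 1]
  have hfin : (Function.support fun n : ℤ =>
      (-n - 1) • pole (N := V) (h * z12 f (-n - 1 - 1)) (W.mode n v u)).Finite := by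
    refine (W.lam_finite (h * z12 f (-1)) v u).subset fun n hn => ?_
    simp only [Function.mem_support] at hn ⊢
    intro h0
    apply hn
    rw [mul_assoc, ← z12_add] at h0
    have : -n - 1 - 1 = -1 + (-n - 1) := by ring
    rw [this, h0, smul_zero]
  rw [e2, lamFun, lamFun, ← finsum_add_distrib (W.lam_finite _ v u) hfin,
    AddMonoidHom.map_finsum _ (W.lam_finite h v u)]
  refine finsum_congr fun n => ?_
  rw [D1_pole, Derivation.leibniz, d1_z12, pole_add_left, Units.val_one, one_smul, add_comm]
  simp only [smul_eq_mul]
  rw [mul_smul_comm, pole_zsmul_left, mul_comm (z12 f _)]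

theorem lamFun_d2 (h : U f r12) (v u : V) : (push V).D p2 (W.lamFun h v u) =
    W.lamFun (U.d p2 h) v u + W.lamFun h v (V.D () u) := by
  rw [lamFun, AddMonoidHom.map_finsum _ (W.lam_finite h v u)]
  have e : ∀ n : ℤ, (push V).D p2 (pole (h * z12 f (-n - 1)) (W.mode n v u)) =
      (pole (U.d p2 h * z12 f (-n - 1)) (W.mode n v u) +
        pole (h * z12 f (-n - 1)) (W.mode n v (V.D () u))) +
      ((n + 1) • pole (h * z12 f (-n - 1 - 1)) (W.mode n v u) +
        pole (h * z12 f (-n - 1)) (W.mode n (V.D () v) u)) := by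
    intro n
    rw [D2_pole, Derivation.leibniz, d2_z12, pole_add_left, Units.val_one, one_smul, T_mode,
      ← mode_T, pole_add_right]
    simp only [smul_eq_mul]
    rw [mul_smul_comm, pole_zsmul_left, mul_comm (z12 f _)]
    have : -(-n - 1) = n + 1 := by ring
    rw [this]
    abel
  have hfin : (Function.support fun n : ℤ =>
      (n + 1) • pole (N := V) (h * z12 f (-n - 1 - 1)) (W.mode n v u)).Finite := by
    refine (W.lam_finite (h * z12 f (-1)) v u).subset fun n hn => ?_
    simp only [Function.mem_support] at hn ⊢
    intro h0
    apply hn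
    rw [mul_assoc, ← z12_add] at h0
    have : -n - 1 - 1 = -1 + (-n - 1) := by ring
    rw [this, h0, smul_zero]
  have e2 : ∑ᶠ n : ℤ, pole (h * z12 f (-n - 1)) (W.mode n (V.D () v) u) =
      ∑ᶠ n : ℤ, (-n - 1) • pole (h * z12 f (-n - 1 - 1)) (W.mode n v u) := by
    rw [← finsum_comp_equiv (Equiv.addRight (1 : ℤ))]
    refine finsum_congr fun n => ?_
    rw [Equiv.coe_addRight, mode_T, pole_zsmul_right, add_sub_cancel_right, neg_add',
      sub_sub (-n) 1 1]
  rw [finsum_congr e, finsum_add_distrib, finsum_add_distrib (W.lam_finite _ _ _)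
    (W.lam_finite _ _ _), finsum_add_distrib hfin (W.lam_finite _ _ _), e2, ← lamFun, ← lamFun]
  · have : ∀ n : ℤ, (-n - 1) • pole (N := V) (h * z12 f (-n - 1 - 1)) (W.mode n v u) =
        -((n + 1) • pole (h * z12 f (-n - 1 - 1)) (W.mode n v u)) := by
      intro n
      rw [← neg_smul]; congr 1; ring
    rw [finsum_congr this, finsum_neg_distrib, add_neg_cancel, add_zero]
  · exact ((W.lam_finite _ _ _).union (W.lam_finite _ _ _)).subset
      (Function.support_add _ _)
  · exact (hfin.union (W.lam_finite _ _ _)).subset (Function.support_add _ _)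

/-- The map `v ↦ u ↦ (h ↦ h Y(v, x_1 - x_2) u)`. -/
def lamAux : V →+ V →+ (U f r12 →ₗ[S f Two] push V) :=
  AddMonoidHom.mk' (fun v => AddMonoidHom.mk' (fun u =>
    { toFun := fun h => W.lamFun h v u
      map_add' := fun a b => W.lamFun_add_left a b v u
      map_smul' := fun s a => by
        rw [Algebra.smul_def, lamFun_smul_left, RingHom.id_apply] })
    (fun a b => by ext h; exact W.lamFun_add_right h v a b))
    (fun a b => by ext u h; exact W.lamFun_add_mid h a b u)

/-- The linear map underlying `lambdaCh`. -/
def lamLin : loc (box V V) r12 →ₗ[S f Two] push V :=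
  TensorProduct.lift (R := S f Two) (M := U f r12) (N := box V V)
    (boxLift W.lamAux
      (fun a v u => by
        ext h
        refine (W.lamFun_smul_mid a h v u).trans ?_
        exact W.lamFun_smul_left _ h v u)
      (fun a v u => by
        ext h
        exact W.lamFun_smul_right a h v u)).flip

theorem lamLin_mk (h : U f r12) (v u : V) :
    W.lamLin (locMk h (boxMk v u)) = W.lamFun h v u := by
  have := boxLift_mk (M := V) (N := V) W.lamAux
      (fun a v u => by
        ext h
        refine (W.lamFun_smul_mid a h v u).trans ?_
        exact W.lamFun_smul_left _ h v u)
      (fun a v u => by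
        ext h
        exact W.lamFun_smul_right a h v u) v u
  exact LinearMap.congr_fun this h

/-- The map of left `𝒟`-modules `λ : j_* j^* (V ⊠ V) → Δ_* V`,
`h (v ⊠ u) ↦ h Y(v, x_1 - x_2) u mod 𝒪 ⊠ V`. -/
def lambdaCh : Hom (loc (box V V) r12) (push V) where
  toLinearMap := W.lamLin
  map_D i z := by
    change W.lamLin ((loc (box V V) r12).D i z) = (push V).D i (W.lamLin z)
    induction z using loc_induction with
    | h0 => simp only [map_zero]
    | ha a b h1 h2 => simp only [map_add, h1, h2]
    | hm h m =>
      induction m using box_induction generalizing h with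
      | h0 =>
        have : locMk (r := r12) h (0 : box V V) = 0 :=
          TensorProduct.tmul_zero (R := S f Two) (M := U f r12) (N := box V V) h
        rw [this]; simp only [map_zero]
      | ha a b h1 h2 => rw [locMk_add]; simp only [map_add, h1, h2]
      | hm s v u =>
        rw [locMk_smul, smul_locMk']
        generalize algebraMap _ _ s * h = h
        rw [D_locMk, Units.val_one, one_smul, map_add, lamLin_mk, lamLin_mk]
        rcases i with ⟨⟩ | ⟨⟩
        · rw [D_inl_boxMk, lamLin_mk]
          exact (W.lamFun_d1 h v u).symm
        · rw [D_inr_boxMk, lamLin_mk]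
          exact (W.lamFun_d2 h v u).symm

end bracket

end VertexAlgebraOver

/-! ### Left and right `𝒟`-modules -/

namespace DMod

/-- A morphism of left `𝒟`-modules as a morphism of the corresponding right `𝒟`-modules. -/
def Hom.toRight {M : LeftDMod.{u} f I} {N : LeftDMod.{v} f I} (φ : Hom M N) :
    Hom M.toRight N.toRight where
  toFun m := φ m
  map_add' a b := map_add φ.toLinearMap a b
  map_smul' s a := map_smul φ.toLinearMap s a
  map_D i m := (map_neg φ.toLinearMap (M.D i m)).trans (congrArg Neg.neg (φ.apply_D i m))

section sides

variable {ε ε' : ℤˣ}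

/-- The map `M ⊠ N → M' ⊠ N'` induced by maps `M → M'` and `N → N'`. -/
def boxMap [Finite I] [Finite J] {M : DMod.{u} f I ε} {N : DMod.{v} f J ε} {M' : DMod.{u} f I ε'}
    {N' : DMod.{v} f J ε'} (φ : M →ₗ[S f I] M') (ψ : N →ₗ[S f J] N') :
    box M N →ₗ[S f (I ⊕ J)] box M' N' :=
  boxLift (AddMonoidHom.mk' (fun m => AddMonoidHom.mk' (fun n => boxMk (φ m) (ψ n))
      (fun a b => by rw [map_add, boxMk_add_right]))
      (fun a b => by
        ext n
        simp only [AddMonoidHom.mk'_apply, AddMonoidHom.add_apply, map_add, boxMk_add_left]))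
    (fun a m n => by simp only [AddMonoidHom.mk'_apply, map_smul, boxMk_smul_left])
    (fun a m n => by simp only [AddMonoidHom.mk'_apply, map_smul, boxMk_smul_right])

theorem boxMap_mk [Finite I] [Finite J] {M : DMod.{u} f I ε} {N : DMod.{v} f J ε}
    {M' : DMod.{u} f I ε'} {N' : DMod.{v} f J ε'} (φ : M →ₗ[S f I] M') (ψ : N →ₗ[S f J] N')
    (m : M) (n : N) : boxMap φ ψ (boxMk m n) = boxMk (φ m) (ψ n) := boxLift_mk _ _ _ m n

theorem boxMap_D [Finite I] [Finite J] {M : DMod.{u} f I ε} {N : DMod.{v} f J ε}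
    {M' : DMod.{u} f I ε'} {N' : DMod.{v} f J ε'} (φ : M →ₗ[S f I] M') (ψ : N →ₗ[S f J] N')
    (c : ℤ) (hc : c * (ε : ℤ) = ε') (hφ : ∀ i m, c • φ (M.D i m) = M'.D i (φ m))
    (hψ : ∀ j n, c • ψ (N.D j n) = N'.D j (ψ n)) (i : I ⊕ J) (z : box M N) :
    c • boxMap φ ψ ((box M N).D i z) = (box M' N').D i (boxMap φ ψ z) := by
  have hl : ∀ (m : M') (n : N'), boxMk (c • m) n = c • boxMk m n := fun m n =>
    map_zsmul (AddMonoidHom.mk' (fun m => boxMk m n) (fun a b => boxMk_add_left a b n)) c m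
  have hr : ∀ (m : M') (n : N'), boxMk m (c • n) = c • boxMk m n := fun m n =>
    map_zsmul (AddMonoidHom.mk' (fun n => boxMk m n) (fun a b => boxMk_add_right m a b)) c n
  induction z using box_induction with
  | h0 => simp only [map_zero, smul_zero]
  | ha a b h1 h2 => simp only [map_add, smul_add, h1, h2]
  | hm s m n =>
    rw [(box M N).D_smul, map_add, map_zsmul, map_smul, map_smul, map_smul, (box M' N').D_smul,
      smul_add, smul_smul, hc, boxMap_mk, smul_comm c s]
    rcases i with i | i
    · rw [D_inl_boxMk, D_inl_boxMk, boxMap_mk, ← hφ, hl]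
    · rw [D_inr_boxMk, D_inr_boxMk, boxMap_mk, ← hψ, hr]

/-- The map `j_* j^* M → j_* j^* N` induced by a map `M → N`. -/
def locMapLin {M : DMod.{u} f I ε} {N : DMod.{u} f I ε'} (r : Setoid I) (φ : M →ₗ[S f I] N) :
    loc M r →ₗ[U f r] loc N r := locLift ((toLoc N r).toLinearMap ∘ₗ φ)

theorem locMapLin_mk {M : DMod.{u} f I ε} {N : DMod.{u} f I ε'} (r : Setoid I)
    (φ : M →ₗ[S f I] N) (h : U f r) (m : M) :
    locMapLin r φ (locMk h m) = locMk h (φ m) := by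
  refine (locLift_mk _ h m).trans ?_
  change h • locMk 1 (φ m) = _
  rw [smul_locMk, mul_one]

theorem locMapLin_D {M : DMod.{u} f I ε} {N : DMod.{u} f I ε'} (r : Setoid I)
    (φ : M →ₗ[S f I] N) (c : ℤ) (hc : c * (ε : ℤ) = ε')
    (hφ : ∀ i m, c • φ (M.D i m) = N.D i (φ m)) (i : I) (z : loc M r) :
    c • locMapLin r φ ((loc M r).D i z) = (loc N r).D i (locMapLin r φ z) := by
  have hr : ∀ (h : U f r) (n : N), locMk h (c • n) = c • locMk h n := fun h n =>
    map_zsmul (AddMonoidHom.mk' (fun n => locMk h n) (fun a b => locMk_add h a b)) c n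
  induction z using loc_induction with
  | h0 => simp only [map_zero, smul_zero]
  | ha a b h1 h2 => simp only [map_add, smul_add, h1, h2]
  | hm h m =>
    rw [D_locMk, map_add, map_zsmul, locMapLin_mk, locMapLin_mk, locMapLin_mk, D_locMk, smul_add,
      smul_smul, hc, ← hφ, hr]

/-- The map `j_* j^* M / M → j_* j^* N / N` induced by a map `M → N`. -/
def cokerMapLin {M : DMod.{u} f I ε} {N : DMod.{u} f I ε'} (r : Setoid I) (φ : M →ₗ[S f I] N) :
    coker M r →ₗ[S f I] coker N r :=
  Submodule.mapQ (regular M r) (regular N r) ((locMapLin r φ).restrictScalars (S f I)) (by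
    rintro _ ⟨m, rfl⟩
    exact ⟨φ m, (locMapLin_mk r φ 1 m).symm⟩)

theorem cokerMapLin_D {M : DMod.{u} f I ε} {N : DMod.{u} f I ε'} (r : Setoid I)
    (φ : M →ₗ[S f I] N) (c : ℤ) (hc : c * (ε : ℤ) = ε')
    (hφ : ∀ i m, c • φ (M.D i m) = N.D i (φ m)) (i : I) (z : coker M r) :
    c • cokerMapLin r φ ((coker M r).D i z) = (coker N r).D i (cokerMapLin r φ z) := by
  obtain ⟨z, rfl⟩ := (regular M r).mkQ_surjective z
  exact congrArg (regular N r).mkQ (locMapLin_D r φ c hc hφ i z)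

/-- The identification of the underlying modules of `M ⊗ ω` and of `M`, `m dx ↦ m`. -/
def ofRight (M : LeftDMod.{u} f I) : M.toRight →ₗ[S f I] M where
  toFun m := m
  map_add' _ _ := rfl
  map_smul' _ _ := rfl

/-- The identification of the underlying modules of `M` and of `M ⊗ ω`, `m ↦ m dx`. -/
def ontoRight (M : LeftDMod.{u} f I) : M →ₗ[S f I] M.toRight where
  toFun m := m
  map_add' _ _ := rfl
  map_smul' _ _ := rfl

/-- The canonical map of right `𝒟`-modules
`j_* j^* ((V ⊗ ω) ⊠ (V ⊗ ω)) → j_* j^* (V ⊠ V) ⊗ ω`, an isomorphism. -/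
def sourceSide (V : LeftDMod.{u} f Unit) :
    Hom (loc (box V.toRight V.toRight) r12) (loc (box V V) r12).toRight where
  toFun z := locMapLin r12 (boxMap (ofRight V) (ofRight V)) z
  map_add' a b := map_add (locMapLin r12 (boxMap (ofRight V) (ofRight V))) a b
  map_smul' s z :=
    map_smul ((locMapLin r12 (boxMap (ofRight V) (ofRight V))).restrictScalars (S f Two)) s z
  map_D i z := by
    have h : ∀ (i : Unit) m, (-1 : ℤ) • ofRight V (V.toRight.D i m) = V.D i (ofRight V m) :=
      fun i m => by
        rw [neg_one_smul]
        exact neg_neg (V.D i m)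
    have h2 := locMapLin_D r12 (boxMap (ofRight V) (ofRight V)) (-1) (by simp)
      (boxMap_D _ _ _ (by simp) h h) i z
    rw [neg_one_smul] at h2
    exact neg_eq_iff_eq_neg.1 h2

/-- The canonical map of right `𝒟`-modules `(Δ_* V) ⊗ ω → Δ_! (V ⊗ ω)`, an isomorphism. -/
def targetSide (V : LeftDMod.{u} f Unit) : Hom (push V).toRight (push V.toRight) where
  toFun z := cokerMapLin r12 (boxMap (M := one f Unit 1) (M' := one f Unit (-1))
    (LinearMap.id : S f Unit →ₗ[S f Unit] S f Unit) (ontoRight V)) z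
  map_add' a b := map_add (cokerMapLin r12 _) a b
  map_smul' s z := map_smul (cokerMapLin r12 _) s z
  map_D i z := by
    have h : ∀ (i : Unit) m, (-1 : ℤ) • ontoRight V (V.D i m) = V.toRight.D i (ontoRight V m) :=
      fun i m => by
        rw [neg_one_smul]
        rfl
    have h' : ∀ (i : Unit) (m : S f Unit), (-1 : ℤ) • ((one f Unit 1).D i m : S f Unit) =
        (one f Unit (-1)).D i m :=
      fun i m => by
        change (-1 : ℤ) • ((1 : ℤ) • S.d i m) = (-1 : ℤ) • S.d i m
        rw [one_smul]
    have h2 := cokerMapLin_D r12 (boxMap (M := one f Unit 1) (M' := one f Unit (-1))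
      (LinearMap.id : S f Unit →ₗ[S f Unit] S f Unit) (ontoRight V)) (-1) (by simp)
      (boxMap_D _ _ _ (by simp) h' h) i z
    rw [neg_one_smul] at h2
    exact (map_neg (cokerMapLin r12 _) _).trans h2

/-- The map of right `𝒟`-modules `j_* j^* (A ⊠ A) → Δ_! A`, `A = V ⊗ ω`, that corresponds to a map
of left `𝒟`-modules `j_* j^* (V ⊠ V) → Δ_* V`. -/
def sideChange {V : LeftDMod.{u} f Unit} (lam : Hom (loc (box V V) r12) (push V)) :
    Hom (loc (box V.toRight V.toRight) r12) (push V.toRight) :=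
  (targetSide V).comp (lam.toRight.comp (sourceSide V))

end sides

end DMod

/-! ### `(A, H, S_X)`-vertex algebras -/

namespace DMod

/-- The map `j_* j^* M → j_* j^* N` over `U(α)` induced by a map `φ : M → N` over `φ(α)`: on
`V(I) ⊗ Γ(U(I), 𝒪)` this is `α_* ⊗ α_*`. It extends functors on finite sets to functors on finite
sets with an equivalence relation. -/
def locMap {ε : ℤˣ} {M : DMod.{u} f I ε} {N : DMod.{u} f J ε} {r : Setoid I} {s : Setoid J}
    (α : I → J) (hα : PresNEq r s α) (φ : M →+ N)
    (hφ : ∀ (a : S f I) m, φ (a • m) = S.map α a • φ m) : loc M r →+ loc N s :=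
  TensorProduct.liftAddHom (R := S f I) (M := U f r) (N := M)
    (AddMonoidHom.mk' (fun h => AddMonoidHom.mk' (fun m => locMk (U.map α hα h) (φ m))
      (fun a b => by rw [map_add, locMk_add]))
      (fun a b => by
        ext m
        simp only [AddMonoidHom.mk'_apply, AddMonoidHom.add_apply, map_add, locMk_add_left]))
    (fun a h m => by
      simp only [AddMonoidHom.mk'_apply, hφ, Algebra.smul_def, map_mul, U.map_algebraMap]
      rw [locMk_smul, smul_locMk'])

theorem locMap_mk {ε : ℤˣ} {M : DMod.{u} f I ε} {N : DMod.{u} f J ε} {r : Setoid I}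
    {s : Setoid J} (α : I → J) (hα : PresNEq r s α) (φ : M →+ N)
    (hφ : ∀ (a : S f I) m, φ (a • m) = S.map α a • φ m) (h : U f r) (m : M) :
    locMap α hα φ hφ (locMk h m) = locMk (U.map α hα h) (φ m) := rfl

end DMod

open DMod

variable (f) in
/-- A (unital) `(A, H, S_X)`-vertex algebra, where `X ⊆ 𝔸¹` is the open affine set `f ≠ 0`: a
singular commutative ring object in the category of functors `V` from finite sets to complex vector
spaces with actions of `T` and of `S_X`.

The extension of `V` to a finite set `I` with an equivalence relation `r` is
`loc (obj I) r = Γ(U(I), 𝒪) ⊗ V(I)`. -/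
structure AHSVertexAlgebra where
  /-- The vector space `V(I)` with its actions of `T(I) = ℂ[∂_i]` and of `S_X(I)`. -/
  obj (I : Type) [Finite I] : LeftDMod.{u} f I
  /-- The map `α_* : V(I) → V(J)`. -/
  map {I J : Type} [Finite I] [Finite J] (α : I → J) : obj I →+ obj J
  map_id {I : Type} [Finite I] (v : obj I) : map id v = v
  map_map {I J K : Type} [Finite I] [Finite J] [Finite K] (α : I → J) (β : J → K) (v : obj I) :
    map β (map α v) = map (β ∘ α) v
  /-- Compatibility with the actions of `S_X`. -/
  map_smul {I J : Type} [Finite I] [Finite J] (α : I → J) (s : S f I) (v : obj I) :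
    map α (s • v) = S.map α s • map α v
  /-- Compatibility with the actions of `T`: `∂_j (α_* v) = α_* (∑_{i ∈ α⁻¹(j)} ∂_i v)`. -/
  D_map {I J : Type} [Finite I] [Finite J] (α : I → J) (j : J) (v : obj I) :
    (obj J).D j (map α v) = map α (∑ i ∈ fiber α j, (obj I).D i v)
  /-- The singular multiplication `V(I) × V(J) → V(I ⊔ J)`, for finite sets with equivalence
  relations `r` and `s`. -/
  mul {I J : Type} [Finite I] [Finite J] (r : Setoid I) (s : Setoid J) :
    loc (obj I) r →+ loc (obj J) s →+ loc (obj (I ⊕ J)) (sumSetoid r s)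
  /-- The multiplication commutes with the actions of `S_X(I)` and `S_X(J)`. -/
  mul_smul_left {I J : Type} [Finite I] [Finite J] (r : Setoid I) (s : Setoid J) (a : U f r)
    (v : loc (obj I) r) (w : loc (obj J) s) :
    mul r s (a • v) w = U.map Sum.inl (presNEq_inl r s) a • mul r s v w
  mul_smul_right {I J : Type} [Finite I] [Finite J] (r : Setoid I) (s : Setoid J) (a : U f s)
    (v : loc (obj I) r) (w : loc (obj J) s) :
    mul r s v (a • w) = U.map Sum.inr (presNEq_inr r s) a • mul r s v w
  /-- The multiplication commutes with the actions of `T(I)` and `T(J)`. -/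
  mul_D_left {I J : Type} [Finite I] [Finite J] (r : Setoid I) (s : Setoid J) (i : I)
    (v : loc (obj I) r) (w : loc (obj J) s) :
    mul r s ((loc (obj I) r).D i v) w = (loc (obj (I ⊕ J)) _).D (Sum.inl i) (mul r s v w)
  mul_D_right {I J : Type} [Finite I] [Finite J] (r : Setoid I) (s : Setoid J) (j : J)
    (v : loc (obj I) r) (w : loc (obj J) s) :
    mul r s v ((loc (obj J) s).D j w) = (loc (obj (I ⊕ J)) _).D (Sum.inr j) (mul r s v w)
  /-- The multiplication is functorial in both arguments. -/
  mul_map {I J I' J' : Type} [Finite I] [Finite J] [Finite I'] [Finite J'] (r : Setoid I)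
    (s : Setoid J) (r' : Setoid I') (s' : Setoid J') (α : I → I') (hα : PresNEq r r' α)
    (β : J → J') (hβ : PresNEq s s' β) (v : loc (obj I) r) (w : loc (obj J) s) :
    mul r' s' (locMap α hα (map α) (map_smul α) v) (locMap β hβ (map β) (map_smul β) w) =
      locMap (Sum.map α β) (presNEq_map hα hβ) (map _) (map_smul _) (mul r s v w)
  /-- The multiplication is commutative. -/
  mul_comm {I J : Type} [Finite I] [Finite J] (r : Setoid I) (s : Setoid J)
    (v : loc (obj I) r) (w : loc (obj J) s) :
    locMap Sum.swap (presNEq_swap r s) (map _) (map_smul _) (mul r s v w) = mul s r w v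
  /-- The multiplication is associative. -/
  mul_assoc {I J K : Type} [Finite I] [Finite J] [Finite K] (r : Setoid I) (s : Setoid J)
    (t : Setoid K) (u : loc (obj I) r) (v : loc (obj J) s) (w : loc (obj K) t) :
    locMap (Equiv.sumAssoc I J K) (presNEq_assoc r s t) (map _) (map_smul _)
      (mul (sumSetoid r s) t (mul r s u v) w) = mul r (sumSetoid s t) u (mul s t v w)
  /-- The unit `S_X → V`. -/
  unit (I : Type) [Finite I] : S f I →ₗ[S f I] obj I
  unit_map {I J : Type} [Finite I] [Finite J] (α : I → J) (a : S f I) :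
    map α (unit I a) = unit J (S.map α a)
  unit_D {I : Type} [Finite I] (i : I) (a : S f I) : (obj I).D i (unit I a) = unit I (S.d i a)
  /-- Compatibility of the unit and the multiplication: the product of `a ∈ S_X(I)` and `v ∈ V(J)` is
  the image in `V(I : J)` of `a ⬝ v ∈ V(I, J)`. In particular the unit is multiplicative. -/
  unit_mul {I J : Type} [Finite I] [Finite J] (a : S f I) (v : obj J) :
    mul ⊤ ⊤ (locMk 1 (unit I a)) (locMk 1 v) =
      locMk 1 (S.map (Sum.inl : I → I ⊕ J) a • map Sum.inr v)

namespace AHSVertexAlgebra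

variable (𝕍 : AHSVertexAlgebra.{u} f)

/-- The left `𝒟`-module `𝒱 = 𝒱(1)` on `X`, with global sections `V(1)`. -/
abbrev V1 : LeftDMod.{u} f Unit := 𝕍.obj Unit

/-- The left `𝒟`-module `𝒱(1, 2)` on `X²`, with global sections `V(1, 2)`. -/
abbrev V12 : LeftDMod.{u} f Two := 𝕍.obj Two

/-- The singular multiplication `μ₁₂ : V(1) × V(2) → V(1 : 2) = Γ(X² ∖ Δ, 𝒪) ⊗ V(1, 2)`. -/
def mul12 : 𝕍.V1 →+ 𝕍.V1 →+ loc 𝕍.V12 r12 :=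
  AddMonoidHom.mk' (fun v => AddMonoidHom.mk'
    (fun u => 𝕍.mul ⊤ ⊤ (locMk 1 v) (locMk 1 u))
    (fun a b => (congrArg (𝕍.mul ⊤ ⊤ (locMk 1 v)) (locMk_add 1 a b)).trans (map_add _ _ _)))
    (fun a b => AddMonoidHom.ext fun u => by
      refine (congrArg (fun z => 𝕍.mul ⊤ ⊤ z (locMk 1 u)) (locMk_add 1 a b)).trans ?_
      simp only [map_add, AddMonoidHom.add_apply]
      rfl)

theorem mul12_apply (v u : 𝕍.V1) : 𝕍.mul12 v u = 𝕍.mul ⊤ ⊤ (locMk 1 v) (locMk 1 u) := rfl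

theorem mul12_smul_left (a : S f Unit) (v u : 𝕍.V1) :
    𝕍.mul12 (a • v) u = S.map (Sum.inl : Unit → Two) a • 𝕍.mul12 v u := by
  rw [mul12_apply, locMk_smul, ← algebraMap_smul (U f (⊤ : Setoid Unit)) a, 𝕍.mul_smul_left,
    U.map_algebraMap, algebraMap_smul]
  rfl

theorem mul12_smul_right (a : S f Unit) (v u : 𝕍.V1) :
    𝕍.mul12 v (a • u) = S.map (Sum.inr : Unit → Two) a • 𝕍.mul12 v u := by
  rw [mul12_apply, locMk_smul, ← algebraMap_smul (U f (⊤ : Setoid Unit)) a, 𝕍.mul_smul_right,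
    U.map_algebraMap, algebraMap_smul]
  rfl

theorem mul12_D_left (v u : 𝕍.V1) :
    𝕍.mul12 (𝕍.V1.D () v) u = (loc 𝕍.V12 r12).D p1 (𝕍.mul12 v u) := by
  have h := (toLoc 𝕍.V1 ⊤).apply_D () v
  have h2 := 𝕍.mul_D_left ⊤ ⊤ () (locMk 1 v : loc 𝕍.V1 ⊤) (locMk 1 u : loc 𝕍.V1 ⊤)
  exact (congrArg (fun z => 𝕍.mul ⊤ ⊤ z (locMk 1 u)) h).trans h2

theorem mul12_D_right (v u : 𝕍.V1) :
    𝕍.mul12 v (𝕍.V1.D () u) = (loc 𝕍.V12 r12).D p2 (𝕍.mul12 v u) := by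
  have h := (toLoc 𝕍.V1 ⊤).apply_D () u
  have h2 := 𝕍.mul_D_right ⊤ ⊤ () (locMk 1 v : loc 𝕍.V1 ⊤) (locMk 1 u : loc 𝕍.V1 ⊤)
  exact (congrArg (fun z => 𝕍.mul ⊤ ⊤ (locMk 1 v) z) h).trans h2

/-- The map on `V(1) ⊗ V(2)` induced by `μ₁₂`. -/
def mulBox : box 𝕍.V1 𝕍.V1 →ₗ[S f Two] loc 𝕍.V12 r12 :=
  boxLift 𝕍.mul12 𝕍.mul12_smul_left (fun a v u => 𝕍.mul12_smul_right a v u)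

theorem mulBox_mk (v u : 𝕍.V1) : 𝕍.mulBox (boxMk v u) = 𝕍.mul12 v u := boxLift_mk _ _ _ v u

/-- The first map `j_* j^* (𝒱 ⊠ 𝒱) → j_* j^* 𝒱(1, 2)`, the extension of `μ₁₂` to the localization
`Γ(X² ∖ Δ, 𝒪) ⊗ (V(1) ⊗ V(2))`. -/
def mulLoc : Hom (loc (box 𝕍.V1 𝕍.V1) r12) (loc 𝕍.V12 r12) where
  toLinearMap := (locLift 𝕍.mulBox).restrictScalars (S f Two)
  map_D i z := by
    change locLift 𝕍.mulBox ((loc (box 𝕍.V1 𝕍.V1) r12).D i z) =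
      (loc 𝕍.V12 r12).D i (locLift 𝕍.mulBox z)
    induction z using loc_induction with
    | h0 => simp only [map_zero]
    | ha a b h1 h2 => simp only [map_add, h1, h2]
    | hm h m =>
      induction m using box_induction generalizing h with
      | h0 =>
        have : locMk (r := r12) h (0 : box 𝕍.V1 𝕍.V1) = 0 :=
          TensorProduct.tmul_zero (R := S f Two) (M := U f r12) (N := box 𝕍.V1 𝕍.V1) h
        rw [this]; simp only [map_zero]
      | ha a b h1 h2 => rw [locMk_add]; simp only [map_add, h1, h2]
      | hm s v u =>
        rw [locMk_smul, smul_locMk']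
        generalize algebraMap _ _ s * h = h
        rw [D_locMk, Units.val_one, one_smul, map_add, locLift_mk, locLift_mk, locLift_mk,
          mulBox_mk, loc_D_smul, Units.val_one, one_smul]
        rcases i with ⟨⟩ | ⟨⟩
        · rw [D_inl_boxMk, mulBox_mk, mul12_D_left]
        · rw [D_inr_boxMk, mulBox_mk, mul12_D_right]

/-- The map of left `𝒟`-modules `α̃ : Δ^* 𝒱(1, 2) → 𝒱(1)` induced by `α_* : V(1, 2) → V(1)`, for
`α : {1, 2} → {1}`. -/
def alphaTilde : Hom (diagPull 𝕍.V12) 𝕍.V1 where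
  toLinearMap := pullLift diag (𝕍.map diag) (𝕍.map_smul diag)
  map_D i z := by
    change pullLift diag _ _ ((diagPull 𝕍.V12).D i z) = 𝕍.V1.D i (pullLift diag _ _ z)
    induction z using pull_induction with
    | h0 => simp only [map_zero]
    | ha a b h1 h2 => simp only [map_add, h1, h2]
    | hm s m =>
      rw [D_pullMk, map_add, map_zsmul, pullLift_mk, pullLift_mk, pullLift_mk, 𝕍.V1.D_smul,
        𝕍.D_map]

end AHSVertexAlgebra


/-! ### The functors `Φ_X` and `Ψ_X` -/

variable (f) in
/-- The data of a chiral algebra on `X`: a right `𝒟`-module `A` and a map of right `𝒟`-modules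
`j_* j^* (A ⊠ A) → Δ_! A`. -/
structure ChiralData where
  /-- the underlying right `𝒟`-module -/
  module : RightDMod.{u} f Unit
  /-- the chiral bracket -/
  bracket : Hom (loc (box module module) r12) (push module)

namespace VertexAlgebraOver

/-- The functor `Ψ_X` from vertex algebras to chiral algebras on `X`, on objects: the right `𝒟`-module is
`A = V ⊗ ω`, and the chiral bracket `μ : j_* j^* (A ⊠ A) → Δ_! A` corresponds to the map of left
`𝒟`-modules `j_* j^* (V ⊠ V) → Δ_* V`, `h (v ⊠ u) ↦ h Y(v, x_1 - x_2) u mod 𝒪 ⊠ V`. -/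
def Psi {V : LeftDMod.{u} f Unit} (W : VertexAlgebraOver V) : ChiralData.{u} f where
  module := V.toRight
  bracket := sideChange W.lambdaCh

end VertexAlgebraOver

namespace AHSVertexAlgebra

variable (𝕍 : AHSVertexAlgebra.{u} f)

/-- The vertex algebra structure `W` on the left `𝒟`-module `V = V(1)` is the one of `Φ_X(V)`. The
vacuum is the image of `1 ∈ S_X(1)`, and `Y(v, z) u = ∑_i (1 / i!) α_*(∂_1^i a) z^{i - N}` whenever
`μ₁₂(v ⊗ u) = (x_1 - x_2)^{-N} a` with `a ∈ V(1, 2)`, where `α : {1, 2} → {1}`. -/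
structure IsPhi (W : VertexAlgebraOver 𝕍.V1) : Prop where
  vac : W.vac = 𝕍.unit Unit 1
  mode : ∀ (v u : 𝕍.V1) (N : ℕ) (a : 𝕍.V12),
    𝕍.mul12 v u = locMk (z12 f (-N)) a → ∀ i : ℕ,
      W.mode (N - i - 1) v u = invFact f Unit i • 𝕍.map diag ((𝕍.V12.D p1)^[i] a)
  mode_eq_zero : ∀ (v u : 𝕍.V1) (N : ℕ) (a : 𝕍.V12),
    𝕍.mul12 v u = locMk (z12 f (-N)) a → ∀ n : ℤ, N ≤ n → W.mode n v u = 0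

/-- The right `𝒟`-module `A = 𝒱 ⊗ ω` with the map `μ₀ : j_* j^* (A ⊠ A) → Δ_! A` that corresponds to
the composite `j_* j^* (𝒱 ⊠ 𝒱) → j_* j^* 𝒱(1, 2) → Δ_* Δ^* 𝒱(1, 2) → Δ_* 𝒱` of the map induced by
`μ₁₂`, the canonical map, and the direct image of `α̃`. -/
def chiral0 : ChiralData.{u} f where
  module := 𝕍.V1.toRight
  bracket := sideChange ((pushHom 𝕍.alphaTilde).comp ((gamma 𝕍.V12).comp 𝕍.mulLoc))

end AHSVertexAlgebra

end AHS

end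

/-!
The vertex operators of `Φ_X(𝕍)` are the Laurent expansions along the diagonal of the sections
`μ₁₂(v ⊗ u)` of `j_* j^* 𝒱(1, 2)`. The Taylor expansion
`V(1, 2) → V(1)[[z]]`, `a ↦ ∑_i (1 / i!) α_*(∂_1^i a) z^i`, turns multiplication by `x_1 - x_2` into
multiplication by `z`. Since `z` acts injectively on series, the expansion kills all torsion along
the diagonal and extends to sections with poles (`AHSVertexAlgebra.expand`). As such sections all
have the form `(x_1 - x_2)^{-N} a`, the formula for the vertex operators determines them. The
expansion turns `∂_1` into `d/dz` and `g(x_1) h(x_2)` into `g(x + z) h(x)`, which gives translation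
covariance and the compatibility with functions on `X`; the vacuum axioms follow from the
compatibility of the unit with `μ`.

Locality comes from `X³`. Expanding first along `x_2 = x_3`, in `w = x_2 - x_3`, and then in
`z = x_1 - x_3`, turns `x_1 - x_3`, `x_2 - x_3` and `x_1 - x_2` into `z`, `w` and `z - w`. Hence,
after multiplication by a power of `(z - w)² z w`, the series `Y(v, z) Y(u, w) a` is the Taylor expansion
of an element of `V(1, 2, 3)` that represents the triple product of `v`, `u` and `a` with its poles
cleared (`AHSVertexAlgebra.exists_deltaThree_pow_smul_mulTriple`). By associativity and
commutativity of `μ` the triple products for the two orders of `v` and `u` correspond under the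
exchange of `x_1` and `x_2` (`AHSVertexAlgebra.mapLoc_swapThree_mulTriple`), and the Taylor
expansion on `X³` is symmetric under this exchange (`AHSVertexAlgebra.taylorThree_swapThree`). The powers of
`z` and `w` can be cancelled again, which leaves the locality relation.

For the chiral bracket, `h Y(v, x_1 - x_2) u` and the value of the canonical map `γ` on
`h (x_1 - x_2)^{-N} a`, followed by `Δ_*(α̃)`, are given by the same sum of classes
(`AHSVertexAlgebra.IsPhi.lambdaCh_eq`).
-/

noncomputable section

universe u v

namespace AHS

open DMod

variable {f : Polynomial ℂ} {I J K : Type}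

/-! ### Taylor coefficients -/

section taylor

variable {M : Type u} {N : Type v} [AddCommGroup M] [AddCommGroup N] [Module (S f I) N]

/-- The Taylor series `∑_i (1 / i!) π(∂^i a) z^i` of `a` for an operator `∂` and a restriction map
`π`. Series are indexed like vertex operators: the value at `n` is the coefficient of `z^{-n-1}`. -/
def taylor (d : M →+ M) (π : M →+ N) : M →+ (ℤ → N) :=
  AddMonoidHom.mk' (fun a n =>
    if n < 0 then invFact f I (-n - 1).toNat • π (d^[(-n - 1).toNat] a) else 0)
    (fun a b => by
      funext n
      by_cases h : n < 0
      · simp only [Pi.add_apply, if_pos h, iterate_map_add, map_add, smul_add]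
      · simp only [Pi.add_apply, if_neg h, add_zero])

variable (d : M →+ M) (π : M →+ N)

theorem taylor_neg (a : M) (i : ℕ) :
    taylor (f := f) (I := I) d π a (-i - 1) = invFact f I i • π (d^[i] a) := by
  have h : -(-(i : ℤ) - 1) - 1 = i := by ring
  change (if _ then _ else _) = _
  rw [if_pos (by omega), h, Int.toNat_natCast]

theorem taylor_nonneg (a : M) {n : ℤ} (hn : 0 ≤ n) : taylor (f := f) (I := I) d π a n = 0 :=
  if_neg (by omega)

theorem int_cases_neg (n : ℤ) : 0 ≤ n ∨ ∃ i : ℕ, n = -i - 1 := by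
  by_cases h : 0 ≤ n
  · exact .inl h
  · exact .inr ⟨(-n - 1).toNat, by omega⟩

/-- The relation `[∂^{i+1}, t] = (i + 1) ∂^i` that follows from `[∂, t] = 1`. -/
theorem iterate_heisenberg {t : M →+ M} (ht : ∀ a, d (t a) = t (d a) + a) (a : M) (i : ℕ) :
    d^[i + 1] (t a) = t (d^[i + 1] a) + ((i + 1 : ℕ) : ℤ) • d^[i] a := by
  induction i with
  | zero => simp [ht]
  | succ i ih =>
    rw [Function.iterate_succ_apply', ih, map_add, ht, map_zsmul,
      ← Function.iterate_succ_apply' d, ← Function.iterate_succ_apply' d]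
    push_cast
    rw [add_smul ((i : ℤ) + 1), one_smul]
    abel

/-- Multiplication by a local coordinate `t`, with `[∂, t] = 1`, that vanishes under `π` becomes
multiplication by `z` on Taylor series. -/
theorem taylor_coordinate {t : M →+ M} (ht : ∀ a, d (t a) = t (d a) + a) (hπ : ∀ a, π (t a) = 0)
    (a : M) (n : ℤ) :
    taylor (f := f) (I := I) d π (t a) n = taylor (f := f) (I := I) d π a (n + 1) := by
  rcases int_cases_neg n with hn | ⟨i, rfl⟩
  · rw [taylor_nonneg d π _ hn, taylor_nonneg d π _ (by omega)]
  · rcases i with _ | i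
    · rw [taylor_neg, taylor_nonneg d π _ (by simp)]
      simp [hπ]
    · have h : (-((i + 1 : ℕ) : ℤ) - 1 + 1) = -(i : ℤ) - 1 := by push_cast; ring
      rw [taylor_neg, h, taylor_neg, iterate_heisenberg d ht, map_add, hπ, zero_add, map_zsmul,
        smul_comm, ← smul_assoc, succ_invFact]

theorem taylor_derivative (a : M) (n : ℤ) : taylor (f := f) (I := I) d π (d a) n =
    (-n) • taylor (f := f) (I := I) d π a (n - 1) := by
  rcases int_cases_neg n with hn | ⟨i, rfl⟩
  · rw [taylor_nonneg d π _ hn]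
    rcases hn.eq_or_lt with rfl | hn
    · simp
    · rw [taylor_nonneg d π _ (by omega), smul_zero]
  · have h : -(i : ℤ) - 1 - 1 = -((i + 1 : ℕ) : ℤ) - 1 := by push_cast; ring
    have h' : -(-(i : ℤ) - 1) = ((i + 1 : ℕ) : ℤ) := by push_cast; ring
    rw [taylor_neg, h, taylor_neg, h', ← smul_assoc, succ_invFact, ← Function.iterate_succ_apply d]

/-- Operators that commute with `∂` act coefficientwise on Taylor series. -/
theorem taylor_apply_commute {M' : Type*} {N' : Type*} [AddCommGroup M'] [AddCommGroup N']
    {I' : Type} [Module (S f I') N'] (d' : M' →+ M') (π' : M' →+ N') (t : M →+ M') (t' : N →+ N')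
    (ht : ∀ a, d' (t a) = t (d a)) (hπ : ∀ a, π' (t a) = t' (π a))
    (hc : ∀ i y, t' (invFact f I i • y) = invFact f I' i • t' y) (a : M) (n : ℤ) :
    taylor (f := f) (I := I') d' π' (t a) n = t' (taylor (f := f) (I := I) d π a n) := by
  have hi : ∀ i : ℕ, d'^[i] (t a) = t (d^[i] a) := fun i =>
    (Function.Semiconj.iterate_right (f := t) (fun a => (ht a).symm) i a).symm
  rcases int_cases_neg n with hn | ⟨i, rfl⟩
  · rw [taylor_nonneg d π _ hn, taylor_nonneg d' π' _ hn, map_zero]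
  · rw [taylor_neg, taylor_neg, hi, hπ, hc]

end taylor

/-! ### Elements of localizations -/

section fractions

variable {ε : ℤˣ} {M : DMod.{u} f I ε} {r : Setoid I}

theorem locMk_zero (t : U f r) : locMk t (0 : M) = 0 :=
  TensorProduct.tmul_zero (R := S f I) (M := U f r) (N := M) t

theorem exists_smul_eq_locMk_one (z : loc M r) :
    ∃ s ∈ diffs f r, ∃ a : M, s • z = locMk 1 a := by
  obtain ⟨⟨a, s⟩, h⟩ := IsLocalizedModule.surj (diffs f r)
    (TensorProduct.mk (S f I) (U f r) M 1) z
  exact ⟨s, s.2, a, h⟩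

theorem exists_smul_eq_of_locMk_one_eq {a b : M} (h : locMk (1 : U f r) a = locMk 1 b) :
    ∃ s ∈ diffs f r, s • a = s • b := by
  obtain ⟨s, hs⟩ := (IsLocalizedModule.eq_iff_exists (diffs f r)
    (TensorProduct.mk (S f I) (U f r) M 1)).1 h
  exact ⟨s, s.2, hs⟩

theorem locMap_smul {N : DMod.{u} f J ε} {s : Setoid J} (α : I → J) (hα : PresNEq r s α)
    (φ : M →+ N) (hφ : ∀ (a : S f I) m, φ (a • m) = S.map α a • φ m) (a : S f I) (z : loc M r) :
    locMap α hα φ hφ (a • z) = S.map α a • locMap α hα φ hφ z := by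
  induction z using loc_induction with
  | h0 => simp only [smul_zero, map_zero]
  | ha x y hx hy => simp only [smul_add, map_add, hx, hy]
  | hm h m =>
    rw [smul_locMk', locMap_mk, locMap_mk, smul_locMk', map_mul, U.map_algebraMap]

end fractions

/-- If `t` vanishes on all removed diagonals, every function inverted on `U(I)` divides a power of
`t`. -/
theorem exists_dvd_pow_of_mem_diffs {r : Setoid I} {t : S f I}
    (ht : ∀ i j, ¬ r i j → (S.x i - S.x j) ∣ t) {s : S f I} (hs : s ∈ diffs f r) :
    ∃ k : ℕ, s ∣ t ^ k := by
  induction hs using Submonoid.closure_induction with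
  | mem y hy =>
    obtain ⟨i, j, hij, rfl⟩ := hy
    exact ⟨1, by simpa using ht i j hij⟩
  | one => exact ⟨0, one_dvd _⟩
  | mul a b _ _ ha hb =>
    obtain ⟨k, hk⟩ := ha
    obtain ⟨l, hl⟩ := hb
    exact ⟨k + l, by rw [pow_add]; exact mul_dvd_mul hk hl⟩

section fractions

variable {ε : ℤˣ} {M : DMod.{u} f I ε} {r : Setoid I} {t : S f I}

theorem exists_pow_smul_eq_locMk_one (ht : ∀ i j, ¬ r i j → (S.x i - S.x j) ∣ t) (z : loc M r) :
    ∃ (k : ℕ) (a : M), t ^ k • z = locMk 1 a := by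
  obtain ⟨s, hs, a, h⟩ := exists_smul_eq_locMk_one z
  obtain ⟨k, c, hc⟩ := exists_dvd_pow_of_mem_diffs ht hs
  exact ⟨k, c • a, by rw [hc, mul_comm, mul_smul, h, locMk_smul]⟩

theorem exists_pow_smul_eq_of_locMk_one_eq (ht : ∀ i j, ¬ r i j → (S.x i - S.x j) ∣ t) {a b : M}
    (h : locMk (1 : U f r) a = locMk 1 b) :
    ∃ k : ℕ, t ^ k • a = t ^ k • b := by
  obtain ⟨s, hs, h⟩ := exists_smul_eq_of_locMk_one_eq h
  obtain ⟨k, c, hc⟩ := exists_dvd_pow_of_mem_diffs ht hs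
  exact ⟨k, by rw [hc, mul_comm, mul_smul, h, mul_smul]⟩

end fractions

/-- The function `x_1 - x_2` on `X²`. -/
abbrev x12 (f : Polynomial ℂ) : S f Two := S.x p1 - S.x p2

theorem sub_dvd_x12 (i j : Two) (h : ¬ r12 i j) : (S.x i - S.x j : S f Two) ∣ x12 f := by
  rcases i with ⟨⟩ | ⟨⟩ <;> rcases j with ⟨⟩ | ⟨⟩
  · exact absurd (.inl trivial) h
  · exact dvd_rfl
  · exact ⟨-1, by simp⟩
  · exact absurd (.inr trivial) h

theorem d1_x12_smul (M : LeftDMod.{u} f Two) (m : M) :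
    M.D p1 (x12 f • m) = x12 f • M.D p1 m + m := by
  have hd : S.d p1 (x12 f) = 1 := by simp [S.d_x]
  rw [M.D_smul, hd, one_smul, Units.val_one, one_smul, add_comm]

section fractionsTwo

variable {M : LeftDMod.{u} f Two}

theorem x12_pow_smul_locMk (k : ℕ) (h : U f r12) (a : M) :
    x12 f ^ k • locMk h a = locMk (z12 f k * h) a := by
  rw [smul_locMk', z12_natCast]

/-- Sections over the complement of the diagonal have poles of finite order. -/
theorem exists_eq_locMk_z12 (z : loc M r12) :
    ∃ N₀ : ℕ, ∀ N, N₀ ≤ N → ∃ a : M, z = locMk (z12 f (-N)) a := by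
  obtain ⟨k, a, h⟩ := exists_pow_smul_eq_locMk_one sub_dvd_x12 z
  refine ⟨k, fun N hN => ⟨x12 f ^ (N - k) • a, ?_⟩⟩
  obtain ⟨l, rfl⟩ := Nat.exists_eq_add_of_le hN
  rw [Nat.add_sub_cancel_left, locMk_smul, x12_pow_smul_locMk, ← z12_add]
  have e : (l : ℤ) + -((k + l : ℕ) : ℤ) = -k := by push_cast; ring
  have e2 : z12 f (-k) • locMk (1 : U f r12) a = locMk (z12 f (-k)) a := by
    rw [smul_locMk, mul_one]
  rw [e, ← e2, ← h, ← algebraMap_smul (U f r12) (x12 f ^ k) z, smul_smul, ← z12_natCast,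
    ← z12_add, neg_add_cancel, z12_zero, one_smul]

end fractionsTwo

namespace AHSVertexAlgebra

variable (𝕍 : AHSVertexAlgebra.{u} f)

/-! ### Expansion along the diagonal of `X²` -/

/-- The Taylor expansion `V(1, 2) → V(1)[[z]]`, `a ↦ ∑_i (1 / i!) α_*(∂_1^i a) z^i`. -/
def taylorTwo : 𝕍.V12 →+ (ℤ → 𝕍.V1) := taylor (f := f) (I := Unit) (𝕍.V12.D p1) (𝕍.map diag)

theorem map_diag_x12_smul (a : 𝕍.V12) : 𝕍.map diag (x12 f • a) = 0 := by
  rw [𝕍.map_smul]; simp [diag]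

theorem taylorTwo_x12_smul (a : 𝕍.V12) (n : ℤ) :
    𝕍.taylorTwo (x12 f • a) n = 𝕍.taylorTwo a (n + 1) :=
  taylor_coordinate _ _ (t := DistribSMul.toAddMonoidHom 𝕍.V12 (x12 f)) (d1_x12_smul 𝕍.V12)
    𝕍.map_diag_x12_smul a n

theorem taylorTwo_x12_pow_smul (k : ℕ) (a : 𝕍.V12) (n : ℤ) :
    𝕍.taylorTwo (x12 f ^ k • a) n = 𝕍.taylorTwo a (n + k) := by
  induction k generalizing n with
  | zero => simp
  | succ k ih =>
    rw [pow_succ', mul_smul, taylorTwo_x12_smul, ih]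
    push_cast; ring_nf

/-- Multiplication by `z` is injective on Laurent series, so that the Taylor expansion kills
torsion along the diagonal and the expansion of a section `(x_1 - x_2)^{-N} a` is well defined. -/
theorem taylorTwo_eq_of_locMk_eq {N N' : ℕ} {a a' : 𝕍.V12}
    (h : locMk (z12 f (-N)) a = locMk (z12 f (-N')) a') (n : ℤ) :
    𝕍.taylorTwo a (n - N) = 𝕍.taylorTwo a' (n - N') := by
  have h1 := congrArg (fun z => x12 f ^ (N + N') • z) h
  have e : (((N + N' : ℕ) : ℤ) + -N) = (N' : ℤ) := by push_cast; ring
  have e' : (((N + N' : ℕ) : ℤ) + -N') = (N : ℤ) := by push_cast; ring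
  simp only [x12_pow_smul_locMk] at h1
  rw [← z12_add, ← z12_add, e, e', ← mul_one (z12 f N'), ← mul_one (z12 f N),
    ← x12_pow_smul_locMk, ← x12_pow_smul_locMk, ← locMk_smul, ← locMk_smul] at h1
  obtain ⟨k, h2⟩ := exists_pow_smul_eq_of_locMk_one_eq sub_dvd_x12 h1
  have h3 := congrFun (congrArg 𝕍.taylorTwo h2) (n - N - N' - k)
  simp only [taylorTwo_x12_pow_smul] at h3
  have c1 : n - N - N' - k + k + N' = n - N := by ring
  have c2 : n - N - N' - k + k + N = n - N' := by ring
  rwa [c1, c2] at h3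

theorem exists_eq_locMk (z : loc 𝕍.V12 r12) :
    ∃ p : ℕ × 𝕍.V12, z = locMk (z12 f (-p.1)) p.2 := by
  obtain ⟨N, hN⟩ := exists_eq_locMk_z12 z
  obtain ⟨a, ha⟩ := hN N le_rfl
  exact ⟨(N, a), ha⟩

/-- The expansion of a section of `j_* j^* 𝒱(1, 2)` as a Laurent series, on underlying
functions. -/
def expandFun (z : loc 𝕍.V12 r12) (n : ℤ) : 𝕍.V1 :=
  𝕍.taylorTwo (𝕍.exists_eq_locMk z).choose.2 (n - (𝕍.exists_eq_locMk z).choose.1)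

theorem expandFun_locMk (N : ℕ) (a : 𝕍.V12) (n : ℤ) :
    𝕍.expandFun (locMk (z12 f (-N)) a) n = 𝕍.taylorTwo a (n - N) :=
  (𝕍.taylorTwo_eq_of_locMk_eq (𝕍.exists_eq_locMk (locMk (z12 f (-N)) a)).choose_spec n).symm

/-- The expansion `j_* j^* 𝒱(1, 2) → V(1)((z))` of sections with poles along the diagonal,
`(x_1 - x_2)^{-N} a ↦ ∑_i (1 / i!) α_*(∂_1^i a) z^{i - N}`. Series are indexed like vertex
operators: the value at `n` is the coefficient of `z^{-n-1}`. -/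
def expand : loc 𝕍.V12 r12 →+ (ℤ → 𝕍.V1) :=
  AddMonoidHom.mk' 𝕍.expandFun (fun y z => by
    obtain ⟨N, hN⟩ := exists_eq_locMk_z12 y
    obtain ⟨N', hN'⟩ := exists_eq_locMk_z12 z
    obtain ⟨a, rfl⟩ := hN (max N N') (le_max_left _ _)
    obtain ⟨b, rfl⟩ := hN' (max N N') (le_max_right _ _)
    funext n
    rw [← locMk_add, Pi.add_apply, expandFun_locMk, expandFun_locMk, expandFun_locMk, map_add,
      Pi.add_apply])

theorem expand_locMk (N : ℕ) (a : 𝕍.V12) (n : ℤ) :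
    𝕍.expand (locMk (z12 f (-N)) a) n = 𝕍.taylorTwo a (n - N) :=
  𝕍.expandFun_locMk N a n

theorem expand_locMk_one (a : 𝕍.V12) (n : ℤ) :
    𝕍.expand (locMk 1 a) n = 𝕍.taylorTwo a n := by
  have := 𝕍.expand_locMk 0 a n
  simpa [z12_zero] using this

theorem expand_x12_smul (z : loc 𝕍.V12 r12) (n : ℤ) :
    𝕍.expand (x12 f • z) n = 𝕍.expand z (n + 1) := by
  obtain ⟨⟨N, a⟩, rfl⟩ := 𝕍.exists_eq_locMk z
  rw [← locMk_smul, expand_locMk, expand_locMk, taylorTwo_x12_smul]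
  ring_nf

/-- The vector field `∂_1` acts on expansions as `d/dz`. -/
theorem expand_D1 (z : loc 𝕍.V12 r12) (n : ℤ) :
    𝕍.expand ((loc 𝕍.V12 r12).D p1 z) n = (-n) • 𝕍.expand z (n - 1) := by
  obtain ⟨⟨N, a⟩, rfl⟩ := 𝕍.exists_eq_locMk z
  have e : locMk (z12 f (-(N : ℤ) - 1)) a = locMk (z12 f (-((N + 1 : ℕ) : ℤ))) a := by
    congr 2; push_cast; ring
  rw [D_locMk, d1_z12, Units.val_one, one_smul, map_add, Pi.add_apply, expand_locMk, expand_locMk,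
    taylorTwo, taylor_derivative, ← taylorTwo]
  have hz : locMk (-(N : ℤ) • z12 f (-(N : ℤ) - 1)) a =
      -(N : ℤ) • locMk (z12 f (-(N : ℤ) - 1)) a :=
    map_zsmul (AddMonoidHom.mk' (fun h : U f r12 => locMk h a)
      (fun h h' => locMk_add_left h h' a)) _ _
  rw [hz, map_zsmul, Pi.smul_apply, e, expand_locMk]
  have e1 : n - ((N + 1 : ℕ) : ℤ) = n - 1 - N := by push_cast; ring
  have e2 : n - (N : ℤ) - 1 = n - 1 - N := by ring
  rw [e1, e2, ← add_smul]
  congr 1; ring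

/-- Functions of `x_2` act coefficientwise on expansions. -/
theorem expand_inr_smul (h : S f Unit) (z : loc 𝕍.V12 r12) (n : ℤ) :
    𝕍.expand (S.map (Sum.inr : Unit → Two) h • z) n = h • 𝕍.expand z n := by
  obtain ⟨⟨N, a⟩, rfl⟩ := 𝕍.exists_eq_locMk z
  rw [← locMk_smul, expand_locMk, expand_locMk]
  have hd : S.d p1 (S.map (Sum.inr : Unit → Two) h) = 0 := by
    rw [S.d_map, fiber_inr_inl, Finset.sum_empty, map_zero]
  have hm : S.map diag (S.map (Sum.inr : Unit → Two) h) = h := by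
    rw [S.map_map]; exact S.map_id h
  refine taylor_apply_commute (𝕍.V12.D p1) (𝕍.map diag) (𝕍.V12.D p1) (𝕍.map diag)
    (DistribSMul.toAddMonoidHom 𝕍.V12 (S.map (Sum.inr : Unit → Two) h))
    (DistribSMul.toAddMonoidHom 𝕍.V1 h) (fun a => ?_) (fun a => ?_) (fun i y => ?_) a _
  · simp only [DistribSMul.toAddMonoidHom_apply]
    rw [𝕍.V12.D_smul, hd, zero_smul, smul_zero, zero_add]
  · simp only [DistribSMul.toAddMonoidHom_apply]
    rw [𝕍.map_smul, hm]
  · exact smul_comm _ _ _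

end AHSVertexAlgebra

/-! ### The Leibniz rule for iterated derivatives -/

theorem iterate_D_smul (M : LeftDMod.{u} f I) (i : I) (s : S f I) (m : M) (n : ℕ) :
    (M.D i)^[n] (s • m) = ∑ kl ∈ Finset.HasAntidiagonal.antidiagonal n,
      n.choose kl.1 • ((S.d i)^[kl.1] s • (M.D i)^[kl.2] m) := by
  induction n with
  | zero => simp
  | succ n ih =>
    rw [Finset.sum_antidiagonal_choose_succ_nsmul
      (fun k l => (S.d i)^[k] s • (M.D i)^[l] m), Function.iterate_succ_apply', ih, map_sum,
      ← Finset.sum_add_distrib]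
    refine Finset.sum_congr rfl fun kl hkl => ?_
    have hc : n.choose kl.2 = n.choose kl.1 := by
      rw [← Finset.HasAntidiagonal.mem_antidiagonal.1 hkl, Nat.choose_symm_add]
    rw [hc, map_nsmul, M.D_smul, Function.iterate_succ_apply', Function.iterate_succ_apply',
      Units.val_one, one_smul, smul_add, add_comm]

theorem invFact_smul_choose_nsmul {N : Type*} [AddCommGroup N] [Module (S f J) N] (k l : ℕ)
    (s : S f J) (y : N) : invFact f J (k + l) • ((k + l).choose k • (s • y)) =
      (invFact f J k * s) • invFact f J l • y := by
  have h : invFact f J (k + l) * (((k + l).choose k : ℕ) : S f J) =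
      invFact f J k * invFact f J l := by
    have h0 : ((k + l).factorial : ℂ) ≠ 0 := Nat.cast_ne_zero.2 (Nat.factorial_ne_zero _)
    have h1 : (k.factorial : ℂ) ≠ 0 := Nat.cast_ne_zero.2 (Nat.factorial_ne_zero _)
    have h2 : (l.factorial : ℂ) ≠ 0 := Nat.cast_ne_zero.2 (Nat.factorial_ne_zero _)
    have h3 : ((k + l).choose k : ℂ) * (k.factorial * l.factorial) = (k + l).factorial := by
      rw [← mul_assoc]
      exact_mod_cast Nat.choose_symm_add ▸
        Nat.add_choose_mul_factorial_mul_factorial k l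
    rw [invFact, invFact, invFact, ← map_natCast (algebraMap ℂ (S f J)), ← map_mul, ← map_mul]
    congr 1
    field_simp
    linear_combination h3
  rw [← Nat.cast_smul_eq_nsmul (S f J), smul_smul, h, smul_smul, smul_smul]
  congr 1; ring

namespace AHSVertexAlgebra

variable (𝕍 : AHSVertexAlgebra.{u} f)

theorem taylorTwo_inl_smul (g : S f Unit) (a : 𝕍.V12) (i : ℕ) :
    𝕍.taylorTwo (S.map (Sum.inl : Unit → Two) g • a) (-i - 1) =
      ∑ kl ∈ Finset.HasAntidiagonal.antidiagonal i,
        (invFact f Unit kl.1 * (S.d ())^[kl.1] g) • 𝕍.taylorTwo a (-kl.2 - 1) := by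
  have hd : ∀ k : ℕ, (S.d p1)^[k] (S.map (Sum.inl : Unit → Two) g) =
      S.map Sum.inl ((S.d ())^[k] g) := by
    intro k
    induction k with
    | zero => rfl
    | succ k ih =>
      rw [Function.iterate_succ_apply', ih, S.d_map, fiber_inl_inl, Finset.sum_singleton,
        Function.iterate_succ_apply']
  have hm : ∀ s : S f Unit, S.map diag (S.map (Sum.inl : Unit → Two) s) = s := by
    intro s; rw [S.map_map]; exact S.map_id s
  rw [taylorTwo, taylor_neg, iterate_D_smul, map_sum, Finset.smul_sum]
  refine Finset.sum_congr rfl fun kl hkl => ?_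
  rw [taylor_neg, map_nsmul, hd, 𝕍.map_smul, hm, ← Finset.HasAntidiagonal.mem_antidiagonal.1 hkl,
    invFact_smul_choose_nsmul]

/-- A function `g(x_1)` acts on expansions by its own Taylor series `g(x + z)`. -/
theorem expand_inl_smul (g : S f Unit) (z : loc 𝕍.V12 r12) (n : ℤ) :
    𝕍.expand (S.map (Sum.inl : Unit → Two) g • z) n =
      ∑ᶠ k : ℕ, (invFact f Unit k * (S.d ())^[k] g) • 𝕍.expand z (n + k) := by
  obtain ⟨⟨N, a⟩, rfl⟩ := 𝕍.exists_eq_locMk z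
  rw [← locMk_smul, expand_locMk]
  rcases int_cases_neg (n - N) with hn | ⟨i, hi⟩
  · rw [taylorTwo, taylor_nonneg _ _ _ hn]
    refine (finsum_eq_zero_of_forall_eq_zero fun k => ?_).symm
    rw [expand_locMk, taylorTwo, taylor_nonneg _ _ _ (by omega), smul_zero]
  · rw [hi, taylorTwo_inl_smul, finsum_eq_sum_of_support_subset (s := Finset.range (i + 1)),
      Finset.Nat.sum_antidiagonal_eq_sum_range_succ_mk]
    · refine Finset.sum_congr rfl fun k hk => ?_
      have hk : k ≤ i := by simpa [Nat.lt_succ_iff] using hk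
      have e : -((i - k : ℕ) : ℤ) - 1 = n + k - N := by omega
      rw [expand_locMk, ← e]
    · intro k hk
      by_contra hlt
      have hlt : i < k := by simpa using hlt
      refine hk ?_
      simp only
      rw [expand_locMk, taylorTwo, taylor_nonneg _ _ _ (by omega), smul_zero]

/-- Total translation invariance: `∂_x` acts on the coefficients of expansions as `∂_1 + ∂_2`. -/
theorem D_expand (z : loc 𝕍.V12 r12) (n : ℤ) :
    𝕍.V1.D () (𝕍.expand z n) =
      𝕍.expand ((loc 𝕍.V12 r12).D p1 z) n + 𝕍.expand ((loc 𝕍.V12 r12).D p2 z) n := by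
  obtain ⟨⟨N, a⟩, rfl⟩ := 𝕍.exists_eq_locMk z
  have hz : ∀ (c : ℤ) (h : U f r12), locMk (c • h) a = c • locMk h a := fun c h =>
    map_zsmul (AddMonoidHom.mk' (fun h : U f r12 => locMk h a)
      (fun h h' => locMk_add_left h h' a)) _ _
  have hs : (loc 𝕍.V12 r12).D p1 (locMk (z12 f (-N)) a) +
      (loc 𝕍.V12 r12).D p2 (locMk (z12 f (-N)) a) =
        locMk (z12 f (-N)) (𝕍.V12.D p1 a + 𝕍.V12.D p2 a) := by
    rw [D_locMk, D_locMk, d1_z12, d2_z12, hz, hz, locMk_add, Units.val_one, one_smul, one_smul,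
      neg_smul (-(N : ℤ))]
    abel
  rw [← Pi.add_apply, ← map_add, hs, expand_locMk, expand_locMk]
  have hfib : fiber diag () = Finset.univ := by ext; simp [diag]
  refine (taylor_apply_commute (𝕍.V12.D p1) (𝕍.map diag) (𝕍.V12.D p1) (𝕍.map diag)
    (𝕍.V12.D p1 + 𝕍.V12.D p2) (𝕍.V1.D ()) (fun a => ?_) (fun a => ?_) (fun i y => ?_) a _).symm
  · simp only [AddMonoidHom.add_apply, map_add, 𝕍.V12.D_comm p1 p2]
  · rw [𝕍.D_map, hfib, Fintype.sum_sum_type]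
    simp
  · rw [𝕍.V1.D_smul, invFact, S.d_C]
    simp

/-! ### Vertex operators -/

/-- The vertex operators `Y(v, z) u` as expansions of `μ₁₂(v ⊗ u)`. -/
def vertexMode (n : ℤ) : 𝕍.V1 →+ 𝕍.V1 →+ 𝕍.V1 :=
  AddMonoidHom.mk' (fun v => AddMonoidHom.mk' (fun u => 𝕍.expand (𝕍.mul12 v u) n)
      (fun a b => by rw [map_add, map_add, Pi.add_apply]))
    (fun a b => by
      ext u
      simp only [AddMonoidHom.mk'_apply, AddMonoidHom.add_apply, map_add, Pi.add_apply])

theorem vertexMode_apply (n : ℤ) (v u : 𝕍.V1) :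
    𝕍.vertexMode n v u = 𝕍.expand (𝕍.mul12 v u) n := rfl

/-- The vacuum: the image of `1 ∈ S_X(1)`. -/
def vacuum : 𝕍.V1 := 𝕍.unit Unit 1

theorem mul12_vacuum_left (u : 𝕍.V1) : 𝕍.mul12 𝕍.vacuum u = locMk 1 (𝕍.map Sum.inr u) := by
  rw [mul12_apply, vacuum]
  have h := 𝕍.unit_mul (1 : S f Unit) u
  have h1 : S.map (Sum.inl : Unit → Two) (1 : S f Unit) = 1 := map_one _
  rw [h1, one_smul] at h
  exact h

theorem mul12_swap (v u : 𝕍.V1) : 𝕍.mul12 v u =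
    locMap Sum.swap (presNEq_swap ⊤ ⊤) (𝕍.map _) (𝕍.map_smul _) (𝕍.mul12 u v) :=
  (𝕍.mul_comm ⊤ ⊤ (locMk 1 u) (locMk 1 v)).symm

theorem mul12_vacuum_right (v : 𝕍.V1) : 𝕍.mul12 v 𝕍.vacuum = locMk 1 (𝕍.map Sum.inl v) := by
  rw [mul12_swap, mul12_vacuum_left]
  have h : U.map (f := f) Sum.swap (presNEq_swap (⊤ : Setoid Unit) (⊤ : Setoid Unit)) 1 = 1 :=
    map_one _
  refine (locMap_mk _ _ _ _ _ _).trans ((congrArg (fun t => locMk t _) h).trans ?_)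
  rw [𝕍.map_map]
  rfl

theorem vertexMode_vacuum (n : ℤ) (u : 𝕍.V1) :
    𝕍.vertexMode n 𝕍.vacuum u = if n = -1 then u else 0 := by
  rw [vertexMode_apply, mul12_vacuum_left, expand_locMk_one, taylorTwo]
  have hD : 𝕍.V12.D p1 (𝕍.map Sum.inr u) = 0 := by
    rw [𝕍.D_map, fiber_inr_inl, Finset.sum_empty, map_zero]
  rcases int_cases_neg n with hn | ⟨i, rfl⟩
  · rw [taylor_nonneg _ _ _ hn, if_neg (by omega)]
  · rw [taylor_neg]
    rcases i with _ | i
    · have h := 𝕍.map_map (Sum.inr : Unit → Two) diag u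
      have h2 : 𝕍.map (diag ∘ (Sum.inr : Unit → Two)) u = u := 𝕍.map_id u
      simp [invFact, h, h2]
    · rw [if_neg (by push_cast; omega), Function.iterate_succ_apply, hD, iterate_map_zero,
        map_zero, smul_zero]

theorem vertexMode_vacuum_right (v : 𝕍.V1) : 𝕍.vertexMode (-1) v 𝕍.vacuum = v := by
  have h := 𝕍.map_map (Sum.inl : Unit → Two) diag v
  have h2 : 𝕍.map (diag ∘ (Sum.inl : Unit → Two)) v = v := 𝕍.map_id v
  have h3 := taylor_neg (f := f) (I := Unit) (𝕍.V12.D p1) (𝕍.map diag) (𝕍.map Sum.inl v) 0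
  rw [vertexMode_apply, mul12_vacuum_right, expand_locMk_one, taylorTwo]
  simpa [invFact, h, h2] using h3

theorem vertexMode_vacuum_right_nonneg (v : 𝕍.V1) (n : ℤ) (hn : 0 ≤ n) :
    𝕍.vertexMode n v 𝕍.vacuum = 0 := by
  rw [vertexMode_apply, mul12_vacuum_right, expand_locMk_one, taylorTwo, taylor_nonneg _ _ _ hn]

theorem vertexMode_truncation (v u : 𝕍.V1) :
    ∃ N : ℤ, ∀ n, N ≤ n → 𝕍.vertexMode n v u = 0 := by
  obtain ⟨⟨N, a⟩, h⟩ := 𝕍.exists_eq_locMk (𝕍.mul12 v u)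
  refine ⟨N, fun n hn => ?_⟩
  rw [vertexMode_apply, h, expand_locMk, taylorTwo, taylor_nonneg _ _ _ (by omega)]

theorem vertexMode_D (n : ℤ) (v u : 𝕍.V1) :
    𝕍.vertexMode n (𝕍.V1.D () v) u = (-n) • 𝕍.vertexMode (n - 1) v u := by
  rw [vertexMode_apply, mul12_D_left, expand_D1, vertexMode_apply]

theorem D_vertexMode (n : ℤ) (v u : 𝕍.V1) : 𝕍.V1.D () (𝕍.vertexMode n v u) =
    (-n) • 𝕍.vertexMode (n - 1) v u + 𝕍.vertexMode n v (𝕍.V1.D () u) := by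
  rw [vertexMode_apply, D_expand, expand_D1, vertexMode_apply, vertexMode_apply, mul12_D_right]

theorem vertexMode_smul_smul (g h : S f Unit) (n : ℤ) (v u : 𝕍.V1) :
    𝕍.vertexMode n (g • v) (h • u) =
      h • ∑ᶠ k : ℕ, (invFact f Unit k * (S.d ())^[k] g) • 𝕍.vertexMode (n + k) v u := by
  rw [vertexMode_apply, mul12_smul_right, expand_inr_smul, mul12_smul_left, expand_inl_smul]
  rfl

end AHSVertexAlgebra

/-! ### Formal distributions in two variables -/

section distributions

variable {N : Type u} [AddCommGroup N]

/-- Multiplication by `z` on formal distributions `∑ F(p, q) z^{-p-1} w^{-q-1}`. -/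
def mulZ (N : Type u) [AddCommGroup N] : Module.End ℤ (ℤ → ℤ → N) where
  toFun F p q := F (p + 1) q
  map_add' _ _ := rfl
  map_smul' _ _ := rfl

/-- Multiplication by `w` on formal distributions `∑ F(p, q) z^{-p-1} w^{-q-1}`. -/
def mulW (N : Type u) [AddCommGroup N] : Module.End ℤ (ℤ → ℤ → N) where
  toFun F p q := F p (q + 1)
  map_add' _ _ := rfl
  map_smul' _ _ := rfl

/-- The exchange of the variables `z` and `w`. -/
def flipZW (N : Type u) [AddCommGroup N] : Module.End ℤ (ℤ → ℤ → N) where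
  toFun F p q := F q p
  map_add' _ _ := rfl
  map_smul' _ _ := rfl

theorem mulZ_pow_apply (n : ℕ) (F : ℤ → ℤ → N) (p q : ℤ) :
    (mulZ N ^ n) F p q = F (p + n) q := by
  induction n generalizing p with
  | zero => simp
  | succ n ih =>
    rw [pow_succ']
    change (mulZ N ^ n) F (p + 1) q = _
    rw [ih]
    push_cast
    ring_nf

theorem mulW_pow_apply (n : ℕ) (F : ℤ → ℤ → N) (p q : ℤ) :
    (mulW N ^ n) F p q = F p (q + n) := by
  induction n generalizing q with
  | zero => simp
  | succ n ih =>
    rw [pow_succ']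
    change (mulW N ^ n) F p (q + 1) = _
    rw [ih]
    push_cast
    ring_nf

theorem mulZ_commute_mulW : Commute (mulZ N) (mulW N) := rfl

theorem mulZ_pow_injective (n : ℕ) :
    Function.Injective (mulZ N ^ n) := by
  intro F G h
  funext p q
  have := congrFun (congrFun h (p - n)) q
  simpa only [mulZ_pow_apply, sub_add_cancel] using this

theorem mulW_pow_injective (n : ℕ) :
    Function.Injective (mulW N ^ n) := by
  intro F G h
  funext p q
  have := congrFun (congrFun h p) (q - n)
  simpa only [mulW_pow_apply, sub_add_cancel] using this

/-- The coefficients of `(z - w)^n F(z, w)`. -/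
theorem mulZ_sub_mulW_pow_apply (n : ℕ) (F : ℤ → ℤ → N) (p q : ℤ) :
    ((mulZ N - mulW N) ^ n) F p q =
      ∑ j ∈ Finset.range (n + 1), ((-1) ^ j * (n.choose j : ℤ)) • F (p + n - j) (q + j) := by
  have hc : Commute (-mulW N) (mulZ N) :=
    mulZ_commute_mulW.symm.neg_left
  have hs : mulZ N - mulW N = -mulW N + mulZ N := by abel
  rw [hs, hc.add_pow, LinearMap.sum_apply, Finset.sum_apply, Finset.sum_apply]
  refine Finset.sum_congr rfl fun j hj => ?_
  have hj : j ≤ n := by simpa [Nat.lt_succ_iff] using hj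
  have hneg : ((-mulW N) ^ j) = ((-1 : ℤ) ^ j) • (mulW N ^ j) := by
    rcases j.even_or_odd with h | h
    · rw [h.neg_pow, h.neg_one_pow, one_smul]
    · rw [h.neg_pow, h.neg_one_pow, neg_one_smul]
  rw [← nsmul_eq_mul', hneg, smul_mul_assoc, mul_comm, mul_smul, natCast_zsmul]
  change n.choose j • ((-1 : ℤ) ^ j • (mulW N ^ j)
    ((mulZ N ^ (n - j)) F) p q) = _
  rw [mulW_pow_apply, mulZ_pow_apply, Nat.cast_sub hj, add_sub_assoc]

/-- Multiplication by `(z - w)² z`. -/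
def mulGamma (N : Type u) [AddCommGroup N] : Module.End ℤ (ℤ → ℤ → N) :=
  (mulZ N - mulW N) ^ 2 * mulZ N

theorem mulZ_sub_mulW_commute_mulZ :
    Commute (mulZ N - mulW N) (mulZ N) :=
  (Commute.refl _).sub_left mulZ_commute_mulW.symm

theorem mulZ_sub_mulW_commute_mulW :
    Commute (mulZ N - mulW N) (mulW N) :=
  mulZ_commute_mulW.sub_left (Commute.refl _)

theorem mulGamma_commute_mulW : Commute (mulGamma N) (mulW N) :=
  (mulZ_sub_mulW_commute_mulW.pow_left 2).mul_left mulZ_commute_mulW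

/-- Multiplication by `(z - w)² z w`, which commutes with the exchange of the variables. -/
def mulDelta (N : Type u) [AddCommGroup N] : Module.End ℤ (ℤ → ℤ → N) := mulGamma N * mulW N

theorem mulGamma_commute_mulDelta :
    Commute (mulGamma N) (mulDelta N) :=
  (Commute.refl _).mul_right mulGamma_commute_mulW

theorem flipZW_commute_mulDelta : Commute (flipZW N) (mulDelta N) := by
  have hZ : SemiconjBy (flipZW N) (mulZ N) (mulW N) := rfl
  have hW : SemiconjBy (flipZW N) (mulW N) (mulZ N) := rfl
  have h := (((hZ.sub_right hW).pow_right 2).mul_right hZ).mul_right hW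
  have e : (mulW N - mulZ N) ^ 2 * mulW N * mulZ N = mulDelta N := by
    have e2 : (mulW N - mulZ N) ^ 2 = (mulZ N - mulW N) ^ 2 := by
      rw [← neg_sub]
      exact neg_sq _
    rw [mulDelta, mulGamma, e2, mul_assoc, mul_assoc]
    rfl
  rw [e] at h
  exact h

theorem mulDelta_pow (n : ℕ) : mulDelta N ^ n =
    mulZ N ^ n * mulW N ^ n * (mulZ N - mulW N) ^ (2 * n) := by
  rw [mulDelta, mulGamma_commute_mulW.mul_pow, mulGamma,
    (mulZ_sub_mulW_commute_mulZ.pow_left 2).mul_pow, ← pow_mul]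
  have h1 := (mulZ_sub_mulW_commute_mulZ (N := N)).pow_pow (2 * n) n
  have h2 := (mulZ_sub_mulW_commute_mulW (N := N)).pow_pow (2 * n) n
  rw [mul_assoc]
  exact h1.mul_right h2

end distributions

/-! ### Pushing forward along composites -/

theorem U.map_comp {r : Setoid I} {s : Setoid J} {t : Setoid K} (α : I → J) (hα : PresNEq r s α)
    (β : J → K) (hβ : PresNEq s t β) (γ : I → K) (hγ : PresNEq r t γ) (h : β ∘ α = γ)
    (a : U f r) : U.map β hβ (U.map α hα a) = U.map γ hγ a := by
  have : (U.map (f := f) β hβ).comp (U.map α hα) = U.map γ hγ := by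
    refine IsLocalization.ringHom_ext (diffs f r) ?_
    ext a
    simp only [RingHom.comp_apply, U.map_algebraMap, S.map_map, h]
  exact RingHom.congr_fun this a

theorem PresNEq.comp {r : Setoid I} {s : Setoid J} {t : Setoid K} {α : I → J} {β : J → K}
    (hβ : PresNEq s t β) (hα : PresNEq r s α) : PresNEq r t (β ∘ α) :=
  fun _ _ h => hα _ _ (hβ _ _ h)

namespace AHSVertexAlgebra

variable (𝕍 : AHSVertexAlgebra.{u} f)

/-- The map `V(I) → V(J)` for finite sets with equivalence relations. -/
abbrev mapLoc [Finite I] [Finite J] {r : Setoid I} {s : Setoid J} (α : I → J)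
    (hα : PresNEq r s α) : loc (𝕍.obj I) r →+ loc (𝕍.obj J) s :=
  locMap α hα (𝕍.map α) (𝕍.map_smul α)

theorem mapLoc_mapLoc [Finite I] [Finite J] [Finite K] {r : Setoid I} {s : Setoid J}
    {t : Setoid K} (α : I → J) (hα : PresNEq r s α) (β : J → K) (hβ : PresNEq s t β) (γ : I → K)
    (hγ : PresNEq r t γ) (h : β ∘ α = γ) (z : loc (𝕍.obj I) r) :
    𝕍.mapLoc β hβ (𝕍.mapLoc α hα z) = 𝕍.mapLoc γ hγ z := by
  induction z using loc_induction with
  | h0 => simp only [map_zero]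
  | ha x y hx hy => simp only [map_add, hx, hy]
  | hm a m =>
    rw [locMap_mk, locMap_mk, locMap_mk, U.map_comp α hα β hβ γ hγ h, 𝕍.map_map, h]

theorem mapLoc_id_locMk_one [Finite I] {r s : Setoid I} (h : PresNEq r s id) (m : 𝕍.obj I) :
    𝕍.mapLoc id h (locMk 1 m) = locMk 1 m := by
  rw [locMap_mk, map_one, 𝕍.map_id]

theorem mul_S_smul_right [Finite I] [Finite J] (r : Setoid I) (s : Setoid J) (a : S f J)
    (v : loc (𝕍.obj I) r) (w : loc (𝕍.obj J) s) :
    𝕍.mul r s v (a • w) = S.map (Sum.inr : J → I ⊕ J) a • 𝕍.mul r s v w := by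
  rw [← algebraMap_smul (U f s) a, 𝕍.mul_smul_right, U.map_algebraMap, algebraMap_smul]

end AHSVertexAlgebra

/-! ### Expansion on `X³` -/

/-- The index set of the factors of `X³ = X × X²`. -/
abbrev Three : Type := Unit ⊕ Two

/-- The index `1` in `{1, 2, 3}`. -/
abbrev q1 : Three := Sum.inl ()

/-- The index `2` in `{1, 2, 3}`. -/
abbrev q2 : Three := Sum.inr p1

/-- The index `3` in `{1, 2, 3}`. -/
abbrev q3 : Three := Sum.inr p2

/-- The finite set `{1 : 2, 3}`: the points `2` and `3` may collide. -/
abbrev rPair : Setoid Three := sumSetoid ⊤ ⊤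

/-- The finite set `{1 : 2 : 3}` of three inequivalent points. -/
abbrev rTriple : Setoid Three := sumSetoid ⊤ r12

/-- The map `{1, 2, 3} → {1, 2}` with `3 ↦ 2`, i.e. the inclusion of the diagonal `x_2 = x_3`. -/
abbrev collapse : Three → Two := Sum.map id diag

theorem presNEq_collapse : PresNEq rPair r12 collapse :=
  presNEq_map (presNEq_top ⊤ id) (presNEq_top ⊤ diag)

theorem presNEq_pair_triple : PresNEq rPair rTriple id := by
  have h := presNEq_map (presNEq_top (⊤ : Setoid Unit) (id : Unit → Unit))
    (presNEq_top r12 (id : Two → Two))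
  rwa [Sum.map_id_id] at h

variable (f) in
/-- The function `(x_1 - x_2)² (x_1 - x_3)`. -/
def gammaThree : S f Three := (S.x q1 - S.x q2) ^ 2 * (S.x q1 - S.x q3)

variable (f) in
/-- The function `(x_1 - x_2)² (x_1 - x_3) (x_2 - x_3)`. The square makes it invariant under the
exchange of `x_1` and `x_2`. -/
def deltaThree : S f Three := gammaThree f * (S.x q2 - S.x q3)

theorem sub_dvd_deltaThree (i j : Three) (h : ¬ rTriple i j) :
    (S.x i - S.x j : S f Three) ∣ deltaThree f := by
  have h12 : (S.x q1 - S.x q2 : S f Three) ∣ deltaThree f :=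
    ⟨(S.x q1 - S.x q2) * (S.x q1 - S.x q3) * (S.x q2 - S.x q3), by
      rw [deltaThree, gammaThree]; ring⟩
  have h13 : (S.x q1 - S.x q3 : S f Three) ∣ deltaThree f :=
    ⟨(S.x q1 - S.x q2) ^ 2 * (S.x q2 - S.x q3), by rw [deltaThree, gammaThree]; ring⟩
  have h23 : (S.x q2 - S.x q3 : S f Three) ∣ deltaThree f := ⟨gammaThree f, mul_comm _ _⟩
  have hrev : ∀ i j : Three, (S.x i - S.x j : S f Three) ∣ deltaThree f →
      (S.x j - S.x i : S f Three) ∣ deltaThree f := by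
    intro i j h
    rwa [← neg_sub, neg_dvd]
  have hself : ∀ i, rTriple i i := fun i => rTriple.refl' i
  rcases i with ⟨⟩ | ⟨⟩ | ⟨⟩ <;> rcases j with ⟨⟩ | ⟨⟩ | ⟨⟩
  · exact absurd (hself _) h
  · exact h12
  · exact h13
  · exact hrev _ _ h12
  · exact absurd (hself _) h
  · exact h23
  · exact hrev _ _ h13
  · exact hrev _ _ h23
  · exact absurd (hself _) h

theorem sub_dvd_deltaThree_of_pair (i j : Three) (h : ¬ rPair i j) :
    (S.x i - S.x j : S f Three) ∣ deltaThree f :=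
  sub_dvd_deltaThree i j fun h' => h (presNEq_pair_triple i j h')

namespace AHSVertexAlgebra

variable (𝕍 : AHSVertexAlgebra.{u} f)

/-- The Taylor expansion in `w = x_2 - x_3` along the diagonal `x_2 = x_3`, with poles at
`x_1 = x_2` and `x_1 = x_3`. -/
def expandPair : loc (𝕍.obj Three) rPair →+ (ℤ → loc 𝕍.V12 r12) :=
  taylor (f := f) (I := Two) ((loc (𝕍.obj Three) rPair).D q2) (𝕍.mapLoc collapse presNEq_collapse)

/-- The expansion of a section over `{x_1 ≠ x_2, x_3}`, first in `w = x_2 - x_3` and then in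
`z = x_1 - x_3`. -/
def expandThree : loc (𝕍.obj Three) rPair →+ (ℤ → ℤ → 𝕍.V1) :=
  AddMonoidHom.mk' (fun m p q => 𝕍.expand (𝕍.expandPair m q) p) (fun a b => by
    funext p q
    simp only [map_add, Pi.add_apply])

theorem expandThree_apply (m : loc (𝕍.obj Three) rPair) (p q : ℤ) :
    𝕍.expandThree m p q = 𝕍.expand (𝕍.expandPair m q) p := rfl

theorem expandThree_x23_smul (m : loc (𝕍.obj Three) rPair) :
    𝕍.expandThree ((S.x q2 - S.x q3 : S f Three) • m) = mulW 𝕍.V1 (𝕍.expandThree m) := by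
  funext p q
  change _ = 𝕍.expandThree m p (q + 1)
  rw [expandThree_apply, expandThree_apply]
  have hd : S.d q2 (S.x q2 - S.x q3 : S f Three) = 1 := by simp [S.d_x]
  have hm : S.map collapse (S.x q2 - S.x q3 : S f Three) = 0 := by simp [diag]
  have := taylor_coordinate (f := f) (I := Two) ((loc (𝕍.obj Three) rPair).D q2)
    (𝕍.mapLoc collapse presNEq_collapse)
    (t := DistribSMul.toAddMonoidHom (loc (𝕍.obj Three) rPair) (S.x q2 - S.x q3 : S f Three))
    (fun a => by
      simp only [DistribSMul.toAddMonoidHom_apply]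
      rw [DMod.D_smul, hd, one_smul, Units.val_one, one_smul, add_comm])
    (fun a => by
      simp only [DistribSMul.toAddMonoidHom_apply]
      rw [locMap_smul, hm, zero_smul]) m q
  exact congrArg (fun z => 𝕍.expand z p) this

theorem expandThree_x13_smul (m : loc (𝕍.obj Three) rPair) :
    𝕍.expandThree ((S.x q1 - S.x q3 : S f Three) • m) = mulZ 𝕍.V1 (𝕍.expandThree m) := by
  funext p q
  change _ = 𝕍.expandThree m (p + 1) q
  rw [expandThree_apply, expandThree_apply, ← expand_x12_smul]
  have hd : S.d q2 (S.x q1 - S.x q3 : S f Three) = 0 := by simp [S.d_x]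
  have hm : S.map collapse (S.x q1 - S.x q3 : S f Three) = x12 f := by simp [diag]
  have := taylor_apply_commute (f := f) (I := Two) (I' := Two) ((loc (𝕍.obj Three) rPair).D q2)
    (𝕍.mapLoc collapse presNEq_collapse) ((loc (𝕍.obj Three) rPair).D q2)
    (𝕍.mapLoc collapse presNEq_collapse)
    (DistribSMul.toAddMonoidHom (loc (𝕍.obj Three) rPair) (S.x q1 - S.x q3 : S f Three))
    (DistribSMul.toAddMonoidHom (loc 𝕍.V12 r12) (x12 f))
    (fun a => by
      simp only [DistribSMul.toAddMonoidHom_apply]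
      rw [DMod.D_smul, hd, zero_smul, smul_zero, zero_add])
    (fun a => by
      simp only [DistribSMul.toAddMonoidHom_apply]
      rw [locMap_smul, hm])
    (fun i y => smul_comm _ _ _) m q
  exact congrArg (fun z => 𝕍.expand z p) this

theorem expandThree_x12_smul (m : loc (𝕍.obj Three) rPair) :
    𝕍.expandThree ((S.x q1 - S.x q2 : S f Three) • m) =
      (mulZ 𝕍.V1 - mulW 𝕍.V1) (𝕍.expandThree m) := by
  have h : (S.x q1 - S.x q2 : S f Three) = (S.x q1 - S.x q3) - (S.x q2 - S.x q3) := by ring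
  rw [h, sub_smul, map_sub, expandThree_x13_smul, expandThree_x23_smul, LinearMap.sub_apply]

theorem expandThree_gammaThree_smul (m : loc (𝕍.obj Three) rPair) :
    𝕍.expandThree (gammaThree f • m) = mulGamma 𝕍.V1 (𝕍.expandThree m) := by
  rw [gammaThree, mul_smul, sq, mul_smul, expandThree_x12_smul, expandThree_x12_smul,
    expandThree_x13_smul, mulGamma, sq, Module.End.mul_apply, Module.End.mul_apply]

theorem expandThree_deltaThree_smul (m : loc (𝕍.obj Three) rPair) :
    𝕍.expandThree (deltaThree f • m) = mulDelta 𝕍.V1 (𝕍.expandThree m) := by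
  rw [deltaThree, mul_smul, expandThree_gammaThree_smul, expandThree_x23_smul, mulDelta,
    Module.End.mul_apply]

theorem expandThree_gammaThree_pow_smul (n : ℕ) (m : loc (𝕍.obj Three) rPair) :
    𝕍.expandThree (gammaThree f ^ n • m) = (mulGamma 𝕍.V1 ^ n) (𝕍.expandThree m) := by
  induction n with
  | zero => simp
  | succ n ih =>
    rw [pow_succ', mul_smul, expandThree_gammaThree_smul, ih, pow_succ', Module.End.mul_apply]

theorem expandThree_deltaThree_pow_smul (n : ℕ) (m : loc (𝕍.obj Three) rPair) :
    𝕍.expandThree (deltaThree f ^ n • m) = (mulDelta 𝕍.V1 ^ n) (𝕍.expandThree m) := by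
  induction n with
  | zero => simp
  | succ n ih =>
    rw [pow_succ', mul_smul, expandThree_deltaThree_smul, ih, pow_succ', Module.End.mul_apply]

/-- The Taylor expansion `V(1, 2, 3) → V(1)[[z, w]]` along the small diagonal of `X³`. -/
def taylorThree (b : 𝕍.obj Three) : ℤ → ℤ → 𝕍.V1 := 𝕍.expandThree (locMk 1 b)

theorem taylorThree_deltaThree_pow_smul (n : ℕ) (b : 𝕍.obj Three) :
    𝕍.taylorThree (deltaThree f ^ n • b) = (mulDelta 𝕍.V1 ^ n) (𝕍.taylorThree b) := by
  rw [taylorThree, locMk_smul, expandThree_deltaThree_pow_smul, taylorThree]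

theorem taylorThree_apply (b : 𝕍.obj Three) (p q : ℤ) : 𝕍.taylorThree b p q =
    𝕍.taylorTwo (taylor (f := f) (I := Two) ((𝕍.obj Three).D q2) (𝕍.map collapse) b q) p := by
  rw [taylorThree, expandThree_apply, expandPair, ← expand_locMk_one]
  have := taylor_apply_commute (f := f) ((𝕍.obj Three).D q2) (𝕍.map collapse)
    ((loc (𝕍.obj Three) rPair).D q2) (𝕍.mapLoc collapse presNEq_collapse)
    (toLoc (𝕍.obj Three) rPair).toLinearMap.toAddMonoidHom
    (toLoc 𝕍.V12 r12).toLinearMap.toAddMonoidHom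
    (fun a => ((toLoc (𝕍.obj Three) rPair).apply_D q2 a).symm)
    (fun a => by
      refine (locMap_mk _ _ _ _ _ _).trans ?_
      rw [map_one]
      rfl)
    (fun i y => _root_.map_smul (toLoc 𝕍.V12 r12).toLinearMap _ _) b q
  exact congrArg (fun z => 𝕍.expand z p) this

/-- The coefficients of the Taylor expansion on `X³`; the map to `{1}` is the only one. -/
theorem taylorThree_neg (b : 𝕍.obj Three) (i j : ℕ) : 𝕍.taylorThree b (-i - 1) (-j - 1) =
    (invFact f Unit i * invFact f Unit j) • 𝕍.map (fun _ => ())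
      (((𝕍.obj Three).D q1)^[i] (((𝕍.obj Three).D q2)^[j] b)) := by
  have hD : ∀ y : 𝕍.obj Three, 𝕍.V12.D p1 (𝕍.map collapse y) =
      𝕍.map collapse ((𝕍.obj Three).D q1 y) := by
    intro y
    have hfib : fiber collapse p1 = {q1} := by
      ext k; rcases k with ⟨⟩ | ⟨⟩ | ⟨⟩ <;> simp [diag]
    rw [𝕍.D_map, hfib, Finset.sum_singleton]
  have hDi : ∀ y : 𝕍.obj Three, (𝕍.V12.D p1)^[i] (𝕍.map collapse y) =
      𝕍.map collapse (((𝕍.obj Three).D q1)^[i] y) := fun y =>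
    (Function.Semiconj.iterate_right (f := 𝕍.map collapse) (fun a => (hD a).symm) i y).symm
  have hc : S.map diag (invFact f Two j) = invFact f Unit j := S.map_C _ _
  rw [taylorThree_apply, taylor_neg, taylorTwo, taylor_neg,
    iterate_smul_const _ (by simp [invFact]), hDi, 𝕍.map_smul, 𝕍.map_map, hc, smul_smul]

theorem taylorThree_nonneg_left (b : 𝕍.obj Three) {p : ℤ} (hp : 0 ≤ p) (q : ℤ) :
    𝕍.taylorThree b p q = 0 := by
  rw [taylorThree_apply, taylorTwo, taylor_nonneg _ _ _ hp]

theorem taylorThree_nonneg_right (b : 𝕍.obj Three) (p : ℤ) {q : ℤ} (hq : 0 ≤ q) :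
    𝕍.taylorThree b p q = 0 := by
  rw [taylorThree_apply, taylor_nonneg _ _ _ hq, map_zero, Pi.zero_apply]

/-! ### Exchange of the first two points -/

/-- The permutation of `{1, 2, 3}` that exchanges `1` and `2`, written as it arises from the
associativity and the commutativity of disjoint unions. -/
def swapThree : Three → Three :=
  Equiv.sumAssoc Unit Unit Unit ∘ Sum.map Sum.swap id ∘ (Equiv.sumAssoc Unit Unit Unit).symm

theorem swapThree_q1 : swapThree q1 = q2 := rfl

theorem swapThree_q2 : swapThree q2 = q1 := rfl

theorem swapThree_q3 : swapThree q3 = q3 := rfl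

theorem presNEq_swapThree : PresNEq rTriple rTriple swapThree := by
  intro i j h
  have hself : ∀ i, rTriple i i := fun i => rTriple.refl' i
  have h12 : ¬ rTriple q1 q2 := by intro h; cases h
  have h13 : ¬ rTriple q1 q3 := by intro h; cases h
  have h23 : ¬ rTriple q2 q3 := by intro h; cases h; rename_i h; cases h
  rcases i with ⟨⟩ | ⟨⟩ | ⟨⟩ <;> rcases j with ⟨⟩ | ⟨⟩ | ⟨⟩
  · exact hself _
  · exact absurd (rTriple.symm' h) h12
  · exact absurd h h23
  · exact absurd h h12
  · exact hself _
  · exact absurd h h13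
  · exact absurd (rTriple.symm' h) h23
  · exact absurd (rTriple.symm' h) h13
  · exact hself _

theorem map_swapThree_deltaThree : S.map swapThree (deltaThree f) = deltaThree f := by
  simp only [deltaThree, gammaThree, map_mul, map_pow, map_sub, S.map_x, swapThree_q1,
    swapThree_q2, swapThree_q3]
  ring

theorem taylorThree_swapThree (b : 𝕍.obj Three) :
    𝕍.taylorThree (𝕍.map swapThree b) = flipZW 𝕍.V1 (𝕍.taylorThree b) := by
  funext p q
  change _ = 𝕍.taylorThree b q p
  have hfib1 : fiber swapThree q1 = {q2} := by
    ext k; rcases k with ⟨⟩ | ⟨⟩ | ⟨⟩ <;> simp [swapThree]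
  have hfib2 : fiber swapThree q2 = {q1} := by
    ext k; rcases k with ⟨⟩ | ⟨⟩ | ⟨⟩ <;> simp [swapThree]
  have h1 : ∀ (i : ℕ) (y : 𝕍.obj Three), ((𝕍.obj Three).D q1)^[i] (𝕍.map swapThree y) =
      𝕍.map swapThree (((𝕍.obj Three).D q2)^[i] y) := fun i y =>
    (Function.Semiconj.iterate_right (f := 𝕍.map swapThree) (fun a => by
      rw [𝕍.D_map, hfib1, Finset.sum_singleton]) i y).symm
  have h2 : ∀ (i : ℕ) (y : 𝕍.obj Three), ((𝕍.obj Three).D q2)^[i] (𝕍.map swapThree y) =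
      𝕍.map swapThree (((𝕍.obj Three).D q1)^[i] y) := fun i y =>
    (Function.Semiconj.iterate_right (f := 𝕍.map swapThree) (fun a => by
      rw [𝕍.D_map, hfib2, Finset.sum_singleton]) i y).symm
  -- After the exchange, the claim is that `∂_1` and `∂_2` commute.
  have hcomm : Function.Commute ((𝕍.obj Three).D q2) ((𝕍.obj Three).D q1) :=
    (𝕍.obj Three).D_comm q2 q1
  rcases int_cases_neg p with hp | ⟨i, rfl⟩
  · rw [taylorThree_nonneg_left _ _ hp, taylorThree_nonneg_right _ _ _ hp]
  · rcases int_cases_neg q with hq | ⟨j, rfl⟩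
    · rw [taylorThree_nonneg_left _ _ hq, taylorThree_nonneg_right _ _ _ hq]
    · rw [taylorThree_neg, taylorThree_neg, h2, h1, 𝕍.map_map,
        (hcomm.iterate_iterate i j).eq, _root_.mul_comm]

/-! ### Locality -/

/-- The product of `v ∈ V(1)` and `c ∈ V(2, 3)`. -/
def mulPair (v : 𝕍.V1) : 𝕍.V12 →+ loc (𝕍.obj Three) rPair :=
  (𝕍.mul ⊤ ⊤ (locMk 1 v)).comp (toLoc 𝕍.V12 ⊤).toLinearMap.toAddMonoidHom

/-- The triple product of `v ∈ V(1)`, `u ∈ V(2)` and `a ∈ V(3)`. -/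
def mulTriple (v u a : 𝕍.V1) : loc (𝕍.obj Three) rTriple :=
  𝕍.mul ⊤ r12 (locMk 1 v) (𝕍.mul12 u a)

theorem mul12_invFact_smul (v : 𝕍.V1) (i : ℕ) (y : 𝕍.V1) :
    𝕍.mul12 v (invFact f Unit i • y) = invFact f Two i • 𝕍.mul12 v y := by
  rw [mul12_smul_right, invFact, S.map_C, invFact]

/-- Expanding `μ(v, c)` along `x_2 = x_3` means expanding `c`, as `μ` is functorial and commutes
with `∂_2`. -/
theorem expandPair_mulPair (v : 𝕍.V1) (c : 𝕍.V12) (q : ℤ) :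
    𝕍.expandPair (𝕍.mulPair v c) q = 𝕍.mul12 v (𝕍.taylorTwo c q) := by
  refine taylor_apply_commute (f := f) (𝕍.V12.D p1) (𝕍.map diag)
    ((loc (𝕍.obj Three) rPair).D q2) (𝕍.mapLoc collapse presNEq_collapse) (𝕍.mulPair v)
    (𝕍.mul12 v) (fun a => ?_) (fun a => ?_) (𝕍.mul12_invFact_smul v) c q
  · have h := 𝕍.mul_D_right ⊤ ⊤ p1 (locMk 1 v : loc 𝕍.V1 ⊤) (locMk 1 a : loc 𝕍.V12 ⊤)
    have h2 := (toLoc 𝕍.V12 ⊤).apply_D p1 a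
    exact h.symm.trans (congrArg (𝕍.mul ⊤ ⊤ (locMk 1 v)) h2.symm)
  · have h := 𝕍.mul_map ⊤ ⊤ ⊤ ⊤ id (presNEq_top ⊤ id) diag (presNEq_top ⊤ diag)
      (locMk 1 v : loc 𝕍.V1 ⊤) (locMk 1 a : loc 𝕍.V12 ⊤)
    rw [locMap_mk, locMap_mk, map_one, map_one, 𝕍.map_id] at h
    exact h.symm

/-- Iterated vertex operators are expansions of products on `X³`. -/
theorem vertexMode_vertexMode (v u a : 𝕍.V1) {N : ℕ} {c : 𝕍.V12}
    (h : 𝕍.mul12 u a = locMk (z12 f (-N)) c) (p q : ℤ) :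
    𝕍.vertexMode p v (𝕍.vertexMode (q + N) u a) = 𝕍.expandThree (𝕍.mulPair v c) p q := by
  rw [vertexMode_apply, vertexMode_apply, h, expand_locMk, add_sub_cancel_right,
    expandThree_apply, expandPair_mulPair]

/-- Clearing the pole along `x_2 = x_3` of a triple product leaves a product of `V(1)` and
`V(2, 3)`. -/
theorem x23_pow_smul_mulTriple (v u a : 𝕍.V1) {N : ℕ} {c : 𝕍.V12}
    (h : 𝕍.mul12 u a = locMk (z12 f (-N)) c) :
    (S.x q2 - S.x q3 : S f Three) ^ N • 𝕍.mulTriple v u a =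
      𝕍.mapLoc id presNEq_pair_triple (𝕍.mulPair v c) := by
  have hx : (S.x q2 - S.x q3 : S f Three) ^ N = S.map (Sum.inr : Two → Three) (x12 f ^ N) := by
    simp
  have h2 := 𝕍.mul_map ⊤ ⊤ ⊤ r12 id (presNEq_top ⊤ id) id (presNEq_top r12 id)
      (locMk 1 v : loc 𝕍.V1 ⊤) (locMk 1 c : loc 𝕍.V12 ⊤)
  rw [mapLoc_id_locMk_one, mapLoc_id_locMk_one] at h2
  rw [mulTriple, h, hx, ← mul_S_smul_right, x12_pow_smul_locMk, ← z12_add, add_neg_cancel,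
    z12_zero, h2]
  have h3 : ∀ (α : Three → Three) (hα : PresNEq rPair rTriple α), α = id →
      ∀ z, 𝕍.mapLoc α hα z = 𝕍.mapLoc id presNEq_pair_triple z := by
    rintro _ _ rfl z; rfl
  exact h3 _ _ Sum.map_id_id _

/-- After poles are cleared, an iterated vertex operator is the Taylor expansion of an element of
`V(1, 2, 3)`. -/
theorem exists_deltaThree_pow_smul_mulTriple (v u a : 𝕍.V1) : ∃ (k : ℕ) (b : 𝕍.obj Three),
    deltaThree f ^ k • 𝕍.mulTriple v u a = locMk 1 b ∧
      (mulDelta 𝕍.V1 ^ k) (fun p q => 𝕍.vertexMode p v (𝕍.vertexMode q u a)) = 𝕍.taylorThree b := by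
  obtain ⟨⟨N, c⟩, hc⟩ := 𝕍.exists_eq_locMk (𝕍.mul12 u a)
  obtain ⟨k, b, hb⟩ := exists_pow_smul_eq_locMk_one sub_dvd_deltaThree_of_pair (𝕍.mulPair v c)
  refine ⟨k + N, gammaThree f ^ N • b, ?_, ?_⟩
  · have e : deltaThree f ^ (k + N) =
        gammaThree f ^ N * deltaThree f ^ k * (S.x q2 - S.x q3) ^ N := by
      have e' : deltaThree f ^ N = gammaThree f ^ N * (S.x q2 - S.x q3) ^ N := mul_pow _ _ _
      rw [pow_add, e']; ring
    have hid : S.map id (deltaThree f ^ k) = deltaThree f ^ k := S.map_id _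
    rw [e, mul_smul, x23_pow_smul_mulTriple 𝕍 v u a hc, mul_smul, ← hid, ← locMap_smul, hb,
      mapLoc_id_locMk_one, locMk_smul]
  · have hW : (mulW 𝕍.V1 ^ N) (fun p q => 𝕍.vertexMode p v (𝕍.vertexMode q u a)) =
        𝕍.expandThree (𝕍.mulPair v c) := by
      funext p q
      rw [mulW_pow_apply, 𝕍.vertexMode_vertexMode v u a hc]
    have e : mulDelta 𝕍.V1 ^ (k + N) =
        mulGamma 𝕍.V1 ^ N * mulDelta 𝕍.V1 ^ k * mulW 𝕍.V1 ^ N := by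
      rw [(mulGamma_commute_mulDelta.pow_pow N k).eq, _root_.mul_assoc,
        ← mulGamma_commute_mulW.mul_pow, pow_add]
      rfl
    rw [e, Module.End.mul_apply, hW, Module.End.mul_apply, ← expandThree_deltaThree_pow_smul, hb,
      ← expandThree_gammaThree_pow_smul, taylorThree, locMk_smul]

/-- The triple product is symmetric, by associativity and commutativity. -/
theorem mapLoc_swapThree_mulTriple (v u a : 𝕍.V1) :
    𝕍.mapLoc swapThree presNEq_swapThree (𝕍.mulTriple v u a) = 𝕍.mulTriple u v a := by
  have h1 := 𝕍.mul_assoc ⊤ ⊤ ⊤ (locMk 1 v : loc 𝕍.V1 ⊤) (locMk 1 u) (locMk 1 a)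
  have h2 := 𝕍.mul_assoc ⊤ ⊤ ⊤ (locMk 1 u : loc 𝕍.V1 ⊤) (locMk 1 v) (locMk 1 a)
  have h3 := 𝕍.mul_map _ ⊤ _ ⊤ Sum.swap (presNEq_swap ⊤ ⊤) id (presNEq_top ⊤ id)
    (𝕍.mul ⊤ ⊤ (locMk 1 v : loc 𝕍.V1 ⊤) (locMk 1 u : loc 𝕍.V1 ⊤)) (locMk 1 a : loc 𝕍.V1 ⊤)
  rw [mapLoc_id_locMk_one, 𝕍.mul_comm] at h3
  rw [h3] at h2
  refine (congrArg (𝕍.mapLoc swapThree presNEq_swapThree) h1.symm).trans (Eq.trans ?_ h2)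
  refine (𝕍.mapLoc_mapLoc _ _ _ _ (Equiv.sumAssoc Unit Unit Unit ∘ Sum.map Sum.swap id)
    (PresNEq.comp (presNEq_assoc ⊤ ⊤ ⊤) (presNEq_map (presNEq_swap ⊤ ⊤) (presNEq_top ⊤ id)))
    ?_ _).trans (𝕍.mapLoc_mapLoc _ _ _ _ _ _ rfl _).symm
  funext k
  rcases k with (⟨⟩ | ⟨⟩) | ⟨⟩ <;> rfl

/-- Locality: `(z - w)^n Y(v, z) Y(u, w) a = (z - w)^n Y(u, w) Y(v, z) a`. -/
theorem vertexMode_locality (v u a : 𝕍.V1) : ∃ n : ℕ,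
    ((mulZ 𝕍.V1 - mulW 𝕍.V1) ^ n)
        (fun p q => 𝕍.vertexMode p v (𝕍.vertexMode q u a)) =
      ((mulZ 𝕍.V1 - mulW 𝕍.V1) ^ n)
        (fun p q => 𝕍.vertexMode q u (𝕍.vertexMode p v a)) := by
  obtain ⟨k, b, hb, hB⟩ := 𝕍.exists_deltaThree_pow_smul_mulTriple u v a
  obtain ⟨l, c, hc, hC⟩ := 𝕍.exists_deltaThree_pow_smul_mulTriple v u a
  set F : ℤ → ℤ → 𝕍.V1 := fun p q => 𝕍.vertexMode p u (𝕍.vertexMode q v a)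
  set G : ℤ → ℤ → 𝕍.V1 := fun p q => 𝕍.vertexMode p v (𝕍.vertexMode q u a)
  have hid : ∀ n : ℕ, S.map swapThree (deltaThree f ^ n) = deltaThree f ^ n := fun n => by
    rw [map_pow, map_swapThree_deltaThree]
  -- Up to powers of `deltaThree f`, the elements `c` and `b` of `V(1, 2, 3)` represent the same
  -- triple product, so that they agree up to torsion after the exchange of `1` and `2`.
  have h1 : locMk (r := rTriple) 1 (deltaThree f ^ k • c) =
      locMk 1 (deltaThree f ^ l • 𝕍.map swapThree b) := by
    have hs : 𝕍.mapLoc swapThree presNEq_swapThree (locMk 1 b) =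
        locMk 1 (𝕍.map swapThree b) := by
      rw [locMap_mk, map_one]
    rw [locMk_smul, locMk_smul, ← hc, ← hs, ← hb, locMap_smul, hid, mapLoc_swapThree_mulTriple,
      smul_smul, smul_smul, _root_.mul_comm]
  obtain ⟨m, hm⟩ := exists_pow_smul_eq_of_locMk_one_eq sub_dvd_deltaThree h1
  -- Torsion is killed by the Taylor expansion, as `z` and `w` act injectively.
  have hflip : flipZW 𝕍.V1 ((mulDelta 𝕍.V1 ^ k) F) = (mulDelta 𝕍.V1 ^ k) (flipZW 𝕍.V1 F) := by
    rw [← Module.End.mul_apply, (flipZW_commute_mulDelta.pow_right k).eq, Module.End.mul_apply]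
  have h2 := congrArg 𝕍.taylorThree hm
  rw [smul_smul, smul_smul, ← pow_add, ← pow_add, taylorThree_deltaThree_pow_smul,
    taylorThree_deltaThree_pow_smul, taylorThree_swapThree, ← hC, ← hB, hflip,
    ← Module.End.mul_apply, ← pow_add, ← Module.End.mul_apply, ← pow_add] at h2
  have e : m + k + l = m + l + k := by ring
  rw [e, mulDelta_pow, _root_.mul_assoc, Module.End.mul_apply, Module.End.mul_apply,
    Module.End.mul_apply, Module.End.mul_apply] at h2
  have h3 := mulW_pow_injective _ (mulZ_pow_injective _ h2)
  refine ⟨2 * (m + l + k), ?_⟩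
  exact h3

end AHSVertexAlgebra

/-! ### The vertex algebra over `X` and its chiral bracket -/

namespace DMod

/-- Maps out of `j_* j^* (M ⊠ N)` are determined by their values on the elements `h (m ⊠ n)`. -/
theorem hom_loc_box_ext {M N : LeftDMod.{u} f Unit} {P : LeftDMod.{u} f Two}
    {φ ψ : Hom (loc (box M N) r12) P}
    (h : ∀ t m n, φ (locMk t (boxMk m n)) = ψ (locMk t (boxMk m n))) : φ = ψ := by
  have key : ∀ z, φ z = ψ z := by
    intro z
    induction z using loc_induction with
    | h0 => simp only [map_zero]
    | ha a b h1 h2 => simp only [map_add, h1, h2]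
    | hm t m =>
      induction m using box_induction generalizing t with
      | h0 => rw [locMk_zero]; simp only [map_zero]
      | ha a b h1 h2 => rw [locMk_add]; simp only [map_add, h1, h2]
      | hm s v u => rw [locMk_smul, smul_locMk', h]
  exact Hom.ext (funext key)

end DMod

namespace AHSVertexAlgebra

variable (𝕍 : AHSVertexAlgebra.{u} f)

/-- The vertex algebra `Φ_X(𝕍)` over `X` on `𝒱(1)`. -/
def vertexAlgebraOver : VertexAlgebraOver 𝕍.V1 where
  vac := 𝕍.vacuum
  mode := 𝕍.vertexMode
  truncation := 𝕍.vertexMode_truncation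
  mode_vac := 𝕍.vertexMode_vacuum
  creation := 𝕍.vertexMode_vacuum_right
  creation_nonneg := 𝕍.vertexMode_vacuum_right_nonneg
  mode_T := 𝕍.vertexMode_D
  T_mode := 𝕍.D_vertexMode
  locality v u a := by
    obtain ⟨N, hN⟩ := 𝕍.vertexMode_locality v u a
    refine ⟨N, fun m n => ?_⟩
    have h := congrFun (congrFun hN m) n
    rwa [mulZ_sub_mulW_pow_apply, mulZ_sub_mulW_pow_apply] at h
  mode_smul_smul := 𝕍.vertexMode_smul_smul

theorem isPhi_vertexAlgebraOver : 𝕍.IsPhi 𝕍.vertexAlgebraOver where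
  vac := rfl
  mode v u N a h i := by
    change 𝕍.vertexMode _ v u = _
    have e : (N : ℤ) - i - 1 - N = -i - 1 := by ring
    rw [vertexMode_apply, h, expand_locMk, e, taylorTwo, taylor_neg]
  mode_eq_zero v u N a h n hn := by
    change 𝕍.vertexMode n v u = 0
    rw [vertexMode_apply, h, expand_locMk, taylorTwo, taylor_nonneg _ _ _ (by omega)]

variable {𝕍}

theorem IsPhi.mode_eq {W : VertexAlgebraOver 𝕍.V1} (hW : 𝕍.IsPhi W) : W.mode = 𝕍.vertexMode := by
  funext n
  ext v u
  obtain ⟨⟨N, a⟩, h⟩ := 𝕍.exists_eq_locMk (𝕍.mul12 v u)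
  have hV := 𝕍.isPhi_vertexAlgebraOver
  by_cases hn : (N : ℤ) ≤ n
  · exact (hW.mode_eq_zero v u N a h n hn).trans (hV.mode_eq_zero v u N a h n hn).symm
  · obtain ⟨i, rfl⟩ : ∃ i : ℕ, n = N - i - 1 := ⟨(N - n - 1).toNat, by omega⟩
    exact (hW.mode v u N a h i).trans (hV.mode v u N a h i).symm

theorem IsPhi.eq_vertexAlgebraOver {W : VertexAlgebraOver 𝕍.V1} (hW : 𝕍.IsPhi W) :
    W = 𝕍.vertexAlgebraOver := by
  have h1 := hW.vac
  have h2 := hW.mode_eq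
  cases W
  simp only at h1 h2
  subst h1 h2
  rfl

/-- Both brackets send `h (v ⊠ u)`, where `μ₁₂(v ⊗ u) = (x_1 - x_2)^{-N} a`, to the class of
`∑_i (1 / i!) h (x_1 - x_2)^{i - N} α_*(∂_1^i a)`. -/
theorem IsPhi.lambdaCh_eq {W : VertexAlgebraOver 𝕍.V1} (hW : 𝕍.IsPhi W) :
    W.lambdaCh = (pushHom 𝕍.alphaTilde).comp ((gamma 𝕍.V12).comp 𝕍.mulLoc) := by
  refine hom_loc_box_ext fun t v u => ?_
  obtain ⟨⟨N, a⟩, h⟩ := 𝕍.exists_eq_locMk (𝕍.mul12 v u)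
  have hmul : 𝕍.mulLoc (locMk t (boxMk v u)) = locMk (t * z12 f (-N)) a := by
    refine (locLift_mk _ t _).trans ?_
    rw [mulBox_mk, h, smul_locMk]
  have hα : ∀ i : ℕ, 𝕍.alphaTilde (invFact f Unit i • bar ((𝕍.V12.D p1)^[i] a)) =
      W.mode (N - i - 1) v u := by
    intro i
    rw [hW.mode v u N a h i, _root_.map_smul]
    refine congrArg (invFact f Unit i • ·) ((pullLift_mk _ _ _ _ _).trans (one_smul _ _))
  obtain ⟨L, hL⟩ := gammaFun_eq_sum (M := 𝕍.V12) (t * z12 f (-N))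
  obtain ⟨R, hR⟩ := exists_regular t
  -- For `i ≥ n` the function `t (x_1 - x_2)^{i - N}` is regular along the diagonal, so both sums
  -- may be cut off there.
  set n := max L (R + N).toNat
  have hpole : ∀ i : ℕ, t * z12 f (-N) * z12 f i = t * z12 f (-((N : ℤ) - i - 1) - 1) := by
    intro i
    rw [_root_.mul_assoc, ← z12_add]
    congr 2
    ring
  change W.lamLin _ = pushHom 𝕍.alphaTilde (gamma 𝕍.V12 (𝕍.mulLoc _))
  rw [hmul, W.lamLin_mk]
  change _ = pushHom 𝕍.alphaTilde (gammaFun (t * z12 f (-N)) a)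
  rw [hL n (le_max_left _ _), map_sum, VertexAlgebraOver.lamFun]
  have hinj : Set.InjOn (fun i : ℕ => (N : ℤ) - i - 1) (Finset.range n) := by
    intro i _ j _ hij
    simp only at hij
    omega
  rw [finsum_eq_sum_of_support_subset (s := (Finset.range n).image fun i : ℕ => (N : ℤ) - i - 1),
    Finset.sum_image hinj]
  · refine Finset.sum_congr rfl fun i _ => ?_
    rw [gammaTerm, pushHom_pole, hα, hpole]
  · intro k hk
    by_contra hlt
    refine hk ?_
    simp only
    by_cases hkN : (N : ℤ) ≤ k
    · rw [hW.mode_eq_zero v u N a h k hkN, pole_zero_right]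
    · have hk2 : (n : ℤ) ≤ N - k - 1 := by
        by_contra hlt2
        refine hlt ?_
        rw [Finset.coe_image]
        exact ⟨(N - k - 1).toNat, by simp only [Finset.coe_range, Set.mem_Iio]; omega, by
          simp only; omega⟩
      obtain ⟨s, hs⟩ := hR (-k - 1) (by omega)
      rw [hs, pole_regular]

theorem IsPhi.Psi_eq {W : VertexAlgebraOver 𝕍.V1} (hW : 𝕍.IsPhi W) : W.Psi = 𝕍.chiral0 := by
  rw [VertexAlgebraOver.Psi, chiral0, hW.lambdaCh_eq]

end AHSVertexAlgebra

end AHS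

end

theorem mainTheorem3 (f : Polynomial ℂ) (𝕍 : AHS.AHSVertexAlgebra f) :
    (∃! W : AHS.VertexAlgebraOver 𝕍.V1, 𝕍.IsPhi W) ∧
      ∀ W : AHS.VertexAlgebraOver 𝕍.V1, 𝕍.IsPhi W → W.Psi = 𝕍.chiral0 :=
  ⟨⟨𝕍.vertexAlgebraOver, 𝕍.isPhi_vertexAlgebraOver, fun _ hW => hW.eq_vertexAlgebraOver⟩,
    fun _ hW => hW.Psi_eq⟩
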